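/- **Setting.** Let $\Gamma\subset\mathbb R^d$ be a smooth, compact (without boundary), connected, embedded hypersurface. Let $m(u)=(1-u^2)^i\tilde m(u)$ with $i\in\mathbb N_0$, $\tilde m\in C^\infty([-1,1])$, $\tilde m>0$ on $[-1,1]$; let $n,A,\tau\in C^\infty([-1,1])$ with $n,n'\neq0$ a.e., $A^2\tau>0$ on $(-1,1)$ and $\inf_{(-1,1)}\frac{n^2}{A^2\tau\sqrt{1-u^2}}>0$. Put $$\mathsf a=\frac1{A^2\tau}\Big(\frac{n^2}{n'}\Big)^2\frac1{\sqrt{1-u^2}},\quad \mathsf m=\frac{m}{\sqrt{1-u^2}},\quad \sigma=\int_{-1}^1\sqrt{1-u^2}\,du,\quad \delta=4\Big(\int_{-1}^1\mathsf m\,du\Big)^{-1},$$ $$\mathcal C f=\int_{-1}^1\Big(f+\frac n{n'}\partial_uf\Big)du,\qquad (f,g)_{\mathcal E}=\int_\Gamma\int_{-1}^1\big(\mathsf a\,\partial_uf\,\partial_ug+\mathsf m\,\nabla_\Gamma f\cdot\nabla_\Gamma g\big)\,du\,d\mathcal H^{d-1}.$$ Let $H$ be the completion of $\{f\in C^\infty(\Gamma\times[-1,1]):\sqrt{\mathsf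 a}\,\partial_uf\in L^2(\Gamma\times[-1,1]),\ \mathcal Cf\in H^1(\Gamma)\}$ with respect to $\|f\|_H^2=(f,f)_{\mathcal E}+\|\mathcal Cf\|^2_{H^1(\Gamma)}$, where $H^1(\Gamma)$ is the closure of $C^\infty(\Gamma)$ in the $H^1$-norm; $\mathcal C$, $(\cdot,\cdot)_{\mathcal E}$ and $\sqrt{\mathsf m}\,\nabla_\Gamma$ extend continuously to $H$. Let $H^2(\Gamma)=\{\kappa\in H^1(\Gamma):\Delta_\Gamma\kappa\in L^2(\Gamma)\}$. **Proposition 5.1.** For every $\kappa\in H^1(\Gamma)$ there is a unique couple $(f,V)\in H\times H^1(\Gamma)^*$ with $\mathcal Cf=\sigma\kappa$ and $(f,\varphi)_{\mathcal E}=\langle V,\mathcal C\varphi\rangle$ for all $\varphi\in H$; write $\mathcal F\kappa:=f$. The propagation operator $\mathcal G_\Gamma\kappa:=-\frac12\Delta_\Gamma\int_{-1}^1\mathsf m\,\mathcal F\kappa\,du$, i.e. $\langle\mathcal G_\Gamma\kappa,\psi\rangle=\frac12\int_\Gamma\big(\int_{-1}^1\mathsf m\nabla_\Gamma\mathcal F\kappa\,du\big)\cdot\nabla_\Gamma\psi\,d\mathcal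 H^{d-1}$ for $\psi\in H^1(\Gamma)$, maps $H^2(\Gamma)$ linearly into $L^2(\Gamma)$, and: 1. *Symmetry.* $(\mathcal G_\Gamma h,\kappa)_{L^2(\Gamma)}=(h,\mathcal G_\Gamma\kappa)_{L^2(\Gamma)}$ for all $h,\kappa\in H^2(\Gamma)$. 2. *Invariance.* $1_\Gamma\in H^2(\Gamma)$ and $\mathcal G_\Gamma1_\Gamma=0$. 3. *Positivity.* $(\mathcal G_\Gamma\kappa,\kappa)_{L^2(\Gamma)}\ge0$ for all $\kappa\in H^2(\Gamma)$. If $\kappa\in H^2(\Gamma)$ is (a.e.) constant, then $(\mathcal G_\Gamma\kappa,\kappa)_{L^2(\Gamma)}=0$. Conversely, provided that $i\le1$ or that $n$ does not vanish to infinite order at $u=1$ nor at $u=-1$, $(\mathcal G_\Gamma\kappa,\kappa)_{L^2(\Gamma)}=0$ with $\kappa\in H^2(\Gamma)$ implies that $\kappa$ is constant a.e. on $\Gamma$. 4. *Upper bound.* $(\mathcal G_\Gamma\kappa,\kappa)_{L^2(\Gamma)}\le\big(-\frac\sigma\delta\Delta_\Gamma\kappa,\kappa\big)_{L^2(\Gamma)}$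 for all $\kappa\in H^2(\Gamma)$. -/

import Mathlib

open MeasureTheory Set
open scoped ContDiff RealInnerProductSpace

noncomputable section

namespace PropOp

/-- Euclidean space `ℝ^d`. -/
abbrev E (d : ℕ) : Type := EuclideanSpace ℝ (Fin d)

/-! ### The hypersurface -/

/-- `Γ ⊂ ℝ^d` is a smooth, compact (without boundary), connected, embedded hypersurface:
near each of its points it is the zero set of a smooth function with nonvanishing derivative. -/
structure IsClosedHypersurface {d : ℕ} (Γ : Set (E d)) : Prop where
  isCompact : IsCompact Γ
  isConnected : IsConnected Γ
  locally_zeroSet : ∀ x ∈ Γ, ∃ U : Set (E d), IsOpen U ∧ x ∈ U ∧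
    ∃ φ : E d → ℝ, ContDiffOn ℝ ∞ φ U ∧ (∀ y ∈ U, fderiv ℝ φ y ≠ 0) ∧
      ∀ y ∈ U, (y ∈ Γ ↔ φ y = 0)

/-- Surface measure: the `(d-1)`-dimensional Hausdorff measure on `Γ`, normalised so that it is
Lebesgue measure on flat pieces. -/
def surfaceMeasure {d : ℕ} (Γ : Set (E d)) : Measure (E d) :=
  (μHE[d - 1] : Measure (E d)).restrict Γ

/-- The tangent space of `Γ` at `x`, as a subspace of `ℝ^d`. -/
def tangentSpaceAt {d : ℕ} (Γ : Set (E d)) (x : E d) : Submodule ℝ (E d) :=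
  Submodule.span ℝ (tangentConeAt ℝ Γ x)

/-- The tangential gradient `∇_Γ f (x)` of (the restriction to `Γ` of) a smooth function `f` on
`ℝ^d`: the orthogonal projection of the gradient onto the tangent space. Every smooth function
on a closed embedded hypersurface is such a restriction. -/
def tangentialGradient {d : ℕ} (Γ : Set (E d)) (f : E d → ℝ) (x : E d) : E d :=
  (tangentSpaceAt Γ x).starProjection (gradient f x)

/-! ### Sobolev spaces on `Γ` -/

/-- `L²(Γ)`. -/
abbrev L2 {d : ℕ} (Γ : Set (E d)) : Type := Lp ℝ 2 (surfaceMeasure Γ)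

/-- `L²(Γ; ℝ^d)`. -/
abbrev L2vec {d : ℕ} (Γ : Set (E d)) : Type := Lp (E d) 2 (surfaceMeasure Γ)

/-- `H¹(Γ)`, the completion of `C^∞(Γ)` in the `H¹`-norm, realised inside
`L²(Γ) × L²(Γ; ℝ^d)`: the closure of the set of all pairs `(f, ∇_Γ f)` with `f` smooth.
An element `κ` is thus the pair of the function `κ` and its weak tangential gradient.
(The generating set is already a linear subspace.) -/
def H1 {d : ℕ} (Γ : Set (E d)) : Submodule ℝ (L2 Γ × L2vec Γ) :=
  (Submodule.span ℝ {v | ∃ f : E d → ℝ, ContDiff ℝ ∞ f ∧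
    v.1 =ᵐ[surfaceMeasure Γ] f ∧
    v.2 =ᵐ[surfaceMeasure Γ] tangentialGradient Γ f}).topologicalClosure

/-- The function in `L²(Γ)` underlying an element of `H¹(Γ)`. -/
def H1fn {d : ℕ} {Γ : Set (E d)} (κ : H1 Γ) : L2 Γ := κ.1.1

/-- The weak tangential gradient of an element of `H¹(Γ)`. -/
def H1grad {d : ℕ} {Γ : Set (E d)} (κ : H1 Γ) : L2vec Γ := κ.1.2

/-- `g = Δ_Γ κ` weakly: `∫_Γ ∇_Γ κ · ∇_Γ ψ = - ∫_Γ g ψ` for all `ψ ∈ H¹(Γ)`. -/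
def IsLaplacian {d : ℕ} {Γ : Set (E d)} (κ : H1 Γ) (g : L2 Γ) : Prop :=
  ∀ ψ : H1 Γ, ⟪H1grad κ, H1grad ψ⟫ = -⟪g, H1fn ψ⟫

/-- `H²(Γ)`, the domain of the Laplace-Beltrami operator in `L²(Γ)`: all `κ ∈ H¹(Γ)` with
`Δ_Γ κ ∈ L²(Γ)`. -/
def H2 {d : ℕ} (Γ : Set (E d)) : Submodule ℝ (H1 Γ) where
  carrier := {κ | ∃ g : L2 Γ, IsLaplacian κ g}
  zero_mem' := by
    refine ⟨0, ?_⟩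
    intro ψ
    simp [H1grad]
  add_mem' := by
    rintro a b ⟨g, hg⟩ ⟨h, hh⟩
    refine ⟨g + h, ?_⟩
    intro ψ
    have h1 := hg ψ
    have h2 := hh ψ
    simp only [H1grad, H1fn, Submodule.coe_add, Prod.snd_add, inner_add_left] at *
    linarith
  smul_mem' := by
    rintro r a ⟨g, hg⟩
    refine ⟨r • g, ?_⟩
    intro ψ
    have h1 := hg ψ
    simp only [H1grad, H1fn, Submodule.coe_smul, Prod.smul_snd, real_inner_smul_left] at *
    rw [h1]
    ring

/-- The function in `L²(Γ)` underlying an element of `H²(Γ)`. -/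
def H2fn {d : ℕ} {Γ : Set (E d)} (κ : H2 Γ) : L2 Γ := H1fn κ.1

/-- `Δ_Γ κ ∈ L²(Γ)` for `κ ∈ H²(Γ)`. -/
def laplacian {d : ℕ} {Γ : Set (E d)} (κ : H2 Γ) : L2 Γ :=
  Classical.choose (show ∃ g : L2 Γ, IsLaplacian κ.1 g from κ.2)

/-! ### Coefficient functions -/

/-- The coefficient functions on `[-1,1]`: the mobility `m`, the coupling function `n`, the bulk
modulus `A` and the relaxation time `τ`. Only values on `[-1,1]` matter. -/
structure Coefficients where
  m : ℝ → ℝ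
  n : ℝ → ℝ
  A : ℝ → ℝ
  τ : ℝ → ℝ

namespace Coefficients

variable (c : Coefficients)

/-- The derivative `n'` on `[-1,1]` (one-sided at the endpoints). -/
def dn (u : ℝ) : ℝ := derivWithin c.n (Icc (-1) 1) u

/-- The product `A²τ`. -/
def Asqτ (u : ℝ) : ℝ := c.A u ^ 2 * c.τ u

/-- `𝖺(u) = (1/(A²τ)) (n²/n')² / √(1-u²)`. -/
def wa (u : ℝ) : ℝ := (1 / c.Asqτ u * (c.n u ^ 2 / c.dn u) ^ 2) * (1 / √(1 - u ^ 2))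

/-- `𝗆(u) = m(u) / √(1-u²)`. -/
def wm (u : ℝ) : ℝ := c.m u / √(1 - u ^ 2)

/-- `δ = 4 (∫_{-1}^1 m(u)/√(1-u²) du)⁻¹`. -/
def δ : ℝ := 4 * (∫ u in Icc (-1 : ℝ) 1, c.wm u)⁻¹

/-- The hypotheses on the coefficients, with `i` the order of degeneracy of the mobility. -/
structure Admissible (i : ℕ) : Prop where
  mobility : ∃ mt : ℝ → ℝ, ContDiffOn ℝ ∞ mt (Icc (-1) 1) ∧ (∀ u ∈ Icc (-1 : ℝ) 1, 0 < mt u) ∧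
    ∀ u ∈ Icc (-1 : ℝ) 1, c.m u = (1 - u ^ 2) ^ i * mt u
  smooth_n : ContDiffOn ℝ ∞ c.n (Icc (-1) 1)
  smooth_A : ContDiffOn ℝ ∞ c.A (Icc (-1) 1)
  smooth_τ : ContDiffOn ℝ ∞ c.τ (Icc (-1) 1)
  n_ne : ∀ᵐ u ∂volume.restrict (Icc (-1 : ℝ) 1), c.n u ≠ 0 ∧ c.dn u ≠ 0
  Asqτ_pos : ∀ u ∈ Ioo (-1 : ℝ) 1, 0 < c.Asqτ u
  iota_pos : ∃ ι : ℝ, 0 < ι ∧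
    ∀ u ∈ Ioo (-1 : ℝ) 1, ι ≤ c.n u ^ 2 / (c.Asqτ u * √(1 - u ^ 2))

/-- `n` does not vanish to infinite order at `1` nor at `-1`. -/
def NotFlat : Prop :=
  (∃ k : ℕ, iteratedDerivWithin k c.n (Icc (-1) 1) 1 ≠ 0) ∧
  (∃ k : ℕ, iteratedDerivWithin k c.n (Icc (-1) 1) (-1) ≠ 0)

end Coefficients

/-- `σ = ∫_{-1}^1 √(1-u²) du`. -/
def σ : ℝ := ∫ u in Icc (-1 : ℝ) 1, √(1 - u ^ 2)

/-! ### The energy space -/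

/-- The product of surface measure and Lebesgue measure on `Γ × [-1,1]`. -/
def cylMeasure {d : ℕ} (Γ : Set (E d)) : Measure (E d × ℝ) :=
  (surfaceMeasure Γ).prod (volume.restrict (Icc (-1 : ℝ) 1))

/-- The partial derivative `∂_u f (s,u)`. -/
def du {d : ℕ} (f : E d × ℝ → ℝ) (x : E d × ℝ) : ℝ := deriv (fun v => f (x.1, v)) x.2

/-- The tangential gradient `∇_Γ f (s,u)` in the variable `s`. -/
def tgrad {d : ℕ} (Γ : Set (E d)) (f : E d × ℝ → ℝ) (x : E d × ℝ) : E d :=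
  tangentialGradient Γ (fun y => f (y, x.2)) x.1

/-- The constraint `𝒞f(s) = ∫_{-1}^1 (f + (n/n') ∂_u f) du` for smooth `f`. -/
def constraintFn {d : ℕ} (c : Coefficients) (f : E d × ℝ → ℝ) (s : E d) : ℝ :=
  ∫ u in Icc (-1 : ℝ) 1, (f (s, u) + c.n u / c.dn u * du f (s, u))

/-- The Hilbert space `H`: the completion of
`{f ∈ C^∞(Γ × [-1,1]) : √𝖺 ∂_u f ∈ L², 𝒞f ∈ H¹(Γ)}` with respect to the norm
`‖f‖_H² = ∫∫ (𝖺 |∂_u f|² + 𝗆 |∇_Γ f|²) du dℋ^{d-1} + ‖𝒞f‖²_{H¹(Γ)}`. It is realised as the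
closure of all triples `(√𝖺 ∂_u f, √𝗆 ∇_Γ f, 𝒞f)` in `L² × L² × H¹(Γ)`; the norm above is
equivalent to the one induced from the product. (Under the standing hypotheses the generating
set is already a linear subspace.) -/
def H {d : ℕ} (Γ : Set (E d)) (c : Coefficients) :
    Submodule ℝ (Lp ℝ 2 (cylMeasure Γ) × Lp (E d) 2 (cylMeasure Γ) × H1 Γ) :=
  (Submodule.span ℝ {v | ∃ f : E d × ℝ → ℝ, ContDiff ℝ ∞ f ∧
    v.1 =ᵐ[cylMeasure Γ] (fun x => √(c.wa x.2) * du f x) ∧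
    v.2.1 =ᵐ[cylMeasure Γ] (fun x => √(c.wm x.2) • tgrad Γ f x) ∧
    H1fn v.2.2 =ᵐ[surfaceMeasure Γ] constraintFn c f}).topologicalClosure

section EnergySpace

variable {d : ℕ} {Γ : Set (E d)} {c : Coefficients}

/-- `√𝖺 ∂_u f` for `f ∈ H`. -/
def Hwdu (f : H Γ c) : Lp ℝ 2 (cylMeasure Γ) := f.1.1

/-- `√𝗆 ∇_Γ f` for `f ∈ H`. -/
def Hwgrad (f : H Γ c) : Lp (E d) 2 (cylMeasure Γ) := f.1.2.1

/-- The extension `𝒞 : H → H¹(Γ)` of the constraint. -/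
def Hconstraint (f : H Γ c) : H1 Γ := f.1.2.2

/-- `(f,g)_ℰ = ∫∫ (𝖺 ∂_u f ∂_u g + 𝗆 ∇_Γ f · ∇_Γ g) du dℋ^{d-1}`. -/
def energyForm (f g : H Γ c) : ℝ := ⟪Hwdu f, Hwdu g⟫ + ⟪Hwgrad f, Hwgrad g⟫

end EnergySpace

/-! ### The solution operator and the propagation operator -/

/-- The couple `(f, V) ∈ H × H¹(Γ)*` solves the constrained elliptic problem with datum `κ`:
`𝒞f = σκ` in `H¹(Γ)`, and `(f,φ)_ℰ = ⟨V, 𝒞φ⟩` for all `φ ∈ H`. -/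
def IsSolution {d : ℕ} {Γ : Set (E d)} {c : Coefficients} (κ : H1 Γ)
    (f : H Γ c) (V : H1 Γ →L[ℝ] ℝ) : Prop :=
  Hconstraint f = σ • κ ∧ ∀ φ : H Γ c, energyForm f φ = V (Hconstraint φ)

/-- The solution operator `ℱ : H¹(Γ) → H`. -/
def solutionOp {d : ℕ} {Γ : Set (E d)} (c : Coefficients) (κ : H1 Γ) : H Γ c :=
  Classical.epsilon fun f => ∃ V : H1 Γ →L[ℝ] ℝ, IsSolution κ f V

/-- The propagation operator `𝒢_Γ κ = -½ Δ_Γ ∫_{-1}^1 𝗆 ℱκ du`, as a functional on `H¹(Γ)`: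
`⟨𝒢_Γ κ, ψ⟩ = ½ ∫_Γ (∫_{-1}^1 𝗆 ∇_Γ ℱκ du) · ∇_Γ ψ dℋ^{d-1}`, where
`𝗆 ∇_Γ ℱκ = √𝗆 (√𝗆 ∇_Γ ℱκ)`. -/
def propagation {d : ℕ} {Γ : Set (E d)} (c : Coefficients) (κ ψ : H1 Γ) : ℝ :=
  1 / 2 * ∫ s, ⟪∫ u in Icc (-1 : ℝ) 1, √(c.wm u) • Hwgrad (solutionOp c κ) (s, u), H1grad ψ s⟫
    ∂(surfaceMeasure Γ)

end PropOp

end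

open PropOp

/-!
The weighted derivatives `(√𝖺 ∂_u f, √𝗆 ∇_Γ f)` turn the energy form into the inner product of a
Hilbert space `X`, and the elements of `H` with vanishing constraint into a closed subspace `N` of it.
Let `Lκ = (0, √𝗆 ∇_Γ κ)` be the weighted derivatives of `κ` extended constantly in `u`; its constraint
is `2κ`. The constrained problem is then solved by minimising the energy: `ℱκ` is `σ/2` times the
projection of `Lκ` to the orthogonal complement of `N`, with `P` that projection, and
`⟨𝒢_Γ κ, ψ⟩ = (σ/4) ⟪P L κ, L ψ⟫` (`isSolution_solve`, `eq_of_isSolution`, `propagation_eq_form`).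
Symmetry, nonnegativity, the vanishing at constants and the upper bound can be read off from this
formula.

That `𝒢_Γ` takes `H²(Γ)` to `L²(Γ)` is a regularity statement in the tangential variable. The
resolvent `(1 - Δ_Γ)⁻¹` acts on functions on `Γ`, and `1 - ∇∇*`, with the adjoint taken in `H¹(Γ)`, is
its counterpart for gradients (`resolventVec_grad`); together they act on `X`. This action preserves `N`
(`resolventTriple_mem_H`), hence commutes with `P` (`proj_resolventEnergy`), so
the bounded operator on `H¹(Γ)` that represents `𝒢_Γ` is symmetric also for the inner product of
`L²(Γ)`. By Krein's theorem (`norm_apply_le_of_symmetric`) it is bounded in the norm of `L²(Γ)`, and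
`⟨𝒢_Γ κ, ψ⟩` is bounded by the `L²` norm of `ψ` as soon as `κ = (1 - Δ_Γ)⁻¹ g` with `g ∈ L²(Γ)`
(`exists_propagation_eq`). No local regularity theory is needed.

If the form vanishes on `κ`, then `(0, 0, κ) ∈ H`: smooth functions `f` with small energy have
constraints close to `κ`. Integration by parts against a weight `w` with `∫ (1 - w) = 0`
(`exists_weight`, `constraintFn_eq`) rewrites `𝒞f` as the vertical average `∫ w f du` up to a term
controlled by `√𝖺 ∂_u f`; if `w / √𝗆` is square integrable, then the tangential derivative of the
average is controlled by `√𝗆 ∇_Γ f`. For `i ≤ 1` one takes `w = 1`; otherwise `w` has to vanish at the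
endpoints, and the hypothesis that `n` is not flat there makes the remainder bounded by `n / n'`. In
local parametrisations of `Γ` the average thus changes little in `L¹` under translations of the
parameter, and in the limit `κ` is locally invariant under translations, so locally constant, and
constant because `Γ` is connected (`ae_const_of_mem_H`).
-/

noncomputable section

namespace PropOp

/-! ### Operators symmetric for a weaker inner product -/

section Functional

variable {X Y : Type*} [NormedAddCommGroup X] [InnerProductSpace ℝ X] [NormedAddCommGroup Y]
  [NormedSpace ℝ Y]

/-- Krein's theorem: a bounded operator that is symmetric for a weaker, possibly degenerate, inner
product `⟪ι ·, ι ·⟫` is bounded for the associated seminorm, with the same constant. The norms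
`‖ι (T^n h)‖` form a log-convex sequence that grows at most like `‖T‖^n`, so already the first
ratio is at most `‖T‖`. -/
theorem norm_apply_le_of_symmetric (ι : Y →L[ℝ] X) (T : Y →L[ℝ] Y)
    (hT : ∀ h k, ⟪ι (T h), ι k⟫ = ⟪ι h, ι (T k)⟫) (h : Y) : ‖ι (T h)‖ ≤ ‖T‖ * ‖ι h‖ := by
  set a : ℕ → ℝ := fun n => ‖ι ((T ^ n) h)‖ with ha
  have hstep : ∀ n, a (n + 1) ^ 2 ≤ a n * a (n + 2) := by
    intro n
    have h1 : ⟪ι ((T ^ (n + 1)) h), ι ((T ^ (n + 1)) h)⟫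
        = ⟪ι ((T ^ n) h), ι ((T ^ (n + 2)) h)⟫ := by
      have e1 : (T ^ (n + 1)) h = T ((T ^ n) h) := by rw [pow_succ']; rfl
      have e2 : (T ^ (n + 2)) h = T ((T ^ (n + 1)) h) := by rw [pow_succ']; rfl
      rw [e2, ← hT, ← e1]
    rw [real_inner_self_eq_norm_sq] at h1
    simp only [ha]
    rw [h1]
    exact real_inner_le_norm _ _
  have hbound : ∀ n, a n ≤ ‖ι‖ * ‖h‖ * ‖T‖ ^ n := by
    intro n
    have h1 : ‖(T ^ n) h‖ ≤ ‖T‖ ^ n * ‖h‖ := by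
      induction n with
      | zero => simp
      | succ n ih =>
        have e1 : (T ^ (n + 1)) h = T ((T ^ n) h) := by rw [pow_succ']; rfl
        rw [e1, pow_succ']
        calc ‖T ((T ^ n) h)‖ ≤ ‖T‖ * ‖(T ^ n) h‖ := T.le_opNorm _
          _ ≤ ‖T‖ * (‖T‖ ^ n * ‖h‖) := by gcongr
          _ = _ := by ring
    calc a n ≤ ‖ι‖ * ‖(T ^ n) h‖ := ι.le_opNorm _
      _ ≤ ‖ι‖ * (‖T‖ ^ n * ‖h‖) := by gcongr
      _ = _ := by ring
  have ha0 : a 0 = ‖ι h‖ := by simp [ha]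
  have ha1 : a 1 = ‖ι (T h)‖ := by simp [ha]
  have hnn : ∀ n, 0 ≤ a n := fun n => norm_nonneg _
  rw [← ha0, ← ha1]
  by_contra! hlt
  rcases (hnn 0).eq_or_lt with h0 | h0
  · have := hstep 0
    rw [← h0, zero_mul] at this
    have h1 : a 1 = 0 := by nlinarith [hnn 1]
    rw [h1, ← h0] at hlt
    simp at hlt
  set r := a 1 / a 0 with hr
  have hTr : ‖T‖ < r := by rwa [hr, lt_div_iff₀ h0]
  have hr0 : 0 < r := (norm_nonneg _).trans_lt hTr
  have hgrow : ∀ n, 0 < a n ∧ r * a n ≤ a (n + 1) := by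
    intro n
    induction n with
    | zero => exact ⟨h0, by rw [hr, div_mul_cancel₀ _ h0.ne']⟩
    | succ n ih =>
      have hp : 0 < a (n + 1) := (mul_pos hr0 ih.1).trans_le ih.2
      refine ⟨hp, ?_⟩
      have h1 := hstep n
      have h2 : a n * (r * a (n + 1)) ≤ a n * a (n + 2) := by nlinarith [ih.2]
      exact le_of_mul_le_mul_left h2 ih.1
  have hpow : ∀ n, r ^ n * a 0 ≤ a n := by
    intro n
    induction n with
    | zero => simp
    | succ n ih =>
      calc r ^ (n + 1) * a 0 = r * (r ^ n * a 0) := by ring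
        _ ≤ r * a n := by gcongr
        _ ≤ _ := (hgrow n).2
  have hle : ∀ n : ℕ, a 0 ≤ ‖ι‖ * ‖h‖ * (‖T‖ / r) ^ n := by
    intro n
    rw [div_pow, mul_div_assoc', le_div_iff₀ (by positivity), mul_comm]
    exact (hpow n).trans (hbound n)
  have hlim : Filter.Tendsto (fun n : ℕ => ‖ι‖ * ‖h‖ * (‖T‖ / r) ^ n) Filter.atTop
      (nhds (‖ι‖ * ‖h‖ * 0)) :=
    (tendsto_pow_atTop_nhds_zero_of_lt_one (by positivity)
      (by rwa [div_lt_one hr0])).const_mul _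
  have := ge_of_tendsto' hlim hle
  rw [mul_zero] at this
  linarith

/-- A linear functional dominated by `‖ι ·‖` is represented by a vector in the closure of the range
of `ι`. -/
theorem exists_inner_eq_of_le_norm [CompleteSpace X] (ι : Y →L[ℝ] X) (ℓ : Y →ₗ[ℝ] ℝ) (C : ℝ)
    (hℓ : ∀ y, |ℓ y| ≤ C * ‖ι y‖) :
    ∃ g ∈ (LinearMap.range ι.toLinearMap).topologicalClosure, ∀ y, ℓ y = ⟪g, ι y⟫ := by
  set K := (LinearMap.range ι.toLinearMap).topologicalClosure with hK
  have : CompleteSpace K :=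
    (Submodule.isClosed_topologicalClosure _).completeSpace_coe
  have hmem : ∀ y, ι y ∈ K := fun y => Submodule.le_topologicalClosure _ ⟨y, rfl⟩
  let e : Y →ₗ[ℝ] K := ι.toLinearMap.codRestrict K hmem
  have hd : DenseRange e := by
    rw [DenseRange, dense_iff_closure_eq, Set.eq_univ_iff_forall]
    intro x
    rw [closure_subtype]
    have hx : (x : X) ∈ closure (LinearMap.range ι.toLinearMap : Set X) := x.2
    refine closure_mono ?_ hx
    rintro _ ⟨y, rfl⟩
    exact ⟨e y, ⟨y, rfl⟩, rfl⟩
  have hx : ∀ y, ℓ.extendOfNorm e (e y) = ℓ y :=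
    LinearMap.extendOfNorm_eq hd ⟨C, hℓ⟩
  refine ⟨((InnerProductSpace.toDual ℝ K).symm (ℓ.extendOfNorm e) : K), Subtype.coe_prop _, ?_⟩
  intro y
  rw [← hx y, ← InnerProductSpace.toDual_symm_apply (𝕜 := ℝ)]
  rfl

/-- Two vectors of the closure of a subspace that have the same inner products with the subspace
are equal. -/
theorem eq_of_mem_closure_of_inner_eq {S : Submodule ℝ X} {g g' : X}
    (hg : g ∈ S.topologicalClosure) (hg' : g' ∈ S.topologicalClosure)
    (h : ∀ x ∈ S, ⟪g, x⟫ = ⟪g', x⟫) : g = g' := by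
  have hcl : ∀ x ∈ S.topologicalClosure, ⟪g - g', x⟫ = 0 := by
    intro x hx
    have hc : IsClosed {x : X | ⟪g - g', x⟫ = 0} :=
      isClosed_eq (by fun_prop) continuous_const
    have hsub : (S : Set X) ⊆ {x : X | ⟪g - g', x⟫ = 0} := by
      intro x hx
      simp [inner_sub_left, h x hx]
    exact closure_minimal hsub hc hx
  have := hcl _ (S.topologicalClosure.sub_mem hg hg')
  rw [inner_self_eq_zero] at this
  exact sub_eq_zero.1 this

end Functional

/-! ### Square integrable functions on a product -/

/-- An orthonormal basis of a separable Hilbert space is countable. -/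
theorem countable_of_hilbertBasis {ι X : Type*} [NormedAddCommGroup X] [InnerProductSpace ℝ X]
    [SecondCountableTopology X] (b : HilbertBasis ι ℝ X) : Countable ι := by
  have hdist : ∀ i j, i ≠ j → 1 ≤ dist (b i) (b j) := by
    intro i j hij
    have h1 : ⟪b i, b i - b j⟫ = (1 : ℝ) := by
      rw [inner_sub_right, real_inner_self_eq_norm_sq, b.orthonormal.1 i, b.orthonormal.2 hij]
      norm_num
    have h2 := real_inner_le_norm (b i) (b i - b j)
    rw [h1, b.orthonormal.1 i, one_mul] at h2
    rwa [dist_eq_norm]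
  have hdisj : (univ : Set ι).PairwiseDisjoint fun i => Metric.ball (b i) (1 / 2) := by
    intro i _ j _ hij
    refine Metric.ball_disjoint_ball ?_
    linarith [hdist i j hij]
  exact countable_univ_iff.1 (hdisj.countable_of_isOpen (fun i _ => Metric.isOpen_ball)
    (fun i _ => ⟨b i, Metric.mem_ball_self (by norm_num)⟩))

section Tensor

variable {α β : Type*} [MeasurableSpace α] [MeasurableSpace β] {μ : Measure α} {ν : Measure β}
variable {F : Type*} [NormedAddCommGroup F] [InnerProductSpace ℝ F]

theorem memLp_tensor (x : Lp F 2 μ) (p : Lp ℝ 2 ν) :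
    MemLp (fun z : α × β => p z.2 • x z.1) 2 (μ.prod ν) := by
  have hm : AEStronglyMeasurable (fun z : α × β => p z.2 • x z.1) (μ.prod ν) :=
    (Lp.aestronglyMeasurable p).comp_snd.smul (Lp.aestronglyMeasurable x).comp_fst
  rw [memLp_two_iff_integrable_sq_norm hm]
  have h1 := (memLp_two_iff_integrable_sq_norm (Lp.aestronglyMeasurable x)).1 (Lp.memLp x)
  have h2 := (memLp_two_iff_integrable_sq_norm (Lp.aestronglyMeasurable p)).1 (Lp.memLp p)
  refine (h1.mul_prod h2).congr (Filter.Eventually.of_forall fun z => ?_)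
  simp only [norm_smul, mul_pow]
  ring

/-- The elementary tensor `(s, u) ↦ p(u) x(s)`. -/
def tensor (x : Lp F 2 μ) (p : Lp ℝ 2 ν) : Lp F 2 (μ.prod ν) := (memLp_tensor x p).toLp

theorem coeFn_tensor (x : Lp F 2 μ) (p : Lp ℝ 2 ν) :
    tensor x p =ᵐ[μ.prod ν] fun z => p z.2 • x z.1 := (memLp_tensor x p).coeFn_toLp

end Tensor

section ProductL2

variable {α β : Type*} [MeasurableSpace α] [MeasurableSpace β] {μ : Measure α} {ν : Measure β}
  [SFinite μ] [SFinite ν]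
variable {F G : Type*} [NormedAddCommGroup F] [NormedAddCommGroup G]

theorem ae_ae_of_ae_prod_swap {p : α × β → Prop} (h : ∀ᵐ z ∂μ.prod ν, p z) :
    ∀ᵐ u ∂ν, ∀ᵐ s ∂μ, p (s, u) := by
  rw [← Measure.prod_swap] at h
  exact Measure.ae_ae_of_ae_prod (ae_of_ae_map measurable_swap.aemeasurable h)

/-- The slice `f(·, u)` of a square integrable function on a product, as an element of `L²`; it is
set to be `0` for the exceptional `u` for which the slice is not square integrable. -/
def slice (f : Lp F 2 (μ.prod ν)) (u : β) : Lp F 2 μ :=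
  open Classical in
  if h : MemLp (fun s => f (s, u)) 2 μ then h.toLp else 0

theorem ae_memLp_slice (f : Lp F 2 (μ.prod ν)) : ∀ᵐ u ∂ν, MemLp (fun s => f (s, u)) 2 μ := by
  have h1 := (memLp_two_iff_integrable_sq_norm (Lp.aestronglyMeasurable f)).1 (Lp.memLp f)
  filter_upwards [h1.prod_left_ae] with u hu
  have hm : AEStronglyMeasurable (fun s => f (s, u)) μ :=
    ((Lp.stronglyMeasurable f).comp_measurable measurable_prodMk_right).aestronglyMeasurable
  exact (memLp_two_iff_integrable_sq_norm hm).2 hu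

theorem coeFn_slice (f : Lp F 2 (μ.prod ν)) :
    ∀ᵐ u ∂ν, slice f u =ᵐ[μ] fun s => f (s, u) := by
  filter_upwards [ae_memLp_slice f] with u hu
  rw [slice, dif_pos hu]
  exact hu.coeFn_toLp

variable [InnerProductSpace ℝ F] [InnerProductSpace ℝ G]

theorem inner_slice_ae (x : Lp F 2 μ) (f : Lp F 2 (μ.prod ν)) :
    ∀ᵐ u ∂ν, ⟪x, slice f u⟫ = ∫ s, ⟪x s, f (s, u)⟫ ∂μ := by
  filter_upwards [coeFn_slice f] with u hu
  rw [L2.inner_def]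
  refine integral_congr_ae ?_
  filter_upwards [hu] with s hs
  rw [hs]

theorem aestronglyMeasurable_slice [MeasurableSpace.CountablyGenerated α]
    [SecondCountableTopology F] [CompleteSpace F] (f : Lp F 2 (μ.prod ν)) :
    AEStronglyMeasurable (slice f) ν := by
  have : Fact ((2 : ENNReal) ≠ ⊤) := ⟨by norm_num⟩
  obtain ⟨w, b, -⟩ := exists_hilbertBasis ℝ (Lp F 2 μ)
  have : Countable w := countable_of_hilbertBasis b
  have hcoef : ∀ i, AEStronglyMeasurable (fun u => ⟪b i, slice f u⟫) ν := by
    intro i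
    have h1 : AEStronglyMeasurable (fun z : α × β => ⟪b i z.1, f z⟫) (μ.prod ν) :=
      ((Lp.aestronglyMeasurable (b i)).comp_fst).inner (Lp.aestronglyMeasurable f)
    have h2 := h1.prod_swap.integral_prod_right'
    refine h2.congr ?_
    filter_upwards [inner_slice_ae (b i) f] with u hu
    rw [hu]
    rfl
  refine aestronglyMeasurable_of_tendsto_ae (u := Filter.atTop)
    (f := fun (t : Finset w) u => ∑ i ∈ t, ⟪b i, slice f u⟫ • b i) ?_ ?_
  · intro t
    exact Finset.aestronglyMeasurable_fun_sum _ fun i _ => (hcoef i).smul_const _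
  · refine Filter.Eventually.of_forall fun u => ?_
    have := b.hasSum_repr (slice f u)
    simpa only [HilbertBasis.repr_apply_apply, HasSum, SummationFilter.unconditional_filter]
      using this

theorem norm_slice_sq_ae (f : Lp F 2 (μ.prod ν)) :
    ∀ᵐ u ∂ν, ‖slice f u‖ ^ 2 = ∫ s, ‖f (s, u)‖ ^ 2 ∂μ := by
  filter_upwards [coeFn_slice f] with u hu
  rw [← real_inner_self_eq_norm_sq, L2.inner_def]
  refine integral_congr_ae ?_
  filter_upwards [hu] with s hs
  rw [hs, real_inner_self_eq_norm_sq]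

variable [MeasurableSpace.CountablyGenerated α] [SecondCountableTopology F] [CompleteSpace F]
  [SecondCountableTopology G] [CompleteSpace G]

theorem memLp_slice (f : Lp F 2 (μ.prod ν)) : MemLp (slice f) 2 ν := by
  rw [memLp_two_iff_integrable_sq_norm (aestronglyMeasurable_slice f)]
  have h1 := (memLp_two_iff_integrable_sq_norm (Lp.aestronglyMeasurable f)).1 (Lp.memLp f)
  refine h1.integral_prod_right.congr ?_
  filter_upwards [norm_slice_sq_ae f] with u hu
  rw [hu]

/-- The isometric embedding of `L²(μ × ν; F)` into `L²(ν; L²(μ; F))` that sends a function to the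
family of its slices. -/
def slices : Lp F 2 (μ.prod ν) →ₗᵢ[ℝ] Lp (Lp F 2 μ) 2 ν where
  toFun f := (memLp_slice f).toLp
  map_add' f g := by
    rw [← MemLp.toLp_add]
    refine MemLp.toLp_congr _ _ ?_
    filter_upwards [coeFn_slice f, coeFn_slice g, coeFn_slice (f + g),
      ae_ae_of_ae_prod_swap (Lp.coeFn_add f g)] with u h1 h2 h3 h4
    apply Lp.ext
    filter_upwards [h1, h2, h3, h4, Lp.coeFn_add (slice f u) (slice g u)] with s k1 k2 k3 k4 k5
    simp only [Pi.add_apply] at *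
    rw [k3, k5, k1, k2]
    exact k4
  map_smul' r f := by
    simp only [RingHom.id_apply]
    rw [← MemLp.toLp_const_smul]
    refine MemLp.toLp_congr _ _ ?_
    filter_upwards [coeFn_slice f, coeFn_slice (r • f),
      ae_ae_of_ae_prod_swap (Lp.coeFn_smul r f)] with u h1 h2 h4
    apply Lp.ext
    simp only [Pi.smul_apply]
    filter_upwards [h1, h2, h4, Lp.coeFn_smul r (slice f u)] with s k1 k2 k4 k5
    simp only [Pi.smul_apply] at *
    rw [k2, k5, k1]
    exact k4
  norm_map' f := by
    have hsq : ‖(memLp_slice f).toLp‖ ^ 2 = ‖f‖ ^ 2 := by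
      rw [← real_inner_self_eq_norm_sq, ← real_inner_self_eq_norm_sq, L2.inner_def, L2.inner_def]
      have h1 := (memLp_two_iff_integrable_sq_norm (Lp.aestronglyMeasurable f)).1 (Lp.memLp f)
      simp only [real_inner_self_eq_norm_sq]
      rw [integral_prod_symm _ h1]
      refine integral_congr_ae ?_
      filter_upwards [norm_slice_sq_ae f, (memLp_slice f).coeFn_toLp] with u hu hu'
      rw [← hu, hu']
    exact (sq_eq_sq₀ (norm_nonneg _) (norm_nonneg _)).1 hsq

theorem coeFn_slices (f : Lp F 2 (μ.prod ν)) :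
    ∀ᵐ u ∂ν, slices f u =ᵐ[μ] fun s => f (s, u) := by
  filter_upwards [coeFn_slice f, (memLp_slice f).coeFn_toLp] with u h1 h2
  change ((memLp_slice f).toLp (slice f)) u =ᵐ[μ] _
  rw [h2]
  exact h1

/-- The slices of an element of `L²(μ × ν)` can be computed from any of its representatives. -/
theorem slices_ae_eq {f : Lp F 2 (μ.prod ν)} {g : α × β → F} (hfg : f =ᵐ[μ.prod ν] g)
    {x : β → Lp F 2 μ} (hx : ∀ᵐ u ∂ν, x u =ᵐ[μ] fun s => g (s, u)) : slices f =ᵐ[ν] x := by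
  filter_upwards [coeFn_slices f, hx, ae_ae_of_ae_prod_swap hfg]
    with u h1 h2 h3
  apply Lp.ext
  filter_upwards [h1, h2, h3] with s k1 k2 k3
  rw [k1, k2]
  exact k3

theorem slices_tensor (x : Lp F 2 μ) (p : Lp ℝ 2 ν) :
    slices (tensor x p) =ᵐ[ν] fun u => p u • x :=
  slices_ae_eq (coeFn_tensor x p)
    (Filter.Eventually.of_forall fun u => Lp.coeFn_smul (p u) x)

theorem norm_tensor (x : Lp F 2 μ) (p : Lp ℝ 2 ν) : ‖tensor x p‖ = ‖x‖ * ‖p‖ := by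
  have hsq : ‖tensor x p‖ ^ 2 = (‖x‖ * ‖p‖) ^ 2 := by
    rw [← slices.norm_map, ← real_inner_self_eq_norm_sq, mul_pow, ← real_inner_self_eq_norm_sq p,
      L2.inner_def, L2.inner_def, ← integral_const_mul]
    refine integral_congr_ae ?_
    filter_upwards [slices_tensor x p] with u hu
    rw [hu, real_inner_self_eq_norm_sq, real_inner_self_eq_norm_sq, norm_smul]
    ring
  exact (sq_eq_sq₀ (norm_nonneg _) (by positivity)).1 hsq

theorem tensor_add (x y : Lp F 2 μ) (p : Lp ℝ 2 ν) :
    tensor (x + y) p = tensor x p + tensor y p := by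
  apply slices.injective
  rw [map_add]
  apply Lp.ext
  filter_upwards [slices_tensor x p, slices_tensor y p, slices_tensor (x + y) p,
    Lp.coeFn_add (slices (tensor x p)) (slices (tensor y p))] with u h1 h2 h3 h4
  rw [h4, h3, Pi.add_apply, h1, h2, smul_add]

theorem tensor_smul (r : ℝ) (x : Lp F 2 μ) (p : Lp ℝ 2 ν) :
    tensor (r • x) p = r • tensor x p := by
  apply slices.injective
  rw [map_smul]
  apply Lp.ext
  filter_upwards [slices_tensor x p, slices_tensor (r • x) p,
    Lp.coeFn_smul r (slices (tensor x p))] with u h1 h3 h4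
  rw [h4, h3, Pi.smul_apply, h1, smul_comm]

/-- The elementary tensor with a fixed function of `u`, as a continuous linear map. -/
def tensorL (p : Lp ℝ 2 ν) : Lp F 2 μ →L[ℝ] Lp F 2 (μ.prod ν) :=
  LinearMap.mkContinuous
    { toFun := fun x => tensor x p
      map_add' := fun x y => tensor_add x y p
      map_smul' := fun r x => tensor_smul r x p }
    ‖p‖ fun x => (norm_tensor x p).le.trans_eq (mul_comm _ _)

/-- The ampliation `T ⊗ 1` of an operator between `L²` spaces over `μ` to the product `μ × ν`. -/
def ampliation (T : Lp F 2 μ →L[ℝ] Lp G 2 μ) : Lp F 2 (μ.prod ν) →L[ℝ] Lp G 2 (μ.prod ν) :=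
  (ContinuousLinearMap.adjoint slices.toContinuousLinearMap) ∘L (T.compLpL 2 ν) ∘L
    slices.toContinuousLinearMap

/-- An ampliation is computed slice by slice. -/
theorem ampliation_eq (T : Lp F 2 μ →L[ℝ] Lp G 2 μ) {f : Lp F 2 (μ.prod ν)}
    {g : Lp G 2 (μ.prod ν)} (h : ∀ᵐ u ∂ν, slices g u = T (slices f u)) : ampliation T f = g := by
  have h1 : T.compLpL 2 ν (slices f) = slices g := by
    apply Lp.ext
    filter_upwards [h, T.coeFn_compLpL (p := 2) (slices f)] with u h1 h2
    rw [h2, h1]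
  change ContinuousLinearMap.adjoint slices.toContinuousLinearMap (T.compLpL 2 ν (slices f)) = g
  rw [h1]
  refine ext_inner_right ℝ fun y => ?_
  rw [ContinuousLinearMap.adjoint_inner_left]
  exact slices.inner_map_map g y

/-- The ampliations of two operators agree as soon as the operators agree on all slices. -/
theorem ampliation_congr {F' : Type*} [NormedAddCommGroup F'] [InnerProductSpace ℝ F']
    [SecondCountableTopology F'] [CompleteSpace F'] (T : Lp F 2 μ →L[ℝ] Lp G 2 μ)
    (T' : Lp F' 2 μ →L[ℝ] Lp G 2 μ) {f : Lp F 2 (μ.prod ν)} {f' : Lp F' 2 (μ.prod ν)}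
    (h : ∀ᵐ u ∂ν, T (slices f u) = T' (slices f' u)) : ampliation T f = ampliation T' f' := by
  have h1 : T.compLpL 2 ν (slices f) = T'.compLpL 2 ν (slices f') := by
    apply Lp.ext
    filter_upwards [h, T.coeFn_compLpL (p := 2) (slices f),
      T'.coeFn_compLpL (p := 2) (slices f')] with u h1 h2 h3
    rw [h2, h3, h1]
  change ContinuousLinearMap.adjoint slices.toContinuousLinearMap (T.compLpL 2 ν (slices f))
    = ContinuousLinearMap.adjoint slices.toContinuousLinearMap (T'.compLpL 2 ν (slices f'))
  rw [h1]

theorem ampliation_tensor (T : Lp F 2 μ →L[ℝ] Lp G 2 μ) (x : Lp F 2 μ) (p : Lp ℝ 2 ν) :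
    ampliation T (tensor x p) = tensor (T x) p := by
  refine ampliation_eq T ?_
  filter_upwards [slices_tensor x p, slices_tensor (T x) p] with u h1 h2
  rw [h1, h2, map_smul]

theorem inner_ampliation (T : Lp F 2 μ →L[ℝ] Lp F 2 μ) (hT : ∀ x y, ⟪T x, y⟫ = ⟪x, T y⟫)
    (f g : Lp F 2 (μ.prod ν)) : ⟪ampliation T f, g⟫ = ⟪f, ampliation T g⟫ := by
  change ⟪ContinuousLinearMap.adjoint slices.toContinuousLinearMap (T.compLpL 2 ν (slices f)), g⟫
    = ⟪f, ContinuousLinearMap.adjoint slices.toContinuousLinearMap (T.compLpL 2 ν (slices g))⟫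
  rw [ContinuousLinearMap.adjoint_inner_left, ContinuousLinearMap.adjoint_inner_right,
    L2.inner_def, L2.inner_def]
  refine integral_congr_ae ?_
  filter_upwards [T.coeFn_compLpL (p := 2) (slices f), T.coeFn_compLpL (p := 2) (slices g)]
    with u h1 h2
  change ⟪T.compLpL 2 ν (slices f) u, slices g u⟫ = ⟪slices f u, T.compLpL 2 ν (slices g) u⟫
  rw [h1, h2, hT]

/-- The partial inner product `u ↦ ⟪x, f(·, u)⟫`, as an element of `L²(ν)`. -/
def partialInner (x : Lp F 2 μ) (f : Lp F 2 (μ.prod ν)) : Lp ℝ 2 ν :=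
  (innerSL ℝ x).compLpL 2 ν (slices f)

theorem coeFn_partialInner (x : Lp F 2 μ) (f : Lp F 2 (μ.prod ν)) :
    partialInner x f =ᵐ[ν] fun u => ⟪x, slices f u⟫ :=
  (innerSL ℝ x).coeFn_compLpL (p := 2) (slices f)

/-- A square integrable function on a product is the sum of the elementary tensors formed from an
orthonormal basis in the first variable. -/
theorem hasSum_tensor_partialInner {ι : Type*} (b : HilbertBasis ι ℝ (Lp F 2 μ))
    (f : Lp F 2 (μ.prod ν)) : HasSum (fun j => tensor (b j) (partialInner (b j) f)) f := by
  have : Fact ((2 : ENNReal) ≠ ⊤) := ⟨by norm_num⟩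
  have : Countable ι := countable_of_hilbertBasis b
  -- the partial sums in `L²(ν; L²(μ))` are the slicewise partial sums of the basis expansion
  have hpart : ∀ t : Finset ι, slices (∑ j ∈ t, tensor (b j) (partialInner (b j) f))
      =ᵐ[ν] fun u => ∑ j ∈ t, ⟪b j, slices f u⟫ • b j := by
    intro t
    rw [map_sum]
    have h1 : ∀ j, ∀ᵐ u ∂ν, slices (tensor (b j) (partialInner (b j) f)) u
        = ⟪b j, slices f u⟫ • b j := by
      intro j
      filter_upwards [slices_tensor (b j) (partialInner (b j) f),
        coeFn_partialInner (b j) f] with u h1 h2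
      rw [h1, h2]
    filter_upwards [ae_all_iff.2 h1,
      Lp.coeFn_finsetSum t fun j => slices (tensor (b j) (partialInner (b j) f))] with u h2 h3
    rw [h3, Finset.sum_apply]
    exact Finset.sum_congr rfl fun j _ => h2 j
  have hpy : ∀ (x : Lp F 2 μ) (t : Finset ι), ‖∑ j ∈ t, ⟪b j, x⟫ • b j - x‖ ≤ ‖x‖ := by
    intro x t
    have h1 : ⟪∑ j ∈ t, ⟪b j, x⟫ • b j - x, ∑ j ∈ t, ⟪b j, x⟫ • b j⟫ = 0 := by
      rw [inner_sum]
      refine Finset.sum_eq_zero fun j hj => ?_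
      rw [inner_smul_right, inner_sub_left]
      have h2 := b.orthonormal.inner_left_sum (fun j => ⟪b j, x⟫) hj
      simp only [conj_trivial] at h2
      rw [h2, real_inner_comm, sub_self, mul_zero]
    have h2 : ‖x‖ ^ 2 = ‖∑ j ∈ t, ⟪b j, x⟫ • b j - x‖ ^ 2 + ‖∑ j ∈ t, ⟪b j, x⟫ • b j‖ ^ 2 := by
      have h3 := norm_sub_sq_real (∑ j ∈ t, ⟪b j, x⟫ • b j)
        (∑ j ∈ t, ⟪b j, x⟫ • b j - x)
      rw [sub_sub_cancel, real_inner_comm, h1] at h3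
      rw [h3]
      ring
    refine (sq_le_sq₀ (norm_nonneg _) (norm_nonneg _)).1 ?_
    nlinarith [sq_nonneg ‖∑ j ∈ t, ⟪b j, x⟫ • b j‖]
  have hnorm : ∀ t : Finset ι, ‖∑ j ∈ t, tensor (b j) (partialInner (b j) f) - f‖ ^ 2
      = ∫ u, ‖∑ j ∈ t, ⟪b j, slices f u⟫ • b j - slices f u‖ ^ 2 ∂ν := by
    intro t
    rw [← slices.norm_map, ← real_inner_self_eq_norm_sq, L2.inner_def, map_sub]
    refine integral_congr_ae ?_
    filter_upwards [hpart t, Lp.coeFn_sub (slices (∑ j ∈ t, tensor (b j) (partialInner (b j) f)))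
      (slices f)] with u h1 h2
    rw [real_inner_self_eq_norm_sq, h2, Pi.sub_apply, h1]
  have hlim : Filter.Tendsto
      (fun t : Finset ι => ‖∑ j ∈ t, tensor (b j) (partialInner (b j) f) - f‖ ^ 2)
      Filter.atTop (nhds 0) := by
    simp_rw [hnorm]
    rw [← integral_zero β ℝ (μ := ν)]
    refine tendsto_integral_filter_of_dominated_convergence (fun u => ‖slices f u‖ ^ 2) ?_ ?_ ?_ ?_
    · refine Filter.Eventually.of_forall fun t => ?_
      have h1 := Lp.aestronglyMeasurable (slices f)
      have h2 : AEStronglyMeasurable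
          (fun u => ∑ j ∈ t, ⟪b j, slices f u⟫ • b j - slices f u) ν :=
        (Finset.aestronglyMeasurable_fun_sum _ fun j _ =>
          (aestronglyMeasurable_const.inner h1).smul_const _).sub h1
      exact h2.norm.pow 2
    · refine Filter.Eventually.of_forall fun t => Filter.Eventually.of_forall fun u => ?_
      rw [Real.norm_of_nonneg (by positivity)]
      exact pow_le_pow_left₀ (norm_nonneg _) (hpy _ t) 2
    · exact (memLp_two_iff_integrable_sq_norm (Lp.aestronglyMeasurable _)).1 (Lp.memLp _)
    · refine Filter.Eventually.of_forall fun u => ?_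
      have h1 := b.hasSum_repr (slices f u)
      simp only [HilbertBasis.repr_apply_apply, HasSum,
        SummationFilter.unconditional_filter] at h1
      have h2 := ((h1.sub_const (slices f u)).norm).pow 2
      simpa using h2
  rw [HasSum, SummationFilter.unconditional_filter, tendsto_iff_norm_sub_tendsto_zero]
  have h1 := hlim.sqrt
  simpa [Real.sqrt_sq] using h1

end ProductL2

/-! ### Local parametrisations of the hypersurface -/

/-- A local parametrisation of `Γ` near `x` over a ball of `ℝ^(d-1)`, inverted by a 1-Lipschitz map
`π` of the ambient space (in practice an orthogonal projection onto the tangent space). -/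
structure LocalParam {d : ℕ} (Γ : Set (E d)) (x : E d) where
  /-- the parametrisation -/
  ψ : EuclideanSpace ℝ (Fin (d - 1)) → E d
  /-- the ambient map inverting it -/
  π : E d → EuclideanSpace ℝ (Fin (d - 1))
  /-- the radius of the parameter ball -/
  ρ : ℝ
  /-- a Lipschitz constant of the parametrisation -/
  K : NNReal
  ρ_pos : 0 < ρ
  ψ_zero : ψ 0 = x
  lipschitz_π : LipschitzWith 1 π
  contDiffOn_ψ : ContDiffOn ℝ 1 ψ (Metric.ball 0 ρ)
  lipschitz_ψ : LipschitzOnWith K ψ (Metric.ball 0 ρ)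
  mem : ∀ z ∈ Metric.ball 0 ρ, ψ z ∈ Γ
  leftInv : ∀ z ∈ Metric.ball 0 ρ, π (ψ z) = z
  nhds_subset : ∀ r, 0 < r → ∃ W : Set (E d), IsOpen W ∧ x ∈ W ∧ Γ ∩ W ⊆ ψ '' Metric.ball 0 r

/-- A nonzero linear functional on `ℝ^d` becomes a coordinate of a linear isomorphism with
`ℝ × ℝ^(d-1)`, the other coordinate being the orthogonal projection to its kernel. -/
theorem exists_equiv_prod {d : ℕ} {f' : E d →L[ℝ] ℝ} (hf'0 : f' ≠ 0) :
    ∃ P : E d →L[ℝ] EuclideanSpace ℝ (Fin (d - 1)), (∀ v, ‖P v‖ ≤ ‖v‖) ∧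
      ∃ A : E d ≃L[ℝ] ℝ × EuclideanSpace ℝ (Fin (d - 1)),
        (A : E d →L[ℝ] ℝ × EuclideanSpace ℝ (Fin (d - 1))) = f'.prod P := by
  have hf'1 : f'.toLinearMap ≠ 0 := fun h => hf'0 (ContinuousLinearMap.coe_injective h)
  set V := LinearMap.ker f'.toLinearMap with hV
  have hrank : Module.finrank ℝ V + 1 = d := by
    have h1 := Module.Dual.finrank_ker_add_one_of_ne_zero (f := f'.toLinearMap) hf'1
    rwa [finrank_euclideanSpace_fin] at h1
  have hrank' : Module.finrank ℝ V = d - 1 := by omega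
  let iso : V ≃ₗᵢ[ℝ] EuclideanSpace ℝ (Fin (d - 1)) :=
    ((stdOrthonormalBasis ℝ V).reindex (finCongr hrank')).repr
  let P : E d →L[ℝ] EuclideanSpace ℝ (Fin (d - 1)) :=
    iso.toContinuousLinearEquiv.toContinuousLinearMap ∘L V.orthogonalProjectionOnto
  have hP : ∀ v, ‖P v‖ ≤ ‖v‖ := fun v => by
    change ‖iso (V.orthogonalProjectionOnto v)‖ ≤ ‖v‖
    rw [iso.norm_map]
    exact V.norm_orthogonalProjectionOnto_apply_le v
  have hinj : Function.Injective (f'.prod P).toLinearMap := by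
    rw [← LinearMap.ker_eq_bot, LinearMap.ker_eq_bot']
    intro v hv
    have h1 : f' v = 0 := congrArg Prod.fst hv
    have h2 : iso (V.orthogonalProjectionOnto v) = 0 := congrArg Prod.snd hv
    have h3 : v ∈ V := h1
    have h4 : V.orthogonalProjectionOnto v = 0 := by simpa using h2
    have h5 : V.orthogonalProjectionOnto v = ⟨v, h3⟩ :=
      V.orthogonalProjectionOnto_mem_subspace_eq_self ⟨v, h3⟩
    rw [h5] at h4
    exact congrArg Subtype.val h4
  have hfr : Module.finrank ℝ (E d) = Module.finrank ℝ (ℝ × EuclideanSpace ℝ (Fin (d - 1))) := by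
    rw [Module.finrank_prod, finrank_euclideanSpace_fin, finrank_euclideanSpace_fin,
      Module.finrank_self]
    omega
  refine ⟨P, hP, (LinearEquiv.ofInjectiveOfFinrankEq _ hinj hfr).toContinuousLinearEquiv, ?_⟩
  ext v <;> rfl

/-- A closed hypersurface is locally a graph over its tangent spaces. -/
theorem IsClosedHypersurface.nonempty_localParam {d : ℕ} {Γ : Set (E d)}
    (hΓ : IsClosedHypersurface Γ) {x : E d} (hx : x ∈ Γ) : Nonempty (LocalParam Γ x) := by
  obtain ⟨U, hU, hxU, φ, hφ, hφ0, hφΓ⟩ := hΓ.locally_zeroSet x hx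
  have hφx : ContDiffAt ℝ ∞ φ x := hφ.contDiffAt (hU.mem_nhds hxU)
  have hφd : HasFDerivAt φ (fderiv ℝ φ x) x :=
    (hφx.differentiableAt (by simp)).hasFDerivAt
  set f' := fderiv ℝ φ x with hf'
  obtain ⟨P, hP, A, hA⟩ := exists_equiv_prod (hφ0 x hxU)
  let Φ : E d → ℝ × EuclideanSpace ℝ (Fin (d - 1)) := fun y => (φ y, P (y - x))
  have hΦ : ContDiffAt ℝ ∞ Φ x :=
    hφx.prodMk (P.contDiff.contDiffAt.comp x (contDiffAt_id.sub contDiffAt_const))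
  have hΦd : HasFDerivAt Φ (A : E d →L[ℝ] ℝ × EuclideanSpace ℝ (Fin (d - 1))) x := by
    have h1 : HasFDerivAt Φ (f'.prod P) x := by
      refine hφd.prodMk ?_
      exact P.hasFDerivAt.comp x ((hasFDerivAt_id x).sub_const x)
    rw [hA]
    exact h1
  have hne : (∞ : WithTop ℕ∞) ≠ 0 := by simp
  let e := hΦ.toOpenPartialHomeomorph Φ hΦd hne
  have hecoe : ∀ y, e y = Φ y := fun y => rfl
  have hxs : x ∈ e.source := hΦ.mem_toOpenPartialHomeomorph_source hΦd hne
  have hΦx : Φ x = (0, 0) := by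
    have : φ x = 0 := (hφΓ x hxU).1 hx
    simp [Φ, this]
  have hsymm : ContDiffAt ℝ ∞ e.symm (0, 0) := by
    have h1 := hΦ.to_localInverse hΦd hne
    rw [hΦx] at h1
    exact h1
  have hinc : ContDiffAt ℝ ∞ (fun z : EuclideanSpace ℝ (Fin (d - 1)) => ((0 : ℝ), z)) 0 :=
    contDiffAt_const.prodMk contDiffAt_id
  let ψ : EuclideanSpace ℝ (Fin (d - 1)) → E d := fun z => e.symm (0, z)
  have hψ : ContDiffAt ℝ ∞ ψ 0 := hsymm.comp (0 : EuclideanSpace ℝ (Fin (d - 1))) hinc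
  have hψ1 : ContDiffAt ℝ 1 ψ 0 := hψ.of_le (by simp)
  have hψ0 : ψ 0 = x := by
    change e.symm (0, 0) = x
    rw [← hΦx, ← hecoe, e.left_inv hxs]
  obtain ⟨K, t, ht, hK⟩ := hψ1.exists_lipschitzOnWith
  have htarget : ∀ᶠ z : EuclideanSpace ℝ (Fin (d - 1)) in nhds 0, ((0 : ℝ), z) ∈ e.target := by
    refine hinc.continuousAt.eventually_mem (e.open_target.mem_nhds ?_)
    rw [← hΦx, ← hecoe]
    exact e.map_source hxs
  have hUev : ∀ᶠ z in nhds (0 : EuclideanSpace ℝ (Fin (d - 1))), ψ z ∈ U := by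
    refine hψ.continuousAt.eventually_mem (hU.mem_nhds ?_)
    rwa [hψ0]
  have hcd : ∀ᶠ z in nhds (0 : EuclideanSpace ℝ (Fin (d - 1))), ContDiffAt ℝ 1 ψ z :=
    hψ1.eventually (by simp)
  obtain ⟨ρ, hρ, hball⟩ := Metric.eventually_nhds_iff_ball.1
    ((htarget.and hUev).and (hcd.and ht))
  have hΦψ : ∀ z ∈ Metric.ball 0 ρ, Φ (ψ z) = (0, z) := fun z hz => by
    rw [← hecoe]
    exact e.right_inv (hball z hz).1.1
  refine ⟨{
    ψ := ψ
    π := fun y => P (y - x)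
    ρ := ρ
    K := K
    ρ_pos := hρ
    ψ_zero := hψ0
    lipschitz_π := ?_
    contDiffOn_ψ := fun z hz => (hball z hz).2.1.contDiffWithinAt
    lipschitz_ψ := hK.mono fun z hz => (hball z hz).2.2
    mem := fun z hz => (hφΓ _ (hball z hz).1.2).2 (congrArg Prod.fst (hΦψ z hz))
    leftInv := fun z hz => congrArg Prod.snd (hΦψ z hz)
    nhds_subset := ?_ }⟩
  · refine LipschitzWith.of_dist_le_mul fun y y' => ?_
    rw [dist_eq_norm, dist_eq_norm, ← map_sub, NNReal.coe_one, one_mul]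
    refine (hP _).trans_eq ?_
    congr 1
    abel
  · intro r hr
    refine ⟨(e.source ∩ U) ∩ (fun y => P (y - x)) ⁻¹' Metric.ball 0 r, ?_, ?_, ?_⟩
    · refine (e.open_source.inter hU).inter (Metric.isOpen_ball.preimage ?_)
      fun_prop
    · refine ⟨⟨hxs, hxU⟩, ?_⟩
      simpa using hr
    · rintro y ⟨hyΓ, ⟨hys, hyU⟩, hyr⟩
      refine ⟨P (y - x), hyr, ?_⟩
      change e.symm (0, P (y - x)) = y
      have h0 : φ y = 0 := (hφΓ y hyU).1 hyΓ
      have h1 : e y = (0, P (y - x)) := by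
        rw [hecoe, ← h0]
      rw [← h1, e.left_inv hys]

theorem euclideanHausdorffMeasure_image_le {X Y : Type*} [EMetricSpace X] [EMetricSpace Y]
    [MeasurableSpace X] [BorelSpace X] [MeasurableSpace Y] [BorelSpace Y] {f : X → Y} {s : Set X}
    {K : NNReal} (hf : LipschitzOnWith K f s) (k : ℕ) :
    (μHE[k] : Measure Y) (f '' s) ≤ (K : ENNReal) ^ (k : ℝ) * (μHE[k] : Measure X) s := by
  rw [Measure.euclideanHausdorffMeasure_def, Measure.euclideanHausdorffMeasure_def,
    Measure.smul_apply, Measure.smul_apply, ENNReal.smul_def, ENNReal.smul_def, smul_eq_mul,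
    smul_eq_mul, mul_left_comm]
  gcongr
  exact hf.hausdorffMeasure_image_le (Nat.cast_nonneg k)

namespace LocalParam

variable {d : ℕ} {Γ : Set (E d)} {x : E d} (p : LocalParam Γ x)

theorem aemeasurable_ψ : AEMeasurable p.ψ (volume.restrict (Metric.ball 0 p.ρ)) :=
  p.contDiffOn_ψ.continuousOn.aemeasurable measurableSet_ball

/-- Surface measure dominates the image of Lebesgue measure: the inverse of the parametrisation does
not increase distances. -/
theorem map_volume_le (hΓ : MeasurableSet Γ) :
    (volume.restrict (Metric.ball 0 p.ρ)).map p.ψ ≤ surfaceMeasure Γ := by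
  refine Measure.le_iff.2 fun A hA => ?_
  rw [Measure.map_apply_of_aemeasurable p.aemeasurable_ψ hA,
    Measure.restrict_apply' measurableSet_ball, surfaceMeasure, Measure.restrict_apply' hΓ]
  have hsub : p.ψ ⁻¹' A ∩ Metric.ball 0 p.ρ ⊆ p.π '' (A ∩ Γ) := by
    rintro z ⟨hzA, hz⟩
    exact ⟨p.ψ z, ⟨hzA, p.mem z hz⟩, p.leftInv z hz⟩
  refine (measure_mono hsub).trans ?_
  rw [← EuclideanSpace.euclideanHausdorffMeasure_eq_volume]
  refine (euclideanHausdorffMeasure_image_le p.lipschitz_π.lipschitzOnWith (d - 1)).trans ?_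
  simp

theorem surfaceMeasure_image_le {A : Set (EuclideanSpace ℝ (Fin (d - 1)))}
    (hA : A ⊆ Metric.ball 0 p.ρ) :
    surfaceMeasure Γ (p.ψ '' A) ≤ (p.K : ENNReal) ^ ((d - 1 : ℕ) : ℝ) * volume A := by
  rw [← EuclideanSpace.euclideanHausdorffMeasure_eq_volume]
  exact (Measure.restrict_apply_le _ _).trans
    (euclideanHausdorffMeasure_image_le (p.lipschitz_ψ.mono hA) (d - 1))

theorem surfaceMeasure_pos (p : LocalParam Γ x) (hΓ : MeasurableSet Γ) {W : Set (E d)}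
    (hW : IsOpen W) (hx : x ∈ W) : 0 < surfaceMeasure Γ W := by
  refine lt_of_lt_of_le ?_ (p.map_volume_le hΓ W)
  rw [Measure.map_apply_of_aemeasurable p.aemeasurable_ψ hW.measurableSet,
    Measure.restrict_apply' measurableSet_ball]
  have h0 : (0 : EuclideanSpace ℝ (Fin (d - 1))) ∈ Metric.ball 0 p.ρ :=
    Metric.mem_ball_self p.ρ_pos
  refine Measure.measure_pos_of_mem_nhds volume (x := 0) (Filter.inter_mem ?_
    (Metric.ball_mem_nhds 0 p.ρ_pos))
  refine (p.contDiffOn_ψ.continuousOn.continuousAt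
    (Metric.ball_mem_nhds 0 p.ρ_pos)).preimage_mem_nhds (hW.mem_nhds ?_)
  rwa [p.ψ_zero]

end LocalParam

section Hypersurface

variable {d : ℕ} {Γ : Set (E d)}

theorem IsClosedHypersurface.isFiniteMeasure (hΓ : IsClosedHypersurface Γ) :
    IsFiniteMeasure (surfaceMeasure Γ) := by
  refine ⟨?_⟩
  rw [surfaceMeasure, Measure.restrict_apply_univ]
  refine hΓ.isCompact.measure_lt_top_of_nhdsWithin fun x hx => ?_
  obtain ⟨p⟩ := hΓ.nonempty_localParam hx
  obtain ⟨W, hW, hxW, hsub⟩ := p.nhds_subset p.ρ p.ρ_pos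
  refine ⟨Γ ∩ W, inter_mem_nhdsWithin _ (hW.mem_nhds hxW), ?_⟩
  refine (measure_mono hsub).trans_lt ?_
  refine (euclideanHausdorffMeasure_image_le p.lipschitz_ψ (d - 1)).trans_lt ?_
  rw [EuclideanSpace.euclideanHausdorffMeasure_eq_volume]
  exact ENNReal.mul_lt_top (ENNReal.rpow_lt_top_of_nonneg (by positivity) (by simp))
    measure_ball_lt_top

/-- A function on a connected hypersurface that is locally almost everywhere constant is almost
everywhere constant. -/
theorem IsClosedHypersurface.ae_const_of_locally (hΓ : IsClosedHypersurface Γ) (f : E d → ℝ)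
    (hf : ∀ x ∈ Γ, ∃ W : Set (E d), IsOpen W ∧ x ∈ W ∧
      ∃ r : ℝ, surfaceMeasure Γ {s ∈ W | f s ≠ r} = 0) :
    ∃ r : ℝ, ∀ᵐ s ∂(surfaceMeasure Γ), f s = r := by
  have hm : MeasurableSet Γ := hΓ.isCompact.measurableSet
  choose! W hW hxW r hr using hf
  have hloc : ∀ x ∈ Γ, ∀ y ∈ Γ, y ∈ W x → r y = r x := by
    intro x hx y hy hyx
    obtain ⟨p⟩ := hΓ.nonempty_localParam hy
    by_contra hne
    have hpos := p.surfaceMeasure_pos hm ((hW x hx).inter (hW y hy)) ⟨hyx, hxW y hy⟩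
    refine hpos.ne' (measure_mono_null (t := {s ∈ W x | f s ≠ r x} ∪ {s ∈ W y | f s ≠ r y}) ?_
      (measure_union_null (hr x hx) (hr y hy)))
    rintro s ⟨hsx, hsy⟩
    by_cases h : f s = r x
    · exact Or.inr ⟨hsy, fun h' => hne (h'.symm.trans h)⟩
    · exact Or.inl ⟨hsx, h⟩
  have : PreconnectedSpace Γ := Subtype.preconnectedSpace hΓ.isConnected.isPreconnected
  have hlc : IsLocallyConstant fun x : Γ => r x := by
    rw [IsLocallyConstant.iff_exists_open]
    intro x
    exact ⟨Subtype.val ⁻¹' W x, (hW x x.2).preimage continuous_subtype_val, hxW x x.2,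
      fun y hy => hloc x x.2 y y.2 hy⟩
  obtain ⟨x₀, hx₀⟩ := hΓ.isConnected.nonempty
  refine ⟨r x₀, ?_⟩
  rw [surfaceMeasure, ae_restrict_iff' hm, ae_iff]
  refine measure_null_of_locally_null _ fun x hx => ?_
  have hxΓ : x ∈ Γ := by
    by_contra h
    exact hx fun h' => absurd h' h
  refine ⟨{s | ¬(s ∈ Γ → f s = r x₀)} ∩ W x,
    inter_mem_nhdsWithin _ ((hW x hxΓ).mem_nhds (hxW x hxΓ)), ?_⟩
  have h1 := hr x hxΓ
  rw [surfaceMeasure, Measure.restrict_apply' hm] at h1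
  refine measure_mono_null ?_ h1
  rintro s ⟨hs, hsW⟩
  push Not at hs
  refine ⟨⟨hsW, ?_⟩, hs.1⟩
  have h2 : r x = r x₀ := hlc.apply_eq_of_preconnectedSpace ⟨x, hxΓ⟩ ⟨x₀, hx₀⟩
  rw [h2]
  exact hs.2

end Hypersurface

/-! ### Translations and local constancy -/

section Translation

variable {Z : Type*} [NormedAddCommGroup Z] [InnerProductSpace ℝ Z] [FiniteDimensional ℝ Z]
  [MeasurableSpace Z] [BorelSpace Z]

theorem lintegral_translate_le (g : Z → ENNReal) {r : ℝ} {v : Z} (hv : ‖v‖ < r) :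
    ∫⁻ z in Metric.ball 0 r, g (z + v) ≤ ∫⁻ z in Metric.ball 0 (2 * r), g z := by
  have h1 : ∀ z ∈ Metric.ball (0 : Z) r,
      g (z + v) ≤ (Metric.ball (0 : Z) (2 * r)).indicator g (z + v) := by
    intro z hz
    rw [indicator_of_mem]
    rw [mem_ball_zero_iff] at hz ⊢
    linarith [norm_add_le z v]
  refine (setLIntegral_mono' measurableSet_ball h1).trans ?_
  refine (setLIntegral_le_lintegral _ _).trans ?_
  rw [lintegral_add_right_eq_self (fun z => (Metric.ball (0 : Z) (2 * r)).indicator g z),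
    lintegral_indicator measurableSet_ball]

/-- The `L¹` modulus of continuity of a function under translation is controlled by the `L¹` norm
of its derivative. -/
theorem lintegral_translate_sub_le {h : Z → ℝ} {r : ℝ}
    (hh : ContDiffOn ℝ 1 h (Metric.ball 0 (2 * r))) {v : Z} (hv : ‖v‖ < r) :
    ∫⁻ z in Metric.ball 0 r, ‖h (z + v) - h z‖ₑ
      ≤ ‖v‖ₑ * ∫⁻ z in Metric.ball 0 (2 * r), ‖fderiv ℝ h z‖ₑ := by
  have hmem : ∀ z ∈ Metric.ball (0 : Z) r, ∀ t ∈ Icc (0 : ℝ) 1,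
      z + t • v ∈ Metric.ball (0 : Z) (2 * r) := by
    intro z hz t ht
    rw [mem_ball_zero_iff] at hz ⊢
    calc ‖z + t • v‖ ≤ ‖z‖ + ‖t • v‖ := norm_add_le _ _
      _ = ‖z‖ + t * ‖v‖ := by rw [norm_smul, Real.norm_of_nonneg ht.1]
      _ ≤ ‖z‖ + 1 * ‖v‖ := by gcongr; exact ht.2
      _ < 2 * r := by linarith
  have hmeas : Measurable fun z => ‖fderiv ℝ h z‖ₑ := (measurable_fderiv ℝ h).enorm
  have hmeas2 : Measurable fun q : Z × ℝ => ‖fderiv ℝ h (q.1 + q.2 • v)‖ₑ * ‖v‖ₑ :=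
    (hmeas.comp (measurable_fst.add (measurable_snd.smul_const v))).mul_const _
  have hpt : ∀ z ∈ Metric.ball (0 : Z) r, ‖h (z + v) - h z‖ₑ
      ≤ ∫⁻ t in Ioc (0 : ℝ) 1, ‖fderiv ℝ h (z + t • v)‖ₑ * ‖v‖ₑ := by
    intro z hz
    have hline : ∀ t : ℝ, HasDerivAt (fun t : ℝ => z + t • v) v t := fun t => by
      simpa using ((hasDerivAt_id t).smul_const v).const_add z
    have hfd : ∀ y ∈ Metric.ball (0 : Z) (2 * r), HasFDerivAt h (fderiv ℝ h y) y := fun y hy =>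
      ((hh.differentiableOn (by simp)).differentiableAt
        (Metric.isOpen_ball.mem_nhds hy)).hasFDerivAt
    have hcont : ContinuousOn (fun t : ℝ => fderiv ℝ h (z + t • v) v) (Icc 0 1) := by
      have h1 : ContinuousOn (fderiv ℝ h) (Metric.ball 0 (2 * r)) :=
        hh.continuousOn_fderiv_of_isOpen Metric.isOpen_ball (by simp)
      have h2 : ContinuousOn (fun t : ℝ => z + t • v) (Icc 0 1) :=
        fun t _ => (hline t).continuousAt.continuousWithinAt
      exact (h1.comp h2 fun t ht => hmem z hz t ht).clm_apply continuousOn_const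
    have hftc : ∫ t in (0 : ℝ)..1, fderiv ℝ h (z + t • v) v = h (z + v) - h z := by
      have := intervalIntegral.integral_eq_sub_of_hasDerivAt (a := 0) (b := 1)
        (f := fun t : ℝ => h (z + t • v)) (f' := fun t => fderiv ℝ h (z + t • v) v)
        (fun t ht => by
          rw [uIcc_of_le zero_le_one] at ht
          exact (hfd _ (hmem z hz t ht)).comp_hasDerivAt t (hline t))
        (hcont.intervalIntegrable_of_Icc zero_le_one)
      rw [this]
      simp
    rw [← hftc, intervalIntegral.integral_of_le zero_le_one]
    refine (enorm_integral_le_lintegral_enorm _).trans (lintegral_mono fun t => ?_)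
    exact ContinuousLinearMap.le_opENorm _ _
  calc ∫⁻ z in Metric.ball 0 r, ‖h (z + v) - h z‖ₑ
      ≤ ∫⁻ z in Metric.ball 0 r, ∫⁻ t in Ioc (0 : ℝ) 1, ‖fderiv ℝ h (z + t • v)‖ₑ * ‖v‖ₑ :=
        setLIntegral_mono' measurableSet_ball hpt
    _ = ∫⁻ t in Ioc (0 : ℝ) 1, ∫⁻ z in Metric.ball 0 r, ‖fderiv ℝ h (z + t • v)‖ₑ * ‖v‖ₑ :=
        lintegral_lintegral_swap hmeas2.aemeasurable
    _ ≤ ∫⁻ t in Ioc (0 : ℝ) 1, ‖v‖ₑ * ∫⁻ z in Metric.ball 0 (2 * r), ‖fderiv ℝ h z‖ₑ := by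
        refine setLIntegral_mono' measurableSet_Ioc fun t ht => ?_
        rw [lintegral_mul_const' _ _ enorm_ne_top, mul_comm]
        refine mul_le_mul' le_rfl ?_
        refine lintegral_translate_le (fun z => ‖fderiv ℝ h z‖ₑ) (v := t • v) ?_
        rw [norm_smul, Real.norm_of_nonneg ht.1.le]
        exact (mul_le_of_le_one_left (norm_nonneg v) ht.2).trans_lt hv
    _ = ‖v‖ₑ * ∫⁻ z in Metric.ball 0 (2 * r), ‖fderiv ℝ h z‖ₑ := by simp

/-- A function invariant under all small translations is locally constant. -/
theorem ae_const_of_translate_eq {k : Z → ℝ} (hk : Measurable k) {r : ℝ} (hr : 0 < r)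
    (h : ∀ v : Z, ‖v‖ < r → ∀ᵐ z ∂(volume.restrict (Metric.ball 0 r)), k (z + v) = k z) :
    ∃ c, ∀ᵐ z ∂(volume.restrict (Metric.ball (0 : Z) (r / 2))), k z = c := by
  have hset : MeasurableSet {q : Z × Z | k (q.2 + q.1) = k q.2} :=
    measurableSet_eq_fun (hk.comp (measurable_snd.add measurable_fst)) (hk.comp measurable_snd)
  have h1 : ∀ᵐ v ∂(volume.restrict (Metric.ball (0 : Z) r)),
      ∀ᵐ z ∂(volume.restrict (Metric.ball (0 : Z) r)), k (z + v) = k z := by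
    filter_upwards [ae_restrict_mem measurableSet_ball] with v hv
    exact h v (mem_ball_zero_iff.1 hv)
  have h2 : ∀ᵐ z ∂(volume.restrict (Metric.ball (0 : Z) r)),
      ∀ᵐ v ∂(volume.restrict (Metric.ball (0 : Z) r)), k (z + v) = k z :=
    (Measure.ae_ae_comm hset).1 h1
  have h3 := ae_restrict_of_ae_restrict_of_subset
    (Metric.ball_subset_ball (by linarith : r / 2 ≤ r)) h2
  have hne : (ae (volume.restrict (Metric.ball (0 : Z) (r / 2)))).NeBot := by
    rw [ae_neBot, Ne, Measure.restrict_eq_zero]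
    exact (Metric.measure_ball_pos volume _ (by linarith)).ne'
  obtain ⟨z₀, hz₀, hz₀'⟩ := (h3.and (ae_restrict_mem measurableSet_ball)).exists
  refine ⟨k z₀, ?_⟩
  rw [ae_restrict_iff' measurableSet_ball] at hz₀ ⊢
  have h4 := (measurePreserving_sub_right (volume : Measure Z) z₀).quasiMeasurePreserving.ae hz₀
  filter_upwards [h4] with z hz hzr
  have h5 := hz (by
    rw [mem_ball_zero_iff] at *
    linarith [norm_sub_le z z₀])
  rwa [add_sub_cancel] at h5

end Translation

/-! ### The weights -/

/-- Lebesgue measure on `[-1,1]`. -/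
abbrev leb : Measure ℝ := volume.restrict (Icc (-1 : ℝ) 1)

theorem ae_leb_mem_Ioo : ∀ᵐ u ∂leb, u ∈ Ioo (-1 : ℝ) 1 := by
  have h : leb = volume.restrict (Ioo (-1 : ℝ) 1) := Measure.restrict_congr_set Ioo_ae_eq_Icc.symm
  rw [h]
  exact ae_restrict_mem measurableSet_Ioo

theorem one_sub_sq_pos {u : ℝ} (hu : u ∈ Ioo (-1 : ℝ) 1) : 0 < 1 - u ^ 2 := by
  nlinarith [hu.1, hu.2]

theorem one_sub_sq_mem_Icc {u : ℝ} (hu : u ∈ Icc (-1 : ℝ) 1) : 1 - u ^ 2 ∈ Icc (0 : ℝ) 1 :=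
  ⟨by nlinarith [hu.1, hu.2], by nlinarith⟩

theorem integrable_inv_sqrt_one_sub_sq : Integrable (fun u : ℝ => 1 / √(1 - u ^ 2)) leb := by
  refine (integrableOn_Icc_iff_integrableOn_Ioc (f := fun u : ℝ => 1 / √(1 - u ^ 2))).2 ?_
  refine intervalIntegral.integrableOn_deriv_of_nonneg (g := Real.arcsin)
    Real.continuous_arcsin.continuousOn (fun u hu => ?_) (fun u _ => by positivity)
  exact Real.hasDerivAt_arcsin hu.1.ne' hu.2.ne

theorem σ_pos : 0 < σ := by
  have h : σ = Real.pi / 2 := by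
    rw [σ, integral_Icc_eq_integral_Ioc, ← intervalIntegral.integral_of_le (by norm_num),
      integral_sqrt_one_sub_sq]
  rw [h]
  positivity

/-! #### Finite order of vanishing -/

/-- At a point where `g` does not vanish to infinite order, `(u - a) g'` is bounded by `g`: if `k` is
the order of vanishing of `g`, both sides are of order `k`. -/
theorem isBigO_sub_mul_derivWithin {s : Set ℝ} (hs : Convex ℝ s) (hsu : UniqueDiffOn ℝ s)
    {g : ℝ → ℝ} (hg : ContDiffOn ℝ ∞ g s) {a : ℝ} (ha : a ∈ s)
    (hk : ∃ k, iteratedDerivWithin k g s a ≠ 0) :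
    (fun u => (u - a) * derivWithin g s u) =O[nhdsWithin a s] g := by
  classical
  have taylor : ∀ (f : ℝ → ℝ) (k : ℕ), ContDiffOn ℝ ∞ f s →
      (∀ l < k, iteratedDerivWithin l f s a = 0) →
      (fun u => f u - (((k.factorial : ℝ)⁻¹ * (u - a) ^ k) * iteratedDerivWithin k f s a))
        =o[nhdsWithin a s] fun u => (u - a) ^ k := by
    intro f k hf hl
    have h1 := taylor_isLittleO (n := k) hs ha (hf.of_le (by exact_mod_cast le_top))
    refine h1.congr_left fun u => ?_
    rw [taylor_within_apply, Finset.sum_range_succ, Finset.sum_eq_zero, zero_add, smul_eq_mul]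
    intro l hl'
    rw [hl l (Finset.mem_range.1 hl'), smul_zero]
  set k := Nat.find hk with hkdef
  have hk0 : iteratedDerivWithin k g s a ≠ 0 := Nat.find_spec hk
  have hkl : ∀ l < k, iteratedDerivWithin l g s a = 0 := fun l hl => by
    by_contra h
    exact Nat.find_min hk hl h
  have hlow : (fun u => (u - a) ^ k) =O[nhdsWithin a s] g := by
    set c := (k.factorial : ℝ)⁻¹ * iteratedDerivWithin k g s a with hc
    have hc0 : c ≠ 0 := mul_ne_zero (by positivity) hk0
    have h1 : Asymptotics.IsEquivalent (nhdsWithin a s) g (fun u => c * (u - a) ^ k) := by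
      have h2 := (taylor g k hg hkl).trans_isBigO
        (Asymptotics.isBigO_self_const_mul (l := nhdsWithin a s) hc0 fun u => (u - a) ^ k)
      refine h2.congr_left fun u => ?_
      simp only [Pi.sub_apply, hc]
      ring
    exact (Asymptotics.isBigO_self_const_mul hc0 _ _).trans h1.isBigO_symm
  refine Asymptotics.IsBigO.trans ?_ hlow
  have hg' : ContDiffOn ℝ ∞ (derivWithin g s) s := hg.derivWithin hsu (by simp)
  rcases Nat.eq_zero_or_pos k with h0 | hpos
  · rw [h0]
    simp only [pow_zero]
    have hcont : Filter.Tendsto (fun u => (u - a) * derivWithin g s u) (nhdsWithin a s)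
        (nhds ((a - a) * derivWithin g s a)) :=
      (((continuous_id.sub continuous_const).tendsto a).mono_left nhdsWithin_le_nhds).mul
        (hg'.continuousOn a ha)
    exact hcont.isBigO_one ℝ
  · obtain ⟨j, hj⟩ : ∃ j, k = j + 1 := ⟨k - 1, by omega⟩
    have h1 := taylor (derivWithin g s) j hg' fun l hl => by
      rw [← iteratedDerivWithin_succ']
      exact hkl _ (by omega)
    have h2 : derivWithin g s =O[nhdsWithin a s] fun u => (u - a) ^ j := by
      have h3 : (fun u => ((j.factorial : ℝ)⁻¹ * (u - a) ^ j) *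
          iteratedDerivWithin j (derivWithin g s) s a) =O[nhdsWithin a s] fun u => (u - a) ^ j := by
        refine (Asymptotics.isBigO_const_mul_self ((j.factorial : ℝ)⁻¹ *
          iteratedDerivWithin j (derivWithin g s) s a) (fun u => (u - a) ^ j) _).congr_left ?_
        intro u
        ring
      exact (h1.isBigO.add h3).congr_left fun u => by ring
    rw [hj]
    refine ((Asymptotics.isBigO_refl (fun u => u - a) _).mul h2).congr_right fun u => ?_
    ring

namespace Coefficients

namespace Admissible

variable {c : Coefficients} {i : ℕ}

theorem n_ne_zero (hc : c.Admissible i) {u : ℝ} (hu : u ∈ Ioo (-1 : ℝ) 1) : c.n u ≠ 0 := by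
  obtain ⟨ι, hι, h⟩ := hc.iota_pos
  intro h0
  have := h u hu
  rw [h0] at this
  simp at this
  linarith

theorem continuousOn_dn (hc : c.Admissible i) : ContinuousOn c.dn (Icc (-1) 1) :=
  hc.smooth_n.continuousOn_derivWithin (uniqueDiffOn_Icc (by norm_num)) (by simp)

/-- If `n` is not flat at the endpoints, then `(1-u²) n'` is bounded by `n`. -/
theorem exists_one_sub_sq_mul_dn_le (hc : c.Admissible i) (hn : c.NotFlat) :
    ∃ C, ∀ u ∈ Ioo (-1 : ℝ) 1, (1 - u ^ 2) * |c.dn u| ≤ C * |c.n u| := by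
  have hsu : UniqueDiffOn ℝ (Icc (-1 : ℝ) 1) := uniqueDiffOn_Icc (by norm_num)
  have hO : ∀ a ∈ Icc (-1 : ℝ) 1,
      (fun u => (1 - u ^ 2) * c.dn u) =O[nhdsWithin a (Icc (-1) 1)] c.n := by
    intro a ha
    have hcont : ∀ p : ℝ → ℝ, Continuous p → p =O[nhdsWithin a (Icc (-1) 1)] fun _ => (1 : ℝ) :=
      fun p hp => ((hp.tendsto a).mono_left nhdsWithin_le_nhds).isBigO_one ℝ
    by_cases hI : a ∈ Ioo (-1 : ℝ) 1
    · have h1 : (fun u => (1 - u ^ 2) * c.dn u) =O[nhdsWithin a (Icc (-1) 1)] fun _ => (1 : ℝ) := by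
        have h2 := (hcont (fun u => 1 - u ^ 2) (by fun_prop)).mul
          ((hc.continuousOn_dn a ha).isBigO_one ℝ)
        simpa using h2
      refine h1.trans ?_
      have h3 : Filter.Tendsto c.n (nhdsWithin a (Icc (-1) 1)) (nhds (c.n a)) :=
        hc.smooth_n.continuousOn a ha
      refine Asymptotics.IsBigO.trans ?_ ((Asymptotics.isEquivalent_const_iff_tendsto
        (hc.n_ne_zero hI)).2 h3).isBigO_symm
      exact Asymptotics.isBigO_const_const _ (hc.n_ne_zero hI) _
    · have hend : a = 1 ∨ a = -1 := by
        rcases ha.1.eq_or_lt with h | h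
        · exact Or.inr h.symm
        · rcases ha.2.eq_or_lt with h' | h'
          · exact Or.inl h'
          · exact absurd ⟨h, h'⟩ hI
      have hk : ∃ k, iteratedDerivWithin k c.n (Icc (-1) 1) a ≠ 0 := by
        rcases hend with rfl | rfl
        · exact hn.1
        · exact hn.2
      have h1 := isBigO_sub_mul_derivWithin (convex_Icc (-1 : ℝ) 1) hsu hc.smooth_n ha hk
      have h2 : (fun u => -(u + a) * ((u - a) * c.dn u)) =O[nhdsWithin a (Icc (-1) 1)]
          fun u => 1 * c.n u := (hcont (fun u => -(u + a)) (by fun_prop)).mul h1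
      refine (h2.congr_right fun u => one_mul _).congr_left fun u => ?_
      have ha2 : a ^ 2 = 1 := by rcases hend with rfl | rfl <;> norm_num
      linear_combination c.dn u * ha2
  suffices h : ∃ C, ∀ u ∈ Icc (-1 : ℝ) 1, u ∈ Ioo (-1 : ℝ) 1 →
      (1 - u ^ 2) * |c.dn u| ≤ C * |c.n u| by
    obtain ⟨C, hC⟩ := h
    exact ⟨C, fun u hu => hC u (Ioo_subset_Icc_self hu) hu⟩
  refine isCompact_Icc.induction_on (p := fun t => ∃ C, ∀ u ∈ t, u ∈ Ioo (-1 : ℝ) 1 →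
      (1 - u ^ 2) * |c.dn u| ≤ C * |c.n u|) ⟨0, by simp⟩ ?_ ?_ ?_
  · rintro s t hst ⟨C, hC⟩
    exact ⟨C, fun u hu => hC u (hst hu)⟩
  · rintro s t ⟨C, hC⟩ ⟨D, hD⟩
    refine ⟨max C D, fun u hu hI => ?_⟩
    rcases hu with hu | hu
    · exact (hC u hu hI).trans (by gcongr; exact le_max_left _ _)
    · exact (hD u hu hI).trans (by gcongr; exact le_max_right _ _)
  · intro a ha
    obtain ⟨C, hC⟩ := (hO a ha).bound
    refine ⟨_, hC, C, fun u hu hI => ?_⟩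
    have h1 : ‖(1 - u ^ 2) * c.dn u‖ ≤ C * ‖c.n u‖ := hu
    rwa [norm_mul, Real.norm_eq_abs, Real.norm_eq_abs, Real.norm_eq_abs,
      abs_of_pos (one_sub_sq_pos hI)] at h1

/-! #### Integrability -/

theorem exists_mobility_bounds (hc : c.Admissible i) : ∃ mt : ℝ → ℝ, ∃ μ₀ M : ℝ, 0 < μ₀ ∧
    ContinuousOn mt (Icc (-1) 1) ∧
    (∀ u ∈ Icc (-1 : ℝ) 1, μ₀ ≤ mt u ∧ mt u ≤ M) ∧
    ∀ u ∈ Icc (-1 : ℝ) 1, c.m u = (1 - u ^ 2) ^ i * mt u := by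
  obtain ⟨mt, h1, h2, h3⟩ := hc.mobility
  have hne : (Icc (-1 : ℝ) 1).Nonempty := ⟨0, by norm_num⟩
  obtain ⟨a, ha, hmin⟩ := isCompact_Icc.exists_isMinOn hne h1.continuousOn
  obtain ⟨b, hb, hmax⟩ := isCompact_Icc.exists_isMaxOn hne h1.continuousOn
  exact ⟨mt, mt a, mt b, h2 a ha, h1.continuousOn, fun u hu => ⟨hmin hu, hmax hu⟩, h3⟩

theorem wm_nonneg (hc : c.Admissible i) {u : ℝ} (hu : u ∈ Icc (-1 : ℝ) 1) : 0 ≤ c.wm u := by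
  obtain ⟨mt, μ₀, M, hμ₀, -, hb, hm⟩ := hc.exists_mobility_bounds
  rw [wm, hm u hu]
  have h1 := (one_sub_sq_mem_Icc hu).1
  have h2 := hμ₀.trans_le (hb u hu).1
  positivity

theorem wm_pos (hc : c.Admissible i) {u : ℝ} (hu : u ∈ Ioo (-1 : ℝ) 1) : 0 < c.wm u := by
  obtain ⟨mt, μ₀, M, hμ₀, -, hb, hm⟩ := hc.exists_mobility_bounds
  rw [wm, hm u (Ioo_subset_Icc_self hu)]
  have h1 := one_sub_sq_pos hu
  have h2 := hμ₀.trans_le (hb u (Ioo_subset_Icc_self hu)).1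
  positivity

theorem aestronglyMeasurable_wm (hc : c.Admissible i) : AEStronglyMeasurable c.wm leb := by
  obtain ⟨mt, μ₀, M, hμ₀, hcont, hb, hm⟩ := hc.exists_mobility_bounds
  have h1 : ContinuousOn c.m (Icc (-1) 1) := by
    refine ContinuousOn.congr (f := fun u => (1 - u ^ 2) ^ i * mt u) ?_ hm
    exact (by fun_prop : Continuous fun u : ℝ => (1 - u ^ 2) ^ i).continuousOn.mul hcont
  have h2 : AEMeasurable (fun u : ℝ => √(1 - u ^ 2)) leb := by fun_prop
  exact ((h1.aemeasurable measurableSet_Icc).div h2).aestronglyMeasurable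

theorem integrable_wm (hc : c.Admissible i) : Integrable c.wm leb := by
  obtain ⟨mt, μ₀, M, hμ₀, hcont, hb, hm⟩ := hc.exists_mobility_bounds
  refine (integrable_inv_sqrt_one_sub_sq.const_mul M).mono' hc.aestronglyMeasurable_wm ?_
  filter_upwards [ae_restrict_mem measurableSet_Icc] with u hu
  rw [Real.norm_of_nonneg (hc.wm_nonneg hu), wm, hm u hu, div_eq_mul_one_div]
  gcongr
  have h1 := one_sub_sq_mem_Icc hu
  calc (1 - u ^ 2) ^ i * mt u ≤ 1 * mt u := by
        gcongr
        · exact hμ₀.le.trans (hb u hu).1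
        · exact pow_le_one₀ h1.1 h1.2
    _ ≤ M := by
        rw [one_mul]
        exact (hb u hu).2

theorem memLp_sqrt_wm (hc : c.Admissible i) : MemLp (fun u => √(c.wm u)) 2 leb := by
  have hm : AEStronglyMeasurable (fun u => √(c.wm u)) leb :=
    hc.aestronglyMeasurable_wm.aemeasurable.sqrt.aestronglyMeasurable
  rw [memLp_two_iff_integrable_sq_norm hm]
  refine hc.integrable_wm.congr ?_
  filter_upwards [ae_restrict_mem measurableSet_Icc] with u hu
  rw [Real.norm_of_nonneg (Real.sqrt_nonneg _), Real.sq_sqrt (hc.wm_nonneg hu)]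

theorem aestronglyMeasurable_n_div_dn (hc : c.Admissible i) :
    AEStronglyMeasurable (fun u => c.n u / c.dn u) leb :=
  ((hc.smooth_n.continuousOn.aemeasurable measurableSet_Icc).div
    (hc.continuousOn_dn.aemeasurable measurableSet_Icc)).aestronglyMeasurable

/-- The weight `√𝖺` controls `n / n'`. -/
theorem exists_n_div_dn_le (hc : c.Admissible i) :
    ∃ B : ℝ, 0 ≤ B ∧ ∀ u ∈ Ioo (-1 : ℝ) 1, |c.n u / c.dn u| ≤ B * √(c.wa u) := by
  obtain ⟨ι, hι, h⟩ := hc.iota_pos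
  refine ⟨(√ι)⁻¹, by positivity, fun u hu => ?_⟩
  have h1 : ι * (c.n u / c.dn u) ^ 2 ≤ c.wa u := by
    have h2 : c.wa u = c.n u ^ 2 / (c.Asqτ u * √(1 - u ^ 2)) * (c.n u / c.dn u) ^ 2 := by
      rw [wa]
      have := (hc.Asqτ_pos u hu).ne'
      have := (Real.sqrt_pos.2 (one_sub_sq_pos hu)).ne'
      by_cases h0 : c.dn u = 0
      · simp [h0]
      · field_simp
    rw [h2]
    gcongr
    exact h u hu
  have h3 : √(ι * (c.n u / c.dn u) ^ 2) ≤ √(c.wa u) := Real.sqrt_le_sqrt h1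
  rw [Real.sqrt_mul hι.le, Real.sqrt_sq_eq_abs] at h3
  rwa [← div_eq_inv_mul, le_div_iff₀ (Real.sqrt_pos.2 hι), mul_comm]

/-! #### A weight for the vertical average -/

/-- There is a weight `w` with the same integral over `[-1,1]` as `1` such that `w / √𝗆` is square
integrable and such that the primitive `h` of `1 - w` vanishing at the endpoints is dominated by
`n / n'`. If the mobility degenerates at most linearly, `w = 1` and `h = 0` will do; otherwise `w` is
a multiple of `(1-u²)^i`, and `h`, being Lipschitz, is dominated by `1-u²`. -/
theorem exists_weight (hc : c.Admissible i) (hi : i ≤ 1 ∨ c.NotFlat) :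
    ∃ w h : ℝ → ℝ, Continuous w ∧ (∀ u, HasDerivAt h (1 - w u) u) ∧ h (-1) = 0 ∧ h 1 = 0 ∧
      (∃ q : ℝ → ℝ, MemLp q 2 leb ∧ ∀ u ∈ Ioo (-1 : ℝ) 1, |w u| ≤ q u * √(c.wm u)) ∧
      ∃ C : ℝ, ∀ u ∈ Ioo (-1 : ℝ) 1, |h u| * |c.dn u| ≤ C * |c.n u| := by
  obtain ⟨mt, μ₀, M, hμ₀, hcont, hb, hm⟩ := hc.exists_mobility_bounds
  -- a continuous weight may be divided by `√𝗆` as soon as its square is `O((1-u²)^i / (1-u²))`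
  have hq : ∀ (w : ℝ → ℝ) (D : ℝ), Continuous w →
      (∀ u ∈ Ioo (-1 : ℝ) 1, w u ^ 2 * (1 - u ^ 2) ≤ D * (1 - u ^ 2) ^ i) →
      ∃ q : ℝ → ℝ, MemLp q 2 leb ∧ ∀ u ∈ Ioo (-1 : ℝ) 1, |w u| ≤ q u * √(c.wm u) := by
    intro w D hw hD
    refine ⟨fun u => |w u| / √(c.wm u), ?_, fun u hu => ?_⟩
    · have hmeas : AEStronglyMeasurable (fun u => |w u| / √(c.wm u)) leb :=
        (hw.abs.measurable.aemeasurable.div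
          hc.aestronglyMeasurable_wm.aemeasurable.sqrt).aestronglyMeasurable
      rw [memLp_two_iff_integrable_sq_norm hmeas]
      refine (integrable_inv_sqrt_one_sub_sq.const_mul (D / μ₀)).mono' (hmeas.norm.pow 2) ?_
      filter_upwards [ae_leb_mem_Ioo] with u hu
      have h0 := one_sub_sq_pos hu
      have hI := Ioo_subset_Icc_self hu
      have hmt := (hb u hI).1
      rw [norm_pow, norm_norm, Real.norm_of_nonneg (by positivity), div_pow, sq_abs,
        Real.sq_sqrt (hc.wm_pos hu).le, wm, hm u hI, div_div_eq_mul_div, mul_one_div,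
        div_div, div_le_div_iff₀ (by have := hμ₀.trans_le hmt; positivity) (by positivity)]
      have hs : √(1 - u ^ 2) * √(1 - u ^ 2) = 1 - u ^ 2 := Real.mul_self_sqrt h0.le
      have hD0 : 0 ≤ D * (1 - u ^ 2) ^ i := le_trans (by positivity) (hD u hu)
      calc w u ^ 2 * √(1 - u ^ 2) * (μ₀ * √(1 - u ^ 2))
          = (w u ^ 2 * (1 - u ^ 2)) * μ₀ := by linear_combination (w u ^ 2 * μ₀) * hs
        _ ≤ (D * (1 - u ^ 2) ^ i) * mt u := mul_le_mul (hD u hu) hmt hμ₀.le hD0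
        _ = D * ((1 - u ^ 2) ^ i * mt u) := by ring
    · rw [div_mul_cancel₀ _ (Real.sqrt_pos.2 (hc.wm_pos hu)).ne']
  rcases hi with hi | hi
  · refine ⟨fun _ => 1, fun _ => 0, continuous_const, fun u => by
      simpa using hasDerivAt_const u (0 : ℝ), rfl, rfl, hq _ 1 continuous_const fun u hu => ?_, 0,
      fun u hu => by simp⟩
    have h0 := one_sub_sq_mem_Icc (Ioo_subset_Icc_self hu)
    rw [one_pow, one_mul, one_mul]
    simpa using pow_le_pow_of_le_one h0.1 h0.2 hi
  · set J := ∫ u in (-1 : ℝ)..1, (1 - u ^ 2) ^ i with hJ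
    have hcw : Continuous fun u : ℝ => (1 - u ^ 2) ^ i := by fun_prop
    have hJ0 : 0 < J := by
      refine intervalIntegral.intervalIntegral_pos_of_pos_on (hcw.intervalIntegrable _ _)
        (fun u hu => ?_) (by norm_num)
      have := one_sub_sq_pos hu
      positivity
    set w : ℝ → ℝ := fun u => 2 / J * (1 - u ^ 2) ^ i with hw
    have hwc : Continuous w := by fun_prop
    have hwc' : Continuous fun u => 1 - w u := by fun_prop
    set h : ℝ → ℝ := fun u => ∫ v in (-1 : ℝ)..u, (1 - w v) with hh
    have hder : ∀ u, HasDerivAt h (1 - w u) u := fun u => hwc'.integral_hasStrictDerivAt _ u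
      |>.hasDerivAt
    have hm1 : h (-1) = 0 := by simp [hh]
    have hp1 : h 1 = 0 := by
      simp only [hh]
      rw [intervalIntegral.integral_sub (by simp) (hwc.intervalIntegrable _ _)]
      simp only [hw, intervalIntegral.integral_const_mul, ← hJ, intervalIntegral.integral_const]
      rw [div_mul_cancel₀ _ hJ0.ne']
      norm_num
    refine ⟨w, h, hwc, hder, hm1, hp1, hq w ((2 / J) ^ 2) hwc fun u hu => ?_, ?_⟩
    · have h0 := one_sub_sq_mem_Icc (Ioo_subset_Icc_self hu)
      have h1 : (1 - u ^ 2) ^ i ≤ 1 := pow_le_one₀ h0.1 h0.2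
      have h2 : 0 ≤ (1 - u ^ 2) ^ i := pow_nonneg h0.1 i
      simp only [hw, mul_pow]
      have h3 : (1 - u ^ 2) ^ i * (1 - u ^ 2) ≤ 1 * 1 := mul_le_mul h1 h0.2 h0.1 zero_le_one
      calc (2 / J) ^ 2 * ((1 - u ^ 2) ^ i) ^ 2 * (1 - u ^ 2)
          = (2 / J) ^ 2 * ((1 - u ^ 2) ^ i * ((1 - u ^ 2) ^ i * (1 - u ^ 2))) := by ring
        _ ≤ (2 / J) ^ 2 * ((1 - u ^ 2) ^ i * (1 * 1)) := by gcongr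
        _ = _ := by ring
    · obtain ⟨C, hC⟩ := hc.exists_one_sub_sq_mul_dn_le hi
      -- `h` is Lipschitz and vanishes at the endpoints
      obtain ⟨a, ha, hmax⟩ := isCompact_Icc.exists_isMaxOn (s := Icc (-1 : ℝ) 1)
        ⟨0, by norm_num⟩ hwc'.abs.continuousOn
      set K := |1 - w a| with hK
      have hlip : ∀ x ∈ Icc (-1 : ℝ) 1, ∀ y ∈ Icc (-1 : ℝ) 1, ‖h y - h x‖ ≤ K * ‖y - x‖ :=
        fun x hx y hy => (convex_Icc (-1 : ℝ) 1).norm_image_sub_le_of_norm_hasDerivWithin_le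
          (fun z _ => (hder z).hasDerivWithinAt) (fun z hz => hmax hz) hx hy
      have hhu : ∀ u ∈ Ioo (-1 : ℝ) 1, |h u| ≤ K * (1 - u ^ 2) := by
        intro u hu
        have hI := Ioo_subset_Icc_self hu
        have hK0 : 0 ≤ K := abs_nonneg _
        rcases le_total u 0 with h0 | h0
        · have h1 := hlip (-1) (by norm_num) u hI
          rw [hm1, sub_zero, Real.norm_eq_abs, Real.norm_eq_abs,
            abs_of_nonneg (show (0 : ℝ) ≤ u - -1 by linarith [hu.1])] at h1
          exact h1.trans (mul_le_mul_of_nonneg_left (by nlinarith [hu.1]) hK0)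
        · have h1 := hlip 1 (by norm_num) u hI
          rw [hp1, sub_zero, Real.norm_eq_abs, Real.norm_eq_abs,
            abs_of_nonpos (show u - 1 ≤ (0 : ℝ) by linarith [hu.2])] at h1
          exact h1.trans (mul_le_mul_of_nonneg_left (by nlinarith [hu.2]) hK0)
      refine ⟨K * C, fun u hu => ?_⟩
      calc |h u| * |c.dn u| ≤ K * (1 - u ^ 2) * |c.dn u| := by
            gcongr
            exact hhu u hu
        _ = K * ((1 - u ^ 2) * |c.dn u|) := by ring
        _ ≤ K * (C * |c.n u|) := by
            exact mul_le_mul_of_nonneg_left (hC u hu) (abs_nonneg _)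
        _ = _ := by ring

end Admissible

end Coefficients

/-! ### The Sobolev space as a Hilbert space -/

section Sobolev

variable {d : ℕ} (Γ : Set (E d))

/-- `H¹(Γ)` with its Hilbert space structure `⟪κ, ψ⟫ = ⟪κ, ψ⟫_{L²} + ⟪∇κ, ∇ψ⟫_{L²}`. -/
def HilbertH1 : Submodule ℝ (WithLp 2 (L2 Γ × L2vec Γ)) :=
  (H1 Γ).comap (WithLp.prodContinuousLinearEquiv 2 ℝ (L2 Γ) (L2vec Γ)).toLinearMap

theorem isClosed_H1 : IsClosed (H1 Γ : Set (L2 Γ × L2vec Γ)) :=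
  Submodule.isClosed_topologicalClosure _

instance : CompleteSpace (HilbertH1 Γ) := by
  have h : IsClosed (HilbertH1 Γ : Set (WithLp 2 (L2 Γ × L2vec Γ))) :=
    (isClosed_H1 Γ).preimage (WithLp.prodContinuousLinearEquiv 2 ℝ (L2 Γ) (L2vec Γ)).continuous
  exact h.completeSpace_coe

/-- The Hilbert space `H¹(Γ)` has the same elements and the same topology as `H1 Γ`. -/
def ofHilbert : HilbertH1 Γ →L[ℝ] H1 Γ :=
  ((WithLp.prodContinuousLinearEquiv 2 ℝ (L2 Γ) (L2vec Γ)).toContinuousLinearMap ∘L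
    (HilbertH1 Γ).subtypeL).codRestrict (H1 Γ) fun x => x.2

/-- The inverse of `ofHilbert`. -/
def toHilbert : H1 Γ →L[ℝ] HilbertH1 Γ :=
  ((WithLp.prodContinuousLinearEquiv 2 ℝ (L2 Γ) (L2vec Γ)).symm.toContinuousLinearMap ∘L
    (H1 Γ).subtypeL).codRestrict (HilbertH1 Γ) fun x => x.2

/-- The inclusion `H¹(Γ) → L²(Γ)`. -/
def H1fnL : H1 Γ →L[ℝ] L2 Γ := ContinuousLinearMap.fst ℝ _ _ ∘L (H1 Γ).subtypeL

/-- The gradient `H¹(Γ) → L²(Γ; ℝ^d)`. -/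
def H1gradL : H1 Γ →L[ℝ] L2vec Γ := ContinuousLinearMap.snd ℝ _ _ ∘L (H1 Γ).subtypeL

/-- The inclusion of the Hilbert space `H¹(Γ)` into `L²(Γ)`. -/
def incl : HilbertH1 Γ →L[ℝ] L2 Γ := H1fnL Γ ∘L ofHilbert Γ

/-- The gradient on the Hilbert space `H¹(Γ)`. -/
def grad : HilbertH1 Γ →L[ℝ] L2vec Γ := H1gradL Γ ∘L ofHilbert Γ

variable {Γ}

@[simp] theorem ofHilbert_toHilbert (κ : H1 Γ) : ofHilbert Γ (toHilbert Γ κ) = κ := rfl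

theorem incl_apply (κ : HilbertH1 Γ) : incl Γ κ = H1fn (ofHilbert Γ κ) := rfl

theorem grad_apply (κ : HilbertH1 Γ) : grad Γ κ = H1grad (ofHilbert Γ κ) := rfl

theorem inner_hilbertH1 (κ ψ : HilbertH1 Γ) :
    ⟪κ, ψ⟫ = ⟪incl Γ κ, incl Γ ψ⟫ + ⟪grad Γ κ, grad Γ ψ⟫ := by
  rw [Submodule.coe_inner, WithLp.prod_inner_apply]
  rfl

variable (Γ)

/-- The adjoint of the inclusion `H¹(Γ) → L²(Γ)`, that is, the resolvent `(1 - Δ)⁻¹` as a map from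
`L²(Γ)` to `H¹(Γ)`. -/
def resolvent : L2 Γ →L[ℝ] HilbertH1 Γ := ContinuousLinearMap.adjoint (incl Γ)

/-- The resolvent `(1 - Δ)⁻¹` on `L²(Γ)`. -/
def resolventFn : L2 Γ →L[ℝ] L2 Γ := incl Γ ∘L resolvent Γ

/-- The operator `1 - ∇∇*` on vector fields, which intertwines the gradient with the resolvent. -/
def resolventVec : L2vec Γ →L[ℝ] L2vec Γ :=
  ContinuousLinearMap.id ℝ _ - grad Γ ∘L ContinuousLinearMap.adjoint (grad Γ)

variable {Γ}

theorem inner_resolvent_left (g : L2 Γ) (ψ : HilbertH1 Γ) : ⟪resolvent Γ g, ψ⟫ = ⟪g, incl Γ ψ⟫ :=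
  ContinuousLinearMap.adjoint_inner_left _ _ _

theorem inner_resolvent_right (g : L2 Γ) (ψ : HilbertH1 Γ) : ⟪ψ, resolvent Γ g⟫ = ⟪incl Γ ψ, g⟫ :=
  ContinuousLinearMap.adjoint_inner_right _ _ _

theorem inner_resolventFn (x y : L2 Γ) : ⟪resolventFn Γ x, y⟫ = ⟪x, resolventFn Γ y⟫ := by
  change ⟪incl Γ (resolvent Γ x), y⟫ = ⟪x, incl Γ (resolvent Γ y)⟫
  rw [← inner_resolvent_right, inner_resolvent_left]

theorem inner_resolventVec (x y : L2vec Γ) : ⟪resolventVec Γ x, y⟫ = ⟪x, resolventVec Γ y⟫ := by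
  simp only [resolventVec, sub_apply, ContinuousLinearMap.id_apply,
    ContinuousLinearMap.comp_apply, inner_sub_left, inner_sub_right]
  rw [← ContinuousLinearMap.adjoint_inner_right (grad Γ),
    ← ContinuousLinearMap.adjoint_inner_left (grad Γ)]

/-- `(1 - ∇∇*) ∇κ = ∇ (1 - Δ)⁻¹ κ`. -/
theorem resolventVec_grad (κ : HilbertH1 Γ) :
    resolventVec Γ (grad Γ κ) = grad Γ (resolvent Γ (incl Γ κ)) := by
  have h : resolvent Γ (incl Γ κ) = κ - ContinuousLinearMap.adjoint (grad Γ) (grad Γ κ) := by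
    refine ext_inner_right ℝ fun ψ => ?_
    rw [inner_resolvent_left, inner_sub_left, ContinuousLinearMap.adjoint_inner_left,
      inner_hilbertH1 κ ψ, add_sub_cancel_right]
  rw [h, map_sub]
  rfl

/-- An element of `H²(Γ)` is the resolvent of `κ - Δκ`. -/
theorem toHilbert_eq_resolvent {κ : H1 Γ} {g : L2 Γ} (hg : IsLaplacian κ g) :
    toHilbert Γ κ = resolvent Γ (H1fn κ - g) := by
  refine ext_inner_right ℝ fun ψ => ?_
  have h1 := hg (ofHilbert Γ ψ)
  rw [inner_resolvent_left, inner_hilbertH1, inner_sub_left, incl_apply, grad_apply,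
    ofHilbert_toHilbert, grad_apply, h1, incl_apply]
  ring

/-- The pair of a smooth function and its tangential gradient belongs to `H¹(Γ)`. -/
theorem mem_H1_of_contDiff {f : E d → ℝ} (hf : ContDiff ℝ ∞ f) {x : L2 Γ} {y : L2vec Γ}
    (hx : x =ᵐ[surfaceMeasure Γ] f) (hy : y =ᵐ[surfaceMeasure Γ] tangentialGradient Γ f) :
    (x, y) ∈ H1 Γ :=
  Submodule.le_topologicalClosure _ (Submodule.subset_span ⟨f, hf, hx, hy⟩)

end Sobolev

/-! ### Smooth functions on the cylinder -/

section Cylinder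

variable {d : ℕ} {Γ : Set (E d)}

theorem tangentialGradient_mul_const {f : E d → ℝ} (hf : Differentiable ℝ f) (r : ℝ) (x : E d) :
    tangentialGradient Γ (fun y => f y * r) x = r • tangentialGradient Γ f x := by
  rw [tangentialGradient, tangentialGradient, gradient, gradient, fderiv_mul_const (hf x), map_smul,
    map_smul]

theorem du_eq_fderiv {f : E d × ℝ → ℝ} (hf : ContDiff ℝ ∞ f) (x : E d × ℝ) :
    du f x = fderiv ℝ f x (0, 1) := by
  have h1 : HasFDerivAt f (fderiv ℝ f x) x := (hf.differentiable (by simp) x).hasFDerivAt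
  have h2 : HasDerivAt (fun v : ℝ => (x.1, v)) (0, 1) x.2 :=
    (hasDerivAt_const x.2 x.1).prodMk (hasDerivAt_id x.2)
  exact (h1.comp_hasDerivAt x.2 h2).deriv

theorem contDiff_du {f : E d × ℝ → ℝ} (hf : ContDiff ℝ ∞ f) : ContDiff ℝ ∞ (du f) := by
  have h : du f = fun x => fderiv ℝ f x (0, 1) := funext fun x => du_eq_fderiv hf x
  rw [h]
  exact (hf.fderiv_right (m := ∞) (by simp)).clm_apply contDiff_const

theorem hasDerivAt_slice {f : E d × ℝ → ℝ} (hf : ContDiff ℝ ∞ f) (s : E d) (u : ℝ) :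
    HasDerivAt (fun v => f (s, v)) (du f (s, u)) u := by
  have h1 : Differentiable ℝ fun v : ℝ => f (s, v) :=
    (hf.comp (contDiff_const.prodMk contDiff_id)).differentiable (by simp)
  exact (h1 u).hasDerivAt

theorem exists_bound_of_continuous (hΓ : IsCompact Γ) {f : E d × ℝ → ℝ} (hf : Continuous f)
    (a b : ℝ) : ∃ M, ∀ s ∈ Γ, ∀ u ∈ Icc a b, ‖f (s, u)‖ ≤ M := by
  obtain ⟨M, hM⟩ := (hΓ.prod isCompact_Icc).exists_bound_of_continuousOn (s := Γ ×ˢ Icc a b)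
    hf.continuousOn
  exact ⟨M, fun s hs u hu => hM (s, u) ⟨hs, hu⟩⟩

theorem ae_mem_surface (hΓ : IsCompact Γ) : ∀ᵐ s ∂(surfaceMeasure Γ), s ∈ Γ :=
  ae_restrict_mem hΓ.measurableSet

theorem integrable_mul_slice (hΓ : IsCompact Γ) {f : E d × ℝ → ℝ} (hf : Continuous f)
    {b : E d → ℝ} (hb : Integrable b (surfaceMeasure Γ)) (u : ℝ) :
    Integrable (fun s => b s * f (s, u)) (surfaceMeasure Γ) := by
  obtain ⟨M, hM⟩ := exists_bound_of_continuous hΓ hf u u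
  refine hb.mul_bdd (c := M) ?_ ?_
  · exact (by fun_prop : Continuous fun s => f (s, u)).aestronglyMeasurable
  · filter_upwards [ae_mem_surface hΓ] with s hs
    exact hM s hs u ⟨le_rfl, le_rfl⟩

theorem hasDerivAt_integral_mul_slice (hΓ : IsCompact Γ) {f : E d × ℝ → ℝ} (hf : ContDiff ℝ ∞ f)
    {b : E d → ℝ} (hb : Integrable b (surfaceMeasure Γ)) (u : ℝ) :
    HasDerivAt (fun u => ∫ s, b s * f (s, u) ∂(surfaceMeasure Γ))
      (∫ s, b s * du f (s, u) ∂(surfaceMeasure Γ)) u := by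
  obtain ⟨M, hM⟩ := exists_bound_of_continuous hΓ (contDiff_du hf).continuous (u - 1) (u + 1)
  refine (hasDerivAt_integral_of_dominated_loc_of_deriv_le (s := Metric.ball u 1)
    (bound := fun s => ‖b s‖ * M) (F' := fun u s => b s * du f (s, u))
    (Metric.ball_mem_nhds u one_pos) ?_ ?_ ?_ ?_ ?_ ?_).2
  · exact Filter.Eventually.of_forall fun v =>
      (integrable_mul_slice hΓ hf.continuous hb v).aestronglyMeasurable
  · exact integrable_mul_slice hΓ hf.continuous hb u
  · exact (integrable_mul_slice hΓ (contDiff_du hf).continuous hb u).aestronglyMeasurable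
  · filter_upwards [ae_mem_surface hΓ] with s hs v hv
    rw [norm_mul]
    refine mul_le_mul_of_nonneg_left (hM s hs v ?_) (norm_nonneg _)
    rw [Real.ball_eq_Ioo] at hv
    exact Ioo_subset_Icc_self hv
  · exact hb.norm.mul_const M
  · exact Filter.Eventually.of_forall fun s v _ => (hasDerivAt_slice hf s v).const_mul (b s)

theorem deriv_integral_mul_slice (hΓ : IsCompact Γ) {f : E d × ℝ → ℝ} (hf : ContDiff ℝ ∞ f)
    {b : E d → ℝ} (hb : Integrable b (surfaceMeasure Γ)) :
    deriv (fun u => ∫ s, b s * f (s, u) ∂(surfaceMeasure Γ))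
      = fun u => ∫ s, b s * du f (s, u) ∂(surfaceMeasure Γ) :=
  funext fun u => (hasDerivAt_integral_mul_slice hΓ hf hb u).deriv

theorem contDiff_integral_mul_slice (hΓ : IsCompact Γ) {f : E d × ℝ → ℝ} (hf : ContDiff ℝ ∞ f)
    {b : E d → ℝ} (hb : Integrable b (surfaceMeasure Γ)) :
    ContDiff ℝ ∞ (fun u => ∫ s, b s * f (s, u) ∂(surfaceMeasure Γ)) := by
  rw [contDiff_infty]
  intro n
  induction n generalizing f with
  | zero =>
    rw [Nat.cast_zero, contDiff_zero]
    exact continuous_iff_continuousAt.2 fun u =>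
      (hasDerivAt_integral_mul_slice hΓ hf hb u).continuousAt
  | succ n ih =>
    push_cast
    rw [contDiff_succ_iff_deriv]
    refine ⟨fun u => (hasDerivAt_integral_mul_slice hΓ hf hb u).differentiableAt, by simp, ?_⟩
    rw [deriv_integral_mul_slice hΓ hf hb]
    exact ih (contDiff_du hf)

end Cylinder

/-! ### Elementary tensors in the energy space -/

section Energy

variable {d : ℕ} {Γ : Set (E d)} {c : Coefficients} {i : ℕ}

/-- The space `L² × L² × H¹(Γ)` in which the energy space `H` is realised. -/
abbrev Ambient (Γ : Set (E d)) : Type :=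
  Lp ℝ 2 (cylMeasure Γ) × Lp (E d) 2 (cylMeasure Γ) × H1 Γ

/-- `v` is the triple `(√𝖺 ∂_u f, √𝗆 ∇_Γ f, 𝒞f)` of the smooth function `f`. -/
structure IsTriple (c : Coefficients) (f : E d × ℝ → ℝ) (v : Ambient Γ) : Prop where
  contDiff : ContDiff ℝ ∞ f
  du_eq : v.1 =ᵐ[cylMeasure Γ] fun x => √(c.wa x.2) * du f x
  grad_eq : v.2.1 =ᵐ[cylMeasure Γ] fun x => √(c.wm x.2) • tgrad Γ f x
  constraint_eq : H1fn v.2.2 =ᵐ[surfaceMeasure Γ] constraintFn c f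

theorem H_eq_closure : H Γ c = (Submodule.span ℝ
    {v : Ambient Γ | ∃ f, IsTriple c f v}).topologicalClosure := by
  have h : {v : Ambient Γ | ∃ f : E d × ℝ → ℝ, ContDiff ℝ ∞ f ∧
      v.1 =ᵐ[cylMeasure Γ] (fun x => √(c.wa x.2) * du f x) ∧
      v.2.1 =ᵐ[cylMeasure Γ] (fun x => √(c.wm x.2) • tgrad Γ f x) ∧
      H1fn v.2.2 =ᵐ[surfaceMeasure Γ] constraintFn c f} = {v | ∃ f, IsTriple c f v} := by
    ext v
    exact exists_congr fun f => ⟨fun ⟨h1, h2, h3, h4⟩ => ⟨h1, h2, h3, h4⟩,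
      fun ⟨h1, h2, h3, h4⟩ => ⟨h1, h2, h3, h4⟩⟩
  rw [← h]
  rfl

theorem IsTriple.mem_H {f : E d × ℝ → ℝ} {v : Ambient Γ} (h : IsTriple c f v) : v ∈ H Γ c := by
  rw [H_eq_closure]
  exact Submodule.le_topologicalClosure _ (Submodule.subset_span ⟨f, h⟩)

theorem isClosed_H : IsClosed (H Γ c : Set (Ambient Γ)) :=
  Submodule.isClosed_topologicalClosure _

/-- A continuous linear map sends `H` into a closed subspace as soon as it does so for the triples of
smooth functions. -/
theorem map_mem_of_triples {X : Type*} [NormedAddCommGroup X] [NormedSpace ℝ X]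
    (T : Ambient Γ →L[ℝ] X) {S : Submodule ℝ X} (hS : IsClosed (S : Set X))
    (h : ∀ f v, IsTriple c f v → T v ∈ S) {v : Ambient Γ} (hv : v ∈ H Γ c) : T v ∈ S := by
  rw [H_eq_closure] at hv
  have hle : Submodule.span ℝ {v : Ambient Γ | ∃ f, IsTriple c f v} ≤ S.comap T.toLinearMap :=
    Submodule.span_le.2 fun v ⟨f, hf⟩ => h f v hf
  exact Submodule.topologicalClosure_minimal _ hle (hS.preimage T.continuous) hv

/-- A continuous linear map sends `H¹(Γ)` into a closed subspace as soon as it does so for smooth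
functions. -/
theorem map_mem_of_smooth {X : Type*} [NormedAddCommGroup X] [NormedSpace ℝ X]
    (T : H1 Γ →L[ℝ] X) {S : Submodule ℝ X} (hS : IsClosed (S : Set X))
    (h : ∀ (f : E d → ℝ) (κ : H1 Γ), ContDiff ℝ ∞ f → H1fn κ =ᵐ[surfaceMeasure Γ] f →
      H1grad κ =ᵐ[surfaceMeasure Γ] tangentialGradient Γ f → T κ ∈ S) (κ : H1 Γ) : T κ ∈ S := by
  have hcl : IsClosed ((S.comap T.toLinearMap).map (H1 Γ).subtype : Set (L2 Γ × L2vec Γ)) := by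
    rw [Submodule.map_coe]
    exact (isClosed_H1 Γ).isClosedEmbedding_subtypeVal.isClosedMap _ (hS.preimage T.continuous)
  have hle : H1 Γ ≤ (S.comap T.toLinearMap).map (H1 Γ).subtype := by
    refine Submodule.topologicalClosure_minimal _ (Submodule.span_le.2 ?_) hcl
    rintro v ⟨f, hf, h1, h2⟩
    have hv : v ∈ H1 Γ := mem_H1_of_contDiff hf h1 h2
    exact ⟨⟨v, hv⟩, h f ⟨v, hv⟩ hf h1 h2, rfl⟩
  obtain ⟨κ', hκ', he⟩ := hle κ.2
  have : κ' = κ := Subtype.ext he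
  exact this ▸ hκ'

/-- The constraint applied to a function of `u` only. -/
def constraintOf (c : Coefficients) (p : ℝ → ℝ) : ℝ :=
  ∫ u in Icc (-1 : ℝ) 1, (p u + c.n u / c.dn u * deriv p u)

theorem ae_cyl_snd {P : ℝ → Prop} (h : ∀ᵐ u ∂leb, P u) : ∀ᵐ x ∂(cylMeasure Γ), P x.2 :=
  Measure.quasiMeasurePreserving_snd.ae h

theorem ae_cyl_fst {P : E d → Prop} (h : ∀ᵐ s ∂(surfaceMeasure Γ), P s) :
    ∀ᵐ x ∂(cylMeasure Γ), P x.1 :=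
  Measure.quasiMeasurePreserving_fst.ae h

theorem inner_eq_integral (x y : L2 Γ) : ⟪x, y⟫ = ∫ s, x s * y s ∂(surfaceMeasure Γ) := by
  rw [L2.inner_def]
  refine integral_congr_ae (Filter.Eventually.of_forall fun s => ?_)
  simp [mul_comm]

variable [IsFiniteMeasure (surfaceMeasure Γ)]

/-- The triple of the elementary tensor `κ(s) p(u)`, as a function of `κ`. -/
def tensorTriple (c : Coefficients) (p : ℝ → ℝ) (P₁ P₀ : Lp ℝ 2 leb) : H1 Γ →L[ℝ] Ambient Γ :=
  (tensorL P₁ ∘L H1fnL Γ).prod ((tensorL P₀ ∘L H1gradL Γ).prod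
    (constraintOf c p • ContinuousLinearMap.id ℝ (H1 Γ)))

/-- Elementary tensors `κ(s) p(u)` with `κ ∈ H¹(Γ)` and `p` smooth belong to the energy space. -/
theorem tensorTriple_mem_H {p : ℝ → ℝ} (hp : ContDiff ℝ ∞ p) {P₁ P₀ : Lp ℝ 2 leb}
    (h₁ : P₁ =ᵐ[leb] fun u => √(c.wa u) * deriv p u) (h₀ : P₀ =ᵐ[leb] fun u => √(c.wm u) * p u)
    (κ : H1 Γ) : tensorTriple c p P₁ P₀ κ ∈ H Γ c := by
  refine map_mem_of_smooth (tensorTriple c p P₁ P₀) isClosed_H (fun f κ hf hκ hκ' => ?_) κ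
  have hdu : ∀ x : E d × ℝ, du (fun x : E d × ℝ => f x.1 * p x.2) x = f x.1 * deriv p x.2 :=
    fun x => deriv_const_mul (f x.1) (hp.differentiable (by simp) x.2)
  refine IsTriple.mem_H (f := fun x => f x.1 * p x.2) ⟨?_, ?_, ?_, ?_⟩
  · exact (hf.comp contDiff_fst).mul (hp.comp contDiff_snd)
  · have h := coeFn_tensor (H1fn κ) P₁
    change tensor (H1fn κ) P₁ =ᵐ[cylMeasure Γ] _
    filter_upwards [h, ae_cyl_snd h₁, ae_cyl_fst hκ] with x k1 k2 k3
    rw [k1, k2, k3, hdu, smul_eq_mul]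
    ring
  · have h := coeFn_tensor (H1grad κ) P₀
    change tensor (H1grad κ) P₀ =ᵐ[cylMeasure Γ] _
    filter_upwards [h, ae_cyl_snd h₀, ae_cyl_fst hκ'] with x k1 k2 k3
    change _ = √(c.wm x.2) • tangentialGradient Γ (fun y => f y * p x.2) x.1
    rw [k1, k2, k3, tangentialGradient_mul_const (hf.differentiable (by simp)), smul_smul]
  · change (constraintOf c p • H1fn κ : L2 Γ) =ᵐ[surfaceMeasure Γ] _
    filter_upwards [Lp.coeFn_smul (constraintOf c p) (H1fn κ), hκ] with s k1 k2
    rw [k1, Pi.smul_apply, k2, constraintFn, smul_eq_mul, constraintOf, mul_comm,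
      ← integral_const_mul]
    refine integral_congr_ae (Filter.Eventually.of_forall fun u => ?_)
    simp only [hdu]
    ring

/-- `√𝗆` as an element of `L²(-1,1)`. -/
def sqrtWm (hc : c.Admissible i) : Lp ℝ 2 leb := hc.memLp_sqrt_wm.toLp

theorem coeFn_sqrtWm (hc : c.Admissible i) : sqrtWm hc =ᵐ[leb] fun u => √(c.wm u) :=
  hc.memLp_sqrt_wm.coeFn_toLp

theorem constraintOf_one : constraintOf c (fun _ => 1) = 2 := by
  simp only [constraintOf, deriv_const, mul_zero, add_zero, integral_const]
  simp only [measureReal_def, Measure.restrict_apply_univ, Real.volume_Icc, smul_eq_mul, mul_one]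
  norm_num

theorem tensor_zero_right (κ : L2 Γ) : (tensor κ (0 : Lp ℝ 2 leb) : Lp ℝ 2 (cylMeasure Γ)) = 0 := by
  have : ‖tensor κ (0 : Lp ℝ 2 leb)‖ = 0 := by rw [norm_tensor, norm_zero, mul_zero]
  exact norm_eq_zero.1 this

theorem tensorTriple_apply (p : ℝ → ℝ) (P₁ P₀ : Lp ℝ 2 leb) (κ : H1 Γ) :
    tensorTriple c p P₁ P₀ κ
      = ((tensor (H1fn κ) P₁, tensor (H1grad κ) P₀, constraintOf c p • κ) : Ambient Γ) := rfl

theorem tensorTriple_one (hc : c.Admissible i) (κ : H1 Γ) :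
    tensorTriple c (fun _ => 1) 0 (sqrtWm hc) κ
      = ((0, tensor (H1grad κ) (sqrtWm hc), (2 : ℝ) • κ) : Ambient Γ) := by
  rw [tensorTriple_apply]
  have h2 := tensor_zero_right (H1fn κ)
  have h3 : constraintOf c (fun _ => 1) • κ = (2 : ℝ) • κ := by rw [constraintOf_one]
  exact Prod.ext h2 (Prod.ext rfl h3)

/-- A function `κ ∈ H¹(Γ)`, extended constantly in `u`, belongs to the energy space. -/
theorem const_mem_H (hc : c.Admissible i) (κ : H1 Γ) :
    ((0, tensor (H1grad κ) (sqrtWm hc), (2 : ℝ) • κ) : Ambient Γ) ∈ H Γ c := by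
  rw [← tensorTriple_one hc]
  refine tensorTriple_mem_H contDiff_const ?_ ?_ κ
  · filter_upwards [Lp.coeFn_zero ℝ 2 leb] with u hu
    simp only [deriv_const, mul_zero]
    exact hu
  · filter_upwards [coeFn_sqrtWm hc] with u hu
    rw [hu, mul_one]

/-! ### The resolvent acts on the energy space -/

/-- The resolvent in the tangential variable, acting on triples `(√𝖺 ∂_u f, √𝗆 ∇_Γ f, 𝒞f)`. -/
def resolventTriple (Γ : Set (E d)) [IsFiniteMeasure (surfaceMeasure Γ)] :
    Ambient Γ →L[ℝ] Ambient Γ :=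
  ContinuousLinearMap.prodMap (ampliation (ν := leb) (resolventFn Γ))
    (ContinuousLinearMap.prodMap (ampliation (ν := leb) (resolventVec Γ))
      (ofHilbert Γ ∘L resolvent Γ ∘L H1fnL Γ))

theorem memLp_of_continuous (hΓ : IsCompact Γ) {f : E d × ℝ → ℝ} (hf : Continuous f) :
    MemLp f 2 (cylMeasure Γ) := by
  obtain ⟨M, hM⟩ := exists_bound_of_continuous hΓ hf (-1) 1
  have : IsFiniteMeasure (cylMeasure Γ) := by
    unfold cylMeasure
    infer_instance
  refine MemLp.of_bound hf.aestronglyMeasurable M ?_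
  filter_upwards [ae_cyl_fst (ae_mem_surface hΓ),
    ae_cyl_snd (ae_restrict_mem (μ := volume) measurableSet_Icc)] with x hx hu
  exact hM x.1 hx x.2 hu

/-- The integrand of the constraint is square integrable for the triples in the energy space. -/
theorem IsTriple.memLp_integrand (hΓ : IsCompact Γ) (hc : c.Admissible i) {f : E d × ℝ → ℝ}
    {v : Ambient Γ} (h : IsTriple c f v) :
    MemLp (fun x => f x + c.n x.2 / c.dn x.2 * du f x) 2 (cylMeasure Γ) := by
  refine (memLp_of_continuous hΓ h.contDiff.continuous).add ?_
  obtain ⟨B, hB, hle⟩ := hc.exists_n_div_dn_le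
  refine (Lp.memLp v.1).of_le_mul (c := B) ?_ ?_
  · exact (hc.aestronglyMeasurable_n_div_dn.comp_snd (μ := surfaceMeasure Γ)).mul
      (contDiff_du h.contDiff).continuous.aestronglyMeasurable
  · filter_upwards [h.du_eq, ae_cyl_snd ae_leb_mem_Ioo] with x h1 h2
    rw [h1, norm_mul, norm_mul, Real.norm_of_nonneg (Real.sqrt_nonneg _), ← mul_assoc]
    exact mul_le_mul_of_nonneg_right (hle x.2 h2) (norm_nonneg _)

theorem memLp_sqrt_wm_mul (hΓ : IsCompact Γ) (hc : c.Admissible i) {f : E d × ℝ → ℝ}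
    (hf : Continuous f) : MemLp (fun x => √(c.wm x.2) * f x) 2 (cylMeasure Γ) := by
  obtain ⟨M, hM⟩ := exists_bound_of_continuous hΓ hf (-1) 1
  have h1 : MemLp (fun x : E d × ℝ => √(c.wm x.2)) 2 (cylMeasure Γ) := by
    have h2 := memLp_tensor (μ := surfaceMeasure Γ) ((memLp_const (1 : ℝ)).toLp) (sqrtWm hc)
    refine h2.ae_eq ?_
    have h3 := ae_cyl_snd (Γ := Γ) (coeFn_sqrtWm hc)
    have h4 := ae_cyl_fst (MemLp.coeFn_toLp (memLp_const (μ := surfaceMeasure Γ) (p := 2) (1 : ℝ)))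
    filter_upwards [h3, h4] with x k1 k2
    rw [k1, k2, smul_eq_mul, mul_one]
  refine h1.of_le_mul (c := M) (h1.aestronglyMeasurable.mul hf.aestronglyMeasurable) ?_
  filter_upwards [ae_cyl_fst (ae_mem_surface hΓ),
    ae_cyl_snd (ae_restrict_mem (μ := volume) measurableSet_Icc)] with x hx hu
  rw [norm_mul, mul_comm]
  exact mul_le_mul_of_nonneg_right (hM x.1 hx x.2 hu) (norm_nonneg _)

/-- Testing the constraint of a smooth function `f` against `b ∈ L²(Γ)` amounts to applying the
constraint to the partial inner product `⟪b, f(·, u)⟫`. -/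
theorem IsTriple.inner_constraint (hΓ : IsCompact Γ) (hc : c.Admissible i) {f : E d × ℝ → ℝ}
    {v : Ambient Γ} (h : IsTriple c f v) (b : L2 Γ) :
    ⟪b, H1fn v.2.2⟫
      = constraintOf c (fun u => ∫ s, b s * f (s, u) ∂(surfaceMeasure Γ)) := by
  have hb : Integrable b (surfaceMeasure Γ) := (Lp.memLp b).integrable one_le_two
  have hint : Integrable
      (fun x : E d × ℝ => b x.1 * (f x + c.n x.2 / c.dn x.2 * du f x)) (cylMeasure Γ) := by
    have h1 : MemLp (fun x : E d × ℝ => b x.1) 2 (cylMeasure Γ) :=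
      (Lp.memLp b).comp_fst leb
    exact h1.integrable_mul (h.memLp_integrand hΓ hc)
  calc ⟪b, H1fn v.2.2⟫ = ∫ s, b s * constraintFn c f s ∂(surfaceMeasure Γ) := by
        rw [inner_eq_integral]
        refine integral_congr_ae ?_
        filter_upwards [h.constraint_eq] with s hs
        rw [hs]
    _ = ∫ s, (∫ u in Icc (-1 : ℝ) 1, b s * (f (s, u) + c.n u / c.dn u * du f (s, u)))
          ∂(surfaceMeasure Γ) := by
        simp only [constraintFn, integral_const_mul]
    _ = ∫ u in Icc (-1 : ℝ) 1, (∫ s, b s * (f (s, u) + c.n u / c.dn u * du f (s, u))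
          ∂(surfaceMeasure Γ)) := integral_integral_swap hint
    _ = _ := by
        refine integral_congr_ae (Filter.Eventually.of_forall fun u => ?_)
        simp only [deriv_integral_mul_slice hΓ h.contDiff hb]
        rw [← integral_const_mul, ← integral_add (integrable_mul_slice hΓ h.contDiff.continuous hb u)
          ((integrable_mul_slice hΓ (contDiff_du h.contDiff).continuous hb u).const_mul _)]
        refine integral_congr_ae (Filter.Eventually.of_forall fun s => ?_)
        ring

/-- The resolvent in the tangential variable preserves the energy space. Expanding a smooth function
`f` in an orthonormal basis `b_j` of `L²(Γ)` gives the resolvent of `f` as the sum of the elementary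
tensors of `(1 - Δ)⁻¹ b_j ∈ H¹(Γ)` with the smooth functions `⟪b_j, f(·, u)⟫`. No regularity theory
for the resolvent is needed. -/
theorem resolventTriple_mem_H (hΓ : IsCompact Γ) (hc : c.Admissible i) {v : Ambient Γ}
    (hv : v ∈ H Γ c) : resolventTriple Γ v ∈ H Γ c := by
  refine map_mem_of_triples (resolventTriple Γ) isClosed_H (fun f v h => ?_) hv
  obtain ⟨w, b, -⟩ := exists_hilbertBasis ℝ (L2 Γ)
  have hb : ∀ j, Integrable (b j) (surfaceMeasure Γ) := fun j =>
    (Lp.memLp (b j)).integrable one_le_two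
  set p : w → ℝ → ℝ := fun j u => ∫ s, b j s * f (s, u) ∂(surfaceMeasure Γ) with hp
  set F₀ : Lp ℝ 2 ((surfaceMeasure Γ).prod leb) :=
    (memLp_sqrt_wm_mul hΓ hc h.contDiff.continuous).toLp with hF₀
  have hF₀c : F₀ =ᵐ[(surfaceMeasure Γ).prod leb] fun x => √(c.wm x.2) * f x := MemLp.coeFn_toLp _
  let v₁ : Lp ℝ 2 ((surfaceMeasure Γ).prod leb) := v.1
  let v₂ : Lp (E d) 2 ((surfaceMeasure Γ).prod leb) := v.2.1
  have hslice : ∀ (x : L2 Γ) (r : ℝ) (g : E d → ℝ), x =ᵐ[surfaceMeasure Γ] (fun s => r * g s) →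
      ∀ j, ⟪b j, x⟫ = r * ∫ s, b j s * g s ∂(surfaceMeasure Γ) := by
    intro x r g hx j
    rw [inner_eq_integral, ← integral_const_mul]
    refine integral_congr_ae ?_
    filter_upwards [hx] with s hs
    rw [hs]
    ring
  have hs₁ : ∀ᵐ u ∂leb, slices v₁ u =ᵐ[surfaceMeasure Γ] fun s => √(c.wa u) * du f (s, u) := by
    filter_upwards [coeFn_slices v₁, ae_ae_of_ae_prod_swap h.du_eq] with u h1 h2
    filter_upwards [h1, h2] with s k1 k2
    rw [k1]
    exact k2
  have hs₂ : ∀ᵐ u ∂leb, slices v₂ u =ᵐ[surfaceMeasure Γ]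
      fun s => √(c.wm u) • tangentialGradient Γ (fun y => f (y, u)) s := by
    filter_upwards [coeFn_slices v₂, ae_ae_of_ae_prod_swap h.grad_eq] with u h1 h2
    filter_upwards [h1, h2] with s k1 k2
    rw [k1]
    exact k2
  have hs₀ : ∀ᵐ u ∂leb, slices F₀ u =ᵐ[surfaceMeasure Γ] fun s => √(c.wm u) * f (s, u) := by
    filter_upwards [coeFn_slices F₀, ae_ae_of_ae_prod_swap hF₀c] with u h1 h2
    filter_upwards [h1, h2] with s k1 k2
    rw [k1, k2]
  have hP₁ : ∀ j, partialInner (b j) v₁ =ᵐ[leb] fun u => √(c.wa u) * deriv (p j) u := by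
    intro j
    filter_upwards [coeFn_partialInner (b j) v₁, hs₁] with u h1 h2
    rw [h1, hslice _ _ _ h2, hp, deriv_integral_mul_slice hΓ h.contDiff (hb j)]
  have hP₀ : ∀ j, partialInner (b j) F₀ =ᵐ[leb] fun u => √(c.wm u) * p j u := by
    intro j
    filter_upwards [coeFn_partialInner (b j) F₀, hs₀] with u h1 h2
    rw [h1, hslice _ _ _ h2]
  -- slicewise, `√𝗆 (f, ∇_Γ f)` belongs to `H¹(Γ)`, so that `1 - ∇∇*` may be replaced by the resolvent
  have hgrad : ampliation (resolventVec Γ) v₂ = ampliation (grad Γ ∘L resolvent Γ) F₀ := by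
    refine ampliation_congr _ _ ?_
    filter_upwards [hs₂, hs₀] with u h2 h0
    have hmem : (slices F₀ u, slices v₂ u) ∈ H1 Γ := by
      refine mem_H1_of_contDiff (f := fun y => f (y, u) * √(c.wm u)) ?_ ?_ ?_
      · exact (h.contDiff.comp (contDiff_id.prodMk contDiff_const)).mul contDiff_const
      · filter_upwards [h0] with s hs
        rw [hs, mul_comm]
      · filter_upwards [h2] with s hs
        rw [hs, tangentialGradient_mul_const]
        exact (h.contDiff.comp (contDiff_id.prodMk contDiff_const)).differentiable (by simp)
    exact resolventVec_grad (toHilbert Γ ⟨_, hmem⟩)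
  let e : w → H1 Γ := fun j => ofHilbert Γ (resolvent Γ (b j))
  have hsum : HasSum (fun j => tensorTriple c (p j) (partialInner (b j) v₁)
      (partialInner (b j) F₀) (e j)) (resolventTriple Γ v) := by
    have h1 := (hasSum_tensor_partialInner b v₁).mapL (ampliation (resolventFn Γ))
    have h2 := (hasSum_tensor_partialInner b F₀).mapL (ampliation (grad Γ ∘L resolvent Γ))
    have h3 := (b.hasSum_repr (H1fn v.2.2)).mapL (ofHilbert Γ ∘L resolvent Γ)
    simp only [ampliation_tensor] at h1 h2
    rw [← hgrad] at h2
    have h4 := h1.prodMk (h2.prodMk h3)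
    refine h4.congr_fun fun j => ?_
    refine Prod.ext rfl (Prod.ext rfl ?_)
    change constraintOf c (p j) • e j = (ofHilbert Γ ∘L resolvent Γ) (b.repr (H1fn v.2.2) j • b j)
    rw [map_smul, HilbertBasis.repr_apply_apply, h.inner_constraint hΓ hc]
    rfl
  refine isClosed_H.mem_of_tendsto hsum (Filter.Eventually.of_forall fun t => ?_)
  refine Submodule.sum_mem _ fun j _ => ?_
  exact tensorTriple_mem_H (contDiff_integral_mul_slice hΓ h.contDiff (hb j)) (hP₁ j) (hP₀ j) (e j)

end Energy

/-! ### The constrained elliptic problem -/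

section Solve

variable {d : ℕ} {Γ : Set (E d)} {c : Coefficients} {i : ℕ}

/-- The Hilbert space `L²(Γ × [-1,1]) × L²(Γ × [-1,1]; ℝ^d)` of weighted derivatives
`(√𝖺 ∂_u f, √𝗆 ∇_Γ f)`, in which the energy form is the inner product. -/
abbrev EnergyL2 (Γ : Set (E d)) : Type :=
  WithLp 2 (Lp ℝ 2 (cylMeasure Γ) × Lp (E d) 2 (cylMeasure Γ))

/-- The weighted derivatives of an element of the energy space. -/
def weighted (v : Ambient Γ) : EnergyL2 Γ := WithLp.toLp 2 (v.1, v.2.1)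

theorem energyForm_eq_inner (f g : H Γ c) : energyForm f g = ⟪weighted f.1, weighted g.1⟫ := by
  rw [WithLp.prod_inner_apply]
  rfl

/-- The map `x ↦ (x, 0)` that completes weighted derivatives by a vanishing constraint. -/
def unconstrained (Γ : Set (E d)) : EnergyL2 Γ →L[ℝ] Ambient Γ :=
  ((ContinuousLinearMap.fst ℝ _ _).prod ((ContinuousLinearMap.snd ℝ _ _).prod 0)) ∘L
    (WithLp.prodContinuousLinearEquiv 2 ℝ (Lp ℝ 2 (cylMeasure Γ))
      (Lp (E d) 2 (cylMeasure Γ))).toContinuousLinearMap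

/-- The weighted derivatives of the elements of the energy space with vanishing constraint. -/
def kernelSpace (Γ : Set (E d)) (c : Coefficients) : Submodule ℝ (EnergyL2 Γ) :=
  (H Γ c).comap (unconstrained Γ).toLinearMap

theorem mem_kernelSpace {x : EnergyL2 Γ} :
    x ∈ kernelSpace Γ c ↔ ((x.fst, x.snd, 0) : Ambient Γ) ∈ H Γ c := Iff.rfl

instance : CompleteSpace (kernelSpace Γ c) := by
  have h : IsClosed (kernelSpace Γ c : Set (EnergyL2 Γ)) :=
    isClosed_H.preimage (unconstrained Γ).continuous
  exact h.completeSpace_coe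

/-- The orthogonal projection onto the complement of the kernel of the constraint. -/
def proj (Γ : Set (E d)) (c : Coefficients) : EnergyL2 Γ →L[ℝ] EnergyL2 Γ :=
  (kernelSpace Γ c)ᗮ.starProjection

theorem proj_mem (x : EnergyL2 Γ) : proj Γ c x ∈ (kernelSpace Γ c)ᗮ :=
  (kernelSpace Γ c)ᗮ.starProjection_apply_mem x

theorem sub_proj_mem (x : EnergyL2 Γ) : x - proj Γ c x ∈ kernelSpace Γ c := by
  have h := (kernelSpace Γ c)ᗮ.sub_starProjection_mem_orthogonal x
  rwa [Submodule.orthogonal_orthogonal] at h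

theorem inner_proj (x y : EnergyL2 Γ) : ⟪proj Γ c x, y⟫ = ⟪x, proj Γ c y⟫ :=
  (kernelSpace Γ c)ᗮ.inner_starProjection_left_eq_right x y

theorem inner_proj_self (x : EnergyL2 Γ) : ⟪proj Γ c x, x⟫ = ‖proj Γ c x‖ ^ 2 := by
  rw [← real_inner_self_eq_norm_sq]
  have h : ⟪proj Γ c x, x - proj Γ c x⟫ = 0 :=
    Submodule.inner_left_of_mem_orthogonal (sub_proj_mem x) (proj_mem x)
  rw [inner_sub_right] at h
  linarith

theorem norm_proj_le (x : EnergyL2 Γ) : ‖proj Γ c x‖ ≤ ‖x‖ :=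
  (kernelSpace Γ c)ᗮ.norm_starProjection_apply_le x

variable [IsFiniteMeasure (surfaceMeasure Γ)]

/-- The weighted derivatives `(0, √𝗆 ∇κ)` of `κ ∈ H¹(Γ)`, extended constantly in `u`. -/
def constLift (hc : c.Admissible i) : H1 Γ →L[ℝ] EnergyL2 Γ :=
  (WithLp.prodContinuousLinearEquiv 2 ℝ (Lp ℝ 2 (cylMeasure Γ))
      (Lp (E d) 2 (cylMeasure Γ))).symm.toContinuousLinearMap ∘L
    ((0 : H1 Γ →L[ℝ] Lp ℝ 2 (cylMeasure Γ)).prod (tensorL (sqrtWm hc) ∘L H1gradL Γ))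

theorem constLift_snd (hc : c.Admissible i) (κ : H1 Γ) :
    (constLift hc κ).snd = tensor (H1grad κ) (sqrtWm hc) := rfl

theorem constLift_mem (hc : c.Admissible i) (κ : H1 Γ) :
    (((constLift hc κ).fst, (constLift hc κ).snd, (2 : ℝ) • κ) : Ambient Γ) ∈ H Γ c :=
  const_mem_H hc κ

/-- An element of the energy space differs from half the lift of its constraint by an element of the
kernel of the constraint. -/
theorem weighted_sub_mem (hc : c.Admissible i) (φ : H Γ c) :
    weighted φ.1 - (1 / 2 : ℝ) • constLift hc (Hconstraint φ) ∈ kernelSpace Γ c := by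
  have h := (H Γ c).sub_mem φ.2 ((H Γ c).smul_mem (1 / 2 : ℝ) (constLift_mem hc (Hconstraint φ)))
  rw [mem_kernelSpace]
  have h0 : φ.1.2.2 - (1 / 2 : ℝ) • ((2 : ℝ) • Hconstraint φ) = 0 := by
    rw [smul_smul]
    norm_num
    exact sub_self _
  have h1 : φ.1 - (1 / 2 : ℝ) • (((constLift hc (Hconstraint φ)).fst,
      (constLift hc (Hconstraint φ)).snd, (2 : ℝ) • Hconstraint φ) : Ambient Γ)
      = (((weighted φ.1 - (1 / 2 : ℝ) • constLift hc (Hconstraint φ)).fst,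
        (weighted φ.1 - (1 / 2 : ℝ) • constLift hc (Hconstraint φ)).snd, 0) : Ambient Γ) :=
    Prod.ext rfl (Prod.ext rfl h0)
  rwa [h1] at h

theorem inner_weighted_of_mem_orthogonal (hc : c.Admissible i) {x : EnergyL2 Γ}
    (hx : x ∈ (kernelSpace Γ c)ᗮ) (φ : H Γ c) :
    ⟪x, weighted φ.1⟫ = 1 / 2 * ⟪x, constLift hc (Hconstraint φ)⟫ := by
  have h := Submodule.inner_left_of_mem_orthogonal (weighted_sub_mem hc φ) hx
  rw [inner_sub_right, inner_smul_right] at h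
  linarith

/-- The weighted derivatives of the solution with datum `κ`. -/
def solvePart (hc : c.Admissible i) (κ : H1 Γ) : EnergyL2 Γ :=
  (σ / 2) • proj Γ c (constLift hc κ)

theorem solvePart_mem (hc : c.Admissible i) (κ : H1 Γ) :
    (((solvePart hc κ).fst, (solvePart hc κ).snd, σ • κ) : Ambient Γ) ∈ H Γ c := by
  have h1 := (H Γ c).smul_mem (σ / 2) (constLift_mem hc κ)
  have h2 := mem_kernelSpace.1 ((kernelSpace Γ c).smul_mem (σ / 2)
    (sub_proj_mem (c := c) (constLift hc κ)))
  have h3 := (H Γ c).sub_mem h1 h2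
  set x := constLift hc κ with hx
  have e0 : (σ / 2) • x - (σ / 2) • (x - proj Γ c x) = solvePart hc κ := by
    rw [← smul_sub, sub_sub_cancel, solvePart]
  have h0 : (σ / 2) • ((2 : ℝ) • κ) - 0 = σ • κ := by
    rw [smul_smul, sub_zero]
    congr 1
    ring
  have h4 : (σ / 2) • ((x.fst, x.snd, (2 : ℝ) • κ) : Ambient Γ)
      - ((((σ / 2) • (x - proj Γ c x)).fst, ((σ / 2) • (x - proj Γ c x)).snd, 0) : Ambient Γ)
      = (((solvePart hc κ).fst, (solvePart hc κ).snd, σ • κ) : Ambient Γ) :=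
    Prod.ext (congrArg (fun y : EnergyL2 Γ => y.fst) e0)
      (Prod.ext (congrArg (fun y : EnergyL2 Γ => y.snd) e0) h0)
  rwa [h4] at h3

/-- The solution with datum `κ`. -/
def solve (hc : c.Admissible i) (κ : H1 Γ) : H Γ c := ⟨_, solvePart_mem hc κ⟩

theorem weighted_solve (hc : c.Admissible i) (κ : H1 Γ) :
    weighted (solve hc κ).1 = solvePart hc κ := rfl

/-- The symmetric bilinear form `(κ, ψ) ↦ ⟨𝒢_Γ κ, ψ⟩`. -/
def form (hc : c.Admissible i) (κ : H1 Γ) : H1 Γ →L[ℝ] ℝ :=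
  (σ / 4) • (innerSL ℝ (proj Γ c (constLift hc κ)) ∘L constLift hc)

theorem form_apply (hc : c.Admissible i) (κ ψ : H1 Γ) :
    form hc κ ψ = σ / 4 * ⟪proj Γ c (constLift hc κ), constLift hc ψ⟫ := rfl

theorem form_symm (hc : c.Admissible i) (κ ψ : H1 Γ) : form hc κ ψ = form hc ψ κ := by
  rw [form_apply, form_apply, inner_proj, real_inner_comm]

theorem isSolution_solve (hc : c.Admissible i) (κ : H1 Γ) :
    IsSolution κ (solve hc κ) (form hc κ) := by
  refine ⟨rfl, fun φ => ?_⟩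
  have h1 : solvePart hc κ ∈ (kernelSpace Γ c)ᗮ := Submodule.smul_mem _ _ (proj_mem _)
  rw [energyForm_eq_inner, weighted_solve, inner_weighted_of_mem_orthogonal hc h1, solvePart,
    real_inner_smul_left, form_apply]
  ring

theorem eq_of_isSolution (hc : c.Admissible i) {κ : H1 Γ} {f f' : H Γ c} {V V' : H1 Γ →L[ℝ] ℝ}
    (h : IsSolution κ f V) (h' : IsSolution κ f' V') : f = f' ∧ V = V' := by
  have hC : Hconstraint (f - f') = 0 := by
    change Hconstraint f - Hconstraint f' = 0
    rw [h.1, h'.1, sub_self]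
  have hE : ∀ φ : H Γ c, ⟪weighted (f - f').1, weighted φ.1⟫ = (V - V') (Hconstraint φ) := by
    intro φ
    have h1 := h.2 φ
    have h2 := h'.2 φ
    rw [energyForm_eq_inner] at h1 h2
    have h3 : weighted (f - f').1 = weighted f.1 - weighted f'.1 := rfl
    rw [h3, inner_sub_left, h1, h2]
    rfl
  have h0 : weighted (f - f').1 = 0 := by
    have h1 := hE (f - f')
    rw [hC, map_zero] at h1
    exact inner_self_eq_zero.1 h1
  have hf : f - f' = 0 := by
    refine Subtype.ext (Prod.ext ?_ (Prod.ext ?_ ?_))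
    · exact congrArg (fun y : EnergyL2 Γ => y.fst) h0
    · exact congrArg (fun y : EnergyL2 Γ => y.snd) h0
    · exact hC
  refine ⟨sub_eq_zero.1 hf, ?_⟩
  ext ψ
  have h1 := hE ⟨_, constLift_mem hc ((1 / 2 : ℝ) • ψ)⟩
  rw [h0, inner_zero_left] at h1
  have h2 : Hconstraint (⟨_, constLift_mem hc ((1 / 2 : ℝ) • ψ)⟩ : H Γ c) = ψ := by
    change (2 : ℝ) • ((1 / 2 : ℝ) • ψ) = ψ
    rw [smul_smul]
    norm_num
  rw [h2] at h1
  have h3 : V ψ - V' ψ = 0 := h1.symm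
  linarith

theorem solutionOp_eq (hc : c.Admissible i) (κ : H1 Γ) : solutionOp c κ = solve hc κ := by
  have h : ∃ V : H1 Γ →L[ℝ] ℝ, IsSolution κ (solutionOp c κ) V :=
    Classical.epsilon_spec (p := fun f : H Γ c => ∃ V : H1 Γ →L[ℝ] ℝ, IsSolution κ f V)
      ⟨solve hc κ, form hc κ, isSolution_solve hc κ⟩
  obtain ⟨V, hV⟩ := h
  exact (eq_of_isSolution hc hV (isSolution_solve hc κ)).1

/-- Pairing with an elementary tensor, computed by integrating in `u` first. -/
theorem inner_tensor_eq (F : Lp (E d) 2 ((surfaceMeasure Γ).prod leb)) (y : L2vec Γ)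
    {q : ℝ → ℝ} (Q : Lp ℝ 2 leb) (hQ : Q =ᵐ[leb] q) :
    ⟪F, tensor y Q⟫
      = ∫ s, ⟪∫ u in Icc (-1 : ℝ) 1, q u • F (s, u), y s⟫ ∂(surfaceMeasure Γ) := by
  have hcongr : ∀ᵐ x ∂((surfaceMeasure Γ).prod leb),
      ⟪F x, tensor y Q x⟫ = ⟪q x.2 • F x, y x.1⟫ := by
    filter_upwards [coeFn_tensor y Q, ae_cyl_snd hQ] with x h1 h2
    rw [h1, h2, real_inner_smul_left, real_inner_smul_right]
  have hint : Integrable (fun x : E d × ℝ => ⟪q x.2 • F x, y x.1⟫)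
      ((surfaceMeasure Γ).prod leb) := (L2.integrable_inner F (tensor y Q)).congr hcongr
  have hQF : Integrable (fun x : E d × ℝ => q x.2 • F x) ((surfaceMeasure Γ).prod leb) := by
    have h1 : MemLp (fun x : E d × ℝ => Q x.2) 2 ((surfaceMeasure Γ).prod leb) :=
      (Lp.memLp Q).comp_snd (surfaceMeasure Γ)
    have h2 : MemLp (fun x : E d × ℝ => q x.2) 2 ((surfaceMeasure Γ).prod leb) :=
      h1.ae_eq (ae_cyl_snd hQ)
    exact memLp_one_iff_integrable.1 ((Lp.memLp F).smul h2)
  rw [L2.inner_def, integral_congr_ae hcongr, integral_prod _ hint]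
  refine integral_congr_ae ?_
  filter_upwards [hQF.prod_right_ae] with s hs
  rw [real_inner_comm, ← integral_inner hs]
  simp only [real_inner_comm]

theorem propagation_eq_form (hc : c.Admissible i) (κ ψ : H1 Γ) :
    propagation c κ ψ = form hc κ ψ := by
  have h1 := inner_tensor_eq (Γ := Γ) (solvePart hc κ).snd (H1grad ψ) (sqrtWm hc) (coeFn_sqrtWm hc)
  have h2 : ⟪solvePart hc κ, constLift hc ψ⟫
      = ⟪(solvePart hc κ).snd, (constLift hc ψ).snd⟫ := by
    rw [WithLp.prod_inner_apply]
    change ⟪(solvePart hc κ).fst, (0 : Lp ℝ 2 (cylMeasure Γ))⟫ + _ = _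
    rw [inner_zero_right, zero_add]
    rfl
  rw [propagation, solutionOp_eq hc]
  have h3 : form hc κ ψ = 1 / 2 * ⟪solvePart hc κ, constLift hc ψ⟫ := by
    rw [form_apply, solvePart, real_inner_smul_left]
    ring
  rw [h3, h2, constLift_snd]
  exact congrArg (fun r : ℝ => 1 / 2 * r) h1.symm

/-! ### Square integrability of the propagation operator -/

/-- The resolvent in the tangential variable, acting on weighted derivatives. -/
def resolventEnergy (x : EnergyL2 Γ) : EnergyL2 Γ :=
  WithLp.toLp 2 (ampliation (ν := leb) (resolventFn Γ) x.fst,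
    ampliation (ν := leb) (resolventVec Γ) x.snd)

theorem inner_resolventEnergy (x y : EnergyL2 Γ) :
    ⟪resolventEnergy x, y⟫ = ⟪x, resolventEnergy y⟫ := by
  rw [WithLp.prod_inner_apply, WithLp.prod_inner_apply]
  exact congrArg₂ (· + ·) (inner_ampliation (resolventFn Γ) inner_resolventFn x.fst y.fst)
    (inner_ampliation (resolventVec Γ) inner_resolventVec x.snd y.snd)

theorem resolventEnergy_mem (hΓ : IsCompact Γ) (hc : c.Admissible i) {x : EnergyL2 Γ}
    (hx : x ∈ kernelSpace Γ c) : resolventEnergy x ∈ kernelSpace Γ c := by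
  have h := resolventTriple_mem_H hΓ hc (mem_kernelSpace.1 hx)
  rw [mem_kernelSpace]
  have h1 : resolventTriple Γ ((x.fst, x.snd, 0) : Ambient Γ)
      = (((resolventEnergy x).fst, (resolventEnergy x).snd, 0) : Ambient Γ) :=
    Prod.ext rfl (Prod.ext rfl
      (map_zero (ofHilbert Γ ∘L resolvent Γ ∘L H1fnL Γ)))
  rwa [h1] at h

theorem resolventEnergy_sub (x y : EnergyL2 Γ) :
    resolventEnergy (x - y) = resolventEnergy x - resolventEnergy y := by
  have h1 := map_sub (ampliation (ν := leb) (resolventFn Γ)) x.fst y.fst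
  have h2 := map_sub (ampliation (ν := leb) (resolventVec Γ)) x.snd y.snd
  exact congrArg (WithLp.toLp 2) (Prod.ext h1 h2)

/-- The resolvent in the tangential variable commutes with the projection off the kernel of the
constraint, because it is symmetric and preserves that kernel. -/
theorem proj_resolventEnergy (hΓ : IsCompact Γ) (hc : c.Admissible i) (x : EnergyL2 Γ) :
    proj Γ c (resolventEnergy x) = resolventEnergy (proj Γ c x) := by
  refine Submodule.eq_starProjection_of_mem_orthogonal ?_ ?_
  · intro y hy
    rw [← inner_resolventEnergy]
    exact Submodule.inner_right_of_mem_orthogonal (resolventEnergy_mem hΓ hc hy) (proj_mem x)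
  · rw [← resolventEnergy_sub, Submodule.orthogonal_orthogonal]
    exact resolventEnergy_mem hΓ hc (sub_proj_mem x)

theorem resolventEnergy_constLift (hc : c.Admissible i) (κ : HilbertH1 Γ) :
    resolventEnergy (constLift hc (ofHilbert Γ κ))
      = constLift hc (ofHilbert Γ (resolvent Γ (incl Γ κ))) := by
  have h1 := map_zero (ampliation (ν := leb) (resolventFn Γ))
  have h2 := ampliation_tensor (resolventVec Γ) (grad Γ κ) (sqrtWm hc)
  rw [resolventVec_grad] at h2
  exact congrArg (WithLp.toLp 2) (Prod.ext h1 h2)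

/-- The operator on the Hilbert space `H¹(Γ)` that represents `form`. -/
def formOp (hc : c.Admissible i) : HilbertH1 Γ →L[ℝ] HilbertH1 Γ :=
  (σ / 4) • (ContinuousLinearMap.adjoint (constLift hc ∘L ofHilbert Γ) ∘L proj Γ c ∘L
    constLift hc ∘L ofHilbert Γ)

theorem inner_formOp (hc : c.Admissible i) (κ ψ : HilbertH1 Γ) :
    ⟪formOp hc κ, ψ⟫ = form hc (ofHilbert Γ κ) (ofHilbert Γ ψ) := by
  rw [form_apply, formOp, smul_apply, real_inner_smul_left,
    ContinuousLinearMap.comp_apply, ContinuousLinearMap.adjoint_inner_left]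
  rfl

/-- `form` commutes with the resolvent. -/
theorem form_resolvent (hΓ : IsCompact Γ) (hc : c.Admissible i) (κ ψ : HilbertH1 Γ) :
    form hc (ofHilbert Γ (resolvent Γ (incl Γ κ))) (ofHilbert Γ ψ)
      = form hc (ofHilbert Γ κ) (ofHilbert Γ (resolvent Γ (incl Γ ψ))) := by
  rw [form_apply, form_apply, ← resolventEnergy_constLift, ← resolventEnergy_constLift,
    proj_resolventEnergy hΓ hc, inner_resolventEnergy]

theorem inner_incl_formOp (hΓ : IsCompact Γ) (hc : c.Admissible i) (κ ψ : HilbertH1 Γ) :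
    ⟪incl Γ (formOp hc κ), incl Γ ψ⟫ = ⟪incl Γ κ, incl Γ (formOp hc ψ)⟫ := by
  rw [← inner_resolvent_right, ← inner_resolvent_left, inner_formOp, ← form_resolvent hΓ hc,
    real_inner_comm, inner_formOp, form_symm]

/-- The propagation operator takes values in `L²(Γ)` on `H²(Γ)`. Writing `κ = (1 - Δ)⁻¹ g`, the
functional `⟨𝒢_Γ κ, ψ⟩` equals the `L²` product of `g` with `formOp ψ`, and `formOp` is bounded in
`L²` by Krein's theorem. -/
theorem exists_propagation_eq (hΓ : IsCompact Γ) (hc : c.Admissible i) (κ : H2 Γ) :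
    ∃ g ∈ (LinearMap.range (H1fnL Γ).toLinearMap).topologicalClosure,
      ∀ ψ : H1 Γ, form hc κ.1 ψ = ⟪g, H1fn ψ⟫ := by
  obtain ⟨l, hl⟩ := κ.2
  have hκ := toHilbert_eq_resolvent hl
  refine exists_inner_eq_of_le_norm (H1fnL Γ) (form hc κ.1).toLinearMap
    (‖formOp (Γ := Γ) hc‖ * ‖H1fn κ.1 - l‖) fun ψ => ?_
  have h1 : form hc κ.1 ψ = ⟪incl Γ (formOp hc (toHilbert Γ ψ)), H1fn κ.1 - l⟫ := by
    rw [← inner_resolvent_right, ← hκ, inner_formOp, ofHilbert_toHilbert, ofHilbert_toHilbert,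
      form_symm]
  change |form hc κ.1 ψ| ≤ _
  rw [h1]
  refine (abs_real_inner_le_norm _ _).trans ?_
  have h2 := norm_apply_le_of_symmetric (incl Γ) (formOp hc) (inner_incl_formOp hΓ hc)
    (toHilbert Γ ψ)
  calc ‖incl Γ (formOp hc (toHilbert Γ ψ))‖ * ‖H1fn κ.1 - l‖
      ≤ (‖formOp (Γ := Γ) hc‖ * ‖incl Γ (toHilbert Γ ψ)‖) * ‖H1fn κ.1 - l‖ := by gcongr
    _ = ‖formOp (Γ := Γ) hc‖ * ‖H1fn κ.1 - l‖ * ‖H1fnL Γ ψ‖ := by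
        rw [mul_right_comm]
        rfl

/-- The propagation operator as a linear map from `H²(Γ)` to `L²(Γ)`, with values in the closure of
`H¹(Γ)`. -/
theorem exists_propagation_linearMap (hΓ : IsCompact Γ) (hc : c.Admissible i) :
    ∃ G : H2 Γ →ₗ[ℝ] L2 Γ,
      (∀ κ, G κ ∈ (LinearMap.range (H1fnL Γ).toLinearMap).topologicalClosure) ∧
      ∀ (κ : H2 Γ) (ψ : H1 Γ), form hc κ.1 ψ = ⟪G κ, H1fn ψ⟫ := by
  choose G hG hG' using fun κ : H2 Γ => exists_propagation_eq hΓ hc κ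
  refine ⟨{ toFun := G, map_add' := fun κ κ' => ?_, map_smul' := fun r κ => ?_ }, hG, hG'⟩
  · refine eq_of_mem_closure_of_inner_eq (hG _) (Submodule.add_mem _ (hG κ) (hG κ')) ?_
    rintro _ ⟨ψ, rfl⟩
    change ⟪G (κ + κ'), H1fn ψ⟫ = ⟪G κ + G κ', H1fn ψ⟫
    rw [inner_add_left, ← hG', ← hG', ← hG', form_symm, form_symm hc κ.1, form_symm hc κ'.1,
      ← map_add]
    rfl
  · refine eq_of_mem_closure_of_inner_eq (hG _) (Submodule.smul_mem _ _ (hG κ)) ?_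
    rintro _ ⟨ψ, rfl⟩
    change ⟪G (r • κ), H1fn ψ⟫ = ⟪r • G κ, H1fn ψ⟫
    rw [real_inner_smul_left, ← hG', ← hG', form_symm, form_symm hc κ.1]
    exact map_smul (form hc ψ) r κ.1

end Solve

/-! ### Smooth functions are dense in the energy space -/

section Constancy

variable {d : ℕ} {Γ : Set (E d)} {c : Coefficients} {i : ℕ}

theorem tangentialGradient_add {f g : E d → ℝ} (hf : Differentiable ℝ f) (hg : Differentiable ℝ g)
    (x : E d) : tangentialGradient Γ (fun y => f y + g y) x
      = tangentialGradient Γ f x + tangentialGradient Γ g x := by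
  rw [tangentialGradient, tangentialGradient, tangentialGradient, gradient, gradient, gradient,
    fderiv_fun_add (hf x) (hg x), map_add, map_add]

theorem differentiable_slice_left {f : E d × ℝ → ℝ} (hf : ContDiff ℝ ∞ f) (u : ℝ) :
    Differentiable ℝ fun y => f (y, u) :=
  (hf.comp (contDiff_id.prodMk contDiff_const)).differentiable (by simp)

theorem IsTriple.smul (r : ℝ) {f : E d × ℝ → ℝ} {v : Ambient Γ} (hv : IsTriple c f v) :
    IsTriple c (fun x => f x * r) (r • v) := by
  have hdu : ∀ x, du (fun x => f x * r) x = du f x * r := fun x =>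
    ((hasDerivAt_slice hv.contDiff x.1 x.2).mul_const r).deriv
  refine ⟨hv.contDiff.mul contDiff_const, ?_, ?_, ?_⟩
  · filter_upwards [Lp.coeFn_smul r v.1, hv.du_eq] with x h1 h2
    change (r • v.1 : Lp ℝ 2 (cylMeasure Γ)) x = _
    rw [h1, Pi.smul_apply, h2, hdu, smul_eq_mul]
    ring
  · filter_upwards [Lp.coeFn_smul r v.2.1, hv.grad_eq] with x h1 h2
    change (r • v.2.1 : Lp (E d) 2 (cylMeasure Γ)) x
      = √(c.wm x.2) • tangentialGradient Γ (fun y => f (y, x.2) * r) x.1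
    rw [h1, Pi.smul_apply, h2,
      tangentialGradient_mul_const (differentiable_slice_left hv.contDiff _), smul_comm]
    rfl
  · filter_upwards [Lp.coeFn_smul r (H1fn v.2.2), hv.constraint_eq] with s h1 h2
    change (r • H1fn v.2.2 : L2 Γ) s = _
    rw [h1, Pi.smul_apply, h2, constraintFn, constraintFn, smul_eq_mul, ← integral_const_mul]
    refine integral_congr_ae (Filter.Eventually.of_forall fun u => ?_)
    simp only [hdu]
    ring

theorem isTriple_zero : IsTriple c (fun _ => 0) (0 : Ambient Γ) := by
  have hdu : ∀ x, du (fun _ : E d × ℝ => (0 : ℝ)) x = 0 := fun x => deriv_const _ _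
  refine ⟨contDiff_const, ?_, ?_, ?_⟩
  · filter_upwards [Lp.coeFn_zero ℝ 2 (cylMeasure Γ)] with x h1
    rw [hdu, mul_zero]
    exact h1
  · filter_upwards [Lp.coeFn_zero (E d) 2 (cylMeasure Γ)] with x h1
    have h2 : tgrad Γ (fun _ : E d × ℝ => (0 : ℝ)) x = 0 := by
      simp [tgrad, tangentialGradient, gradient]
    rw [h2, smul_zero]
    exact h1
  · filter_upwards [Lp.coeFn_zero ℝ 2 (surfaceMeasure Γ)] with s h1
    have h2 : constraintFn c (fun _ : E d × ℝ => (0 : ℝ)) s = 0 := by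
      simp [constraintFn, hdu]
    rw [h2]
    exact h1

section

variable [IsFiniteMeasure (surfaceMeasure Γ)]

theorem IsTriple.ae_integrable (hΓ : IsCompact Γ) (hc : c.Admissible i) {f : E d × ℝ → ℝ}
    {v : Ambient Γ} (h : IsTriple c f v) : ∀ᵐ s ∂(surfaceMeasure Γ),
      Integrable (fun u => f (s, u) + c.n u / c.dn u * du f (s, u)) leb := by
  have : IsFiniteMeasure (cylMeasure Γ) := by
    unfold cylMeasure
    infer_instance
  exact ((h.memLp_integrand hΓ hc).integrable one_le_two).prod_right_ae

theorem IsTriple.add (hΓ : IsCompact Γ) (hc : c.Admissible i) {f g : E d × ℝ → ℝ}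
    {v w : Ambient Γ} (hv : IsTriple c f v) (hw : IsTriple c g w) :
    IsTriple c (fun x => f x + g x) (v + w) := by
  have hdu : ∀ x, du (fun x => f x + g x) x = du f x + du g x := fun x =>
    ((hasDerivAt_slice hv.contDiff x.1 x.2).add (hasDerivAt_slice hw.contDiff x.1 x.2)).deriv
  refine ⟨hv.contDiff.add hw.contDiff, ?_, ?_, ?_⟩
  · filter_upwards [Lp.coeFn_add v.1 w.1, hv.du_eq, hw.du_eq] with x h1 h2 h3
    change (v.1 + w.1 : Lp ℝ 2 (cylMeasure Γ)) x = _
    rw [h1, Pi.add_apply, h2, h3, hdu, mul_add]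
  · filter_upwards [Lp.coeFn_add v.2.1 w.2.1, hv.grad_eq, hw.grad_eq] with x h1 h2 h3
    change (v.2.1 + w.2.1 : Lp (E d) 2 (cylMeasure Γ)) x
      = √(c.wm x.2) • tangentialGradient Γ (fun y => f (y, x.2) + g (y, x.2)) x.1
    rw [h1, Pi.add_apply, h2, h3, tangentialGradient_add (differentiable_slice_left hv.contDiff _)
      (differentiable_slice_left hw.contDiff _), smul_add]
    rfl
  · filter_upwards [Lp.coeFn_add (H1fn v.2.2) (H1fn w.2.2), hv.constraint_eq, hw.constraint_eq,
      hv.ae_integrable hΓ hc, hw.ae_integrable hΓ hc] with s h1 h2 h3 h4 h5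
    change (H1fn v.2.2 + H1fn w.2.2 : L2 Γ) s = _
    rw [h1, Pi.add_apply, h2, h3, constraintFn, constraintFn, constraintFn, ← integral_add h4 h5]
    refine integral_congr_ae (Filter.Eventually.of_forall fun u => ?_)
    simp only [hdu]
    ring

/-- The triples of smooth functions form a subspace, so they are dense in the energy space. -/
theorem mem_closure_triples (hΓ : IsCompact Γ) (hc : c.Admissible i) {v : Ambient Γ}
    (hv : v ∈ H Γ c) : v ∈ closure {v : Ambient Γ | ∃ f, IsTriple c f v} := by
  let S : Submodule ℝ (Ambient Γ) :=
    { carrier := {v | ∃ f, IsTriple c f v}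
      add_mem' := fun ⟨_, hf⟩ ⟨_, hg⟩ => ⟨_, hf.add hΓ hc hg⟩
      zero_mem' := ⟨_, isTriple_zero⟩
      smul_mem' := fun r _ ⟨_, hf⟩ => ⟨_, hf.smul r⟩ }
  rw [H_eq_closure] at hv
  have h : Submodule.span ℝ {v : Ambient Γ | ∃ f, IsTriple c f v} = S := Submodule.span_eq S
  rw [h] at hv
  exact hv

end

/-! ### Vertical averages -/

/-- The constraint of a smooth function equals a weighted vertical average up to a term controlled by
the vertical derivative. -/
theorem constraintFn_eq {w h : ℝ → ℝ} (hw : Continuous w) (hh : ∀ u, HasDerivAt h (1 - w u) u)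
    (hm1 : h (-1) = 0) (hp1 : h 1 = 0) {f : E d × ℝ → ℝ} (hf : ContDiff ℝ ∞ f) {s : E d}
    (hint : Integrable (fun u => f (s, u) + c.n u / c.dn u * du f (s, u)) leb) :
    constraintFn c f s = (∫ u in Icc (-1 : ℝ) 1, w u * f (s, u))
      + ∫ u in Icc (-1 : ℝ) 1, (c.n u / c.dn u - h u) * du f (s, u) := by
  have hfc : Continuous fun u => f (s, u) := hf.continuous.comp (by fun_prop)
  have hdc : Continuous fun u => du f (s, u) := (contDiff_du hf).continuous.comp (by fun_prop)
  have hhc : Continuous h := continuous_iff_continuousAt.2 fun u => (hh u).continuousAt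
  have hon : ∀ g : ℝ → ℝ, Continuous g → Integrable g leb := fun g hg =>
    hg.continuousOn.integrableOn_compact isCompact_Icc
  have hparts : ∫ u in Icc (-1 : ℝ) 1, ((1 - w u) * f (s, u) + h u * du f (s, u)) = 0 := by
    rw [integral_Icc_eq_integral_Ioc, ← intervalIntegral.integral_of_le (by norm_num),
      intervalIntegral.integral_eq_sub_of_hasDerivAt (f := fun u => h u * f (s, u))]
    · simp [hm1, hp1]
    · exact fun u _ => (hh u).mul (hasDerivAt_slice hf s u)
    · exact Continuous.intervalIntegrable (by fun_prop) _ _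
  have hi1 := hon (fun u => w u * f (s, u)) (by fun_prop)
  have hi2 := hon (fun u => (1 - w u) * f (s, u) + h u * du f (s, u)) (by fun_prop)
  have hi3 : Integrable (fun u => (c.n u / c.dn u - h u) * du f (s, u)) leb := by
    refine ((hint.sub hi1).sub hi2).congr (Filter.Eventually.of_forall fun u => ?_)
    simp only [Pi.sub_apply]
    ring
  have hi12 : Integrable (fun u => w u * f (s, u) + ((1 - w u) * f (s, u) + h u * du f (s, u))) leb :=
    hi1.add hi2
  rw [← add_zero (∫ u in Icc (-1 : ℝ) 1, w u * f (s, u)), ← hparts, ← integral_add hi1 hi2,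
    ← integral_add hi12 hi3, constraintFn]
  refine integral_congr_ae (Filter.Eventually.of_forall fun u => ?_)
  ring

section

variable [IsFiniteMeasure (surfaceMeasure Γ)]

/-- On a finite measure space the `L¹` norm is bounded by the `L²` norm. -/
theorem exists_lintegral_enorm_le {α F : Type*} [MeasurableSpace α] [NormedAddCommGroup F]
    (μ : Measure α) [IsFiniteMeasure μ] :
    ∃ D : ENNReal, D ≠ ⊤ ∧ ∀ f : Lp F 2 μ, ∫⁻ x, ‖f x‖ₑ ∂μ ≤ D * ‖f‖ₑ := by
  refine ⟨μ univ ^ ((1 : ℝ) / 2), ENNReal.rpow_ne_top_of_nonneg (by norm_num) (measure_ne_top _ _),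
    fun f => ?_⟩
  have h := eLpNorm_le_eLpNorm_mul_rpow_measure_univ (p := 1) (q := 2) one_le_two
    (Lp.aestronglyMeasurable f)
  rw [eLpNorm_one_eq_lintegral_enorm] at h
  refine h.trans_eq ?_
  rw [mul_comm, Lp.enorm_def]
  norm_num

/-- The constraint of a smooth function is `L¹`-close to its weighted vertical average, with an error
controlled by the weighted vertical derivative. -/
theorem exists_lintegral_sub_average_le (hΓ : IsCompact Γ) (hc : c.Admissible i) {w h : ℝ → ℝ}
    (hw : Continuous w) (hh : ∀ u, HasDerivAt h (1 - w u) u) (hm1 : h (-1) = 0) (hp1 : h 1 = 0)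
    (hC : ∃ C : ℝ, ∀ u ∈ Ioo (-1 : ℝ) 1, |h u| * |c.dn u| ≤ C * |c.n u|) :
    ∃ D : ENNReal, D ≠ ⊤ ∧ ∀ (f : E d × ℝ → ℝ) (v : Ambient Γ), IsTriple c f v →
      ∫⁻ s, ‖H1fn v.2.2 s - ∫ u in Icc (-1 : ℝ) 1, w u * f (s, u)‖ₑ ∂(surfaceMeasure Γ)
        ≤ D * ‖v.1‖ₑ := by
  obtain ⟨C, hC⟩ := hC
  obtain ⟨B, hB, hle⟩ := hc.exists_n_div_dn_le
  have : IsFiniteMeasure (cylMeasure Γ) := by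
    unfold cylMeasure
    infer_instance
  obtain ⟨D, hD, hDle⟩ := exists_lintegral_enorm_le (F := ℝ) (cylMeasure Γ)
  -- the weight `√𝖺` controls `n / n' - h`
  have hcoef : ∀ᵐ u ∂leb, |c.n u / c.dn u - h u| ≤ (1 + |C|) * B * √(c.wa u) := by
    filter_upwards [hc.n_ne, ae_leb_mem_Ioo] with u hu hI
    have h1 : |h u| ≤ |C| * |c.n u / c.dn u| := by
      rw [abs_div, mul_div_assoc', le_div_iff₀ (abs_pos.2 hu.2)]
      exact (hC u hI).trans (mul_le_mul_of_nonneg_right (le_abs_self C) (abs_nonneg _))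
    calc |c.n u / c.dn u - h u| ≤ |c.n u / c.dn u| + |h u| := abs_sub _ _
      _ ≤ (1 + |C|) * |c.n u / c.dn u| := by linarith
      _ ≤ (1 + |C|) * (B * √(c.wa u)) := by
          gcongr
          exact hle u hI
      _ = _ := by ring
  refine ⟨ENNReal.ofReal ((1 + |C|) * B) * D, ENNReal.mul_ne_top ENNReal.ofReal_ne_top hD,
    fun f v hv => ?_⟩
  have hpt : ∀ᵐ s ∂(surfaceMeasure Γ),
      ‖H1fn v.2.2 s - ∫ u in Icc (-1 : ℝ) 1, w u * f (s, u)‖ₑ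
        ≤ ENNReal.ofReal ((1 + |C|) * B) * ∫⁻ u, ‖v.1 (s, u)‖ₑ ∂leb := by
    filter_upwards [hv.constraint_eq, hv.ae_integrable hΓ hc,
      Measure.ae_ae_of_ae_prod hv.du_eq] with s h1 h2 h3
    rw [h1, constraintFn_eq hw hh hm1 hp1 hv.contDiff h2, add_sub_cancel_left,
      ← lintegral_const_mul' _ _ ENNReal.ofReal_ne_top]
    refine (enorm_integral_le_lintegral_enorm _).trans (lintegral_mono_ae ?_)
    filter_upwards [hcoef, h3] with u k1 k2
    rw [k2, ← Real.enorm_of_nonneg (by positivity : (0 : ℝ) ≤ (1 + |C|) * B), ← enorm_mul,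
      enorm_le_iff_norm_le, norm_mul, norm_mul _ (√(c.wa u) * _), norm_mul (√_),
      Real.norm_of_nonneg (by positivity : (0 : ℝ) ≤ (1 + |C|) * B),
      Real.norm_of_nonneg (Real.sqrt_nonneg _), ← mul_assoc]
    exact mul_le_mul_of_nonneg_right k1 (norm_nonneg _)
  refine (lintegral_mono_ae hpt).trans ?_
  rw [lintegral_const_mul' _ _ ENNReal.ofReal_ne_top, mul_assoc]
  gcongr
  refine le_trans (le_of_eq ?_) (hDle v.1)
  exact (lintegral_prod _ (Lp.aestronglyMeasurable v.1).enorm).symm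

end

/-! ### Translations in a local parametrisation -/

namespace LocalParam

variable {x : E d} (p : LocalParam Γ x)

/-- In a local parametrisation only the tangential part of the gradient matters. -/
theorem norm_fderiv_comp_le {g : E d → ℝ} (hg : Differentiable ℝ g)
    {z : EuclideanSpace ℝ (Fin (d - 1))} (hz : z ∈ Metric.ball 0 p.ρ) :
    ‖fderiv ℝ (fun z => g (p.ψ z)) z‖ ≤ p.K * ‖tangentialGradient Γ g (p.ψ z)‖ := by
  have hnhds : Metric.ball 0 p.ρ ∈ nhds z := Metric.isOpen_ball.mem_nhds hz
  have hψ : HasFDerivAt p.ψ (fderiv ℝ p.ψ z) z :=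
    ((p.contDiffOn_ψ.differentiableOn (by simp)).differentiableAt hnhds).hasFDerivAt
  have hK : ‖fderiv ℝ p.ψ z‖ ≤ p.K := norm_fderiv_le_of_lipschitzOn ℝ hnhds p.lipschitz_ψ
  have htan : ∀ v, fderiv ℝ p.ψ z v ∈ tangentSpaceAt Γ (p.ψ z) := by
    intro v
    have h1 := (hψ.hasFDerivWithinAt (s := Metric.ball 0 p.ρ)).mapsTo_tangent_cone
    rw [tangentConeAt_of_mem_nhds hnhds] at h1
    refine Submodule.subset_span (tangentConeAt_mono ?_ (h1 (mem_univ v)))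
    rintro _ ⟨y, hy, rfl⟩
    exact p.mem y hy
  have hcomp : fderiv ℝ (fun z => g (p.ψ z)) z = (fderiv ℝ g (p.ψ z)).comp (fderiv ℝ p.ψ z) :=
    ((hg (p.ψ z)).hasFDerivAt.comp z hψ).fderiv
  rw [hcomp]
  refine ContinuousLinearMap.opNorm_le_bound _ (by positivity) fun v => ?_
  have h2 : fderiv ℝ g (p.ψ z) (fderiv ℝ p.ψ z v)
      = ⟪tangentialGradient Γ g (p.ψ z), fderiv ℝ p.ψ z v⟫ := by
    rw [tangentialGradient, Submodule.inner_starProjection_left_eq_right,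
      Submodule.starProjection_eq_self_iff.2 (htan v), gradient,
      InnerProductSpace.toDual_symm_apply]
  change ‖fderiv ℝ g (p.ψ z) (fderiv ℝ p.ψ z v)‖ ≤ _
  rw [h2]
  calc ‖⟪tangentialGradient Γ g (p.ψ z), fderiv ℝ p.ψ z v⟫‖
      ≤ ‖tangentialGradient Γ g (p.ψ z)‖ * ‖fderiv ℝ p.ψ z v‖ := norm_inner_le_norm _ _
    _ ≤ ‖tangentialGradient Γ g (p.ψ z)‖ * (p.K * ‖v‖) := by
        gcongr
        exact (ContinuousLinearMap.le_opNorm _ _).trans (by gcongr)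
    _ = _ := by ring

theorem lintegral_comp_le (hΓ : MeasurableSet Γ) {g : E d → ENNReal}
    (hg : AEMeasurable g (surfaceMeasure Γ)) {r : ℝ} (hr : r ≤ p.ρ) :
    ∫⁻ z in Metric.ball 0 r, g (p.ψ z) ≤ ∫⁻ s, g s ∂(surfaceMeasure Γ) := by
  refine (lintegral_mono' (Measure.restrict_mono (Metric.ball_subset_ball hr) le_rfl) le_rfl).trans ?_
  rw [← lintegral_map' (hg.mono_measure (p.map_volume_le hΓ)) p.aemeasurable_ψ]
  exact lintegral_mono' (p.map_volume_le hΓ) le_rfl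

theorem ae_comp (hΓ : MeasurableSet Γ) {P : E d → Prop} (h : ∀ᵐ s ∂(surfaceMeasure Γ), P s) {r : ℝ}
    (hr : r ≤ p.ρ) : ∀ᵐ z ∂(volume.restrict (Metric.ball 0 r)), P (p.ψ z) := by
  have h1 : ∀ᵐ s ∂((volume.restrict (Metric.ball 0 p.ρ)).map p.ψ), P s :=
    (Measure.absolutelyContinuous_of_le (p.map_volume_le hΓ)).ae_le h
  exact ae_restrict_of_ae_restrict_of_subset (Metric.ball_subset_ball hr)
    (ae_of_ae_map p.aemeasurable_ψ h1)

end LocalParam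

end Constancy

section Local

variable {d : ℕ} {Γ : Set (E d)} {c : Coefficients} {i : ℕ}

theorem exists_lintegral_weight_mul_le [IsFiniteMeasure (surfaceMeasure Γ)] {q : ℝ → ℝ}
    (hq : MemLp q 2 leb) : ∃ D : ENNReal, D ≠ ⊤ ∧ ∀ F : Lp (E d) 2 (cylMeasure Γ),
      ∫⁻ u, ∫⁻ s, ‖q u‖ₑ * ‖F (s, u)‖ₑ ∂(surfaceMeasure Γ) ∂leb ≤ D * ‖F‖ₑ := by
  have hq2 : MemLp (fun x : E d × ℝ => q x.2) 2 (cylMeasure Γ) := hq.comp_snd (surfaceMeasure Γ)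
  refine ⟨eLpNorm (fun x : E d × ℝ => q x.2) 2 (cylMeasure Γ), hq2.eLpNorm_ne_top, fun F => ?_⟩
  have h := eLpNorm_smul_le_mul_eLpNorm (p := 2) (q := 2) (r := 1) (Lp.aestronglyMeasurable F) hq2.aestronglyMeasurable
  rw [eLpNorm_one_eq_lintegral_enorm, ← Lp.enorm_def] at h
  refine le_trans (le_of_eq ?_) h
  have h2 : AEMeasurable (fun x : E d × ℝ => ‖q x.2‖ₑ * ‖F x‖ₑ)
      ((surfaceMeasure Γ).prod leb) :=
    hq2.aestronglyMeasurable.enorm.mul (Lp.aestronglyMeasurable F).enorm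
  rw [← lintegral_prod_symm _ h2]
  refine lintegral_congr fun x => ?_
  rw [Pi.smul_apply', enorm_smul]

namespace LocalParam

variable {x : E d} (p : LocalParam Γ x)

theorem add_mem_ball {r : ℝ} {z v : EuclideanSpace ℝ (Fin (d - 1))} (hr : 2 * r ≤ p.ρ)
    (hv : ‖v‖ < r) (hz : z ∈ Metric.ball 0 r) : z + v ∈ Metric.ball 0 p.ρ := by
  rw [mem_ball_zero_iff] at hz ⊢
  linarith [norm_add_le z v]

theorem continuousOn_translate {r : ℝ} {v : EuclideanSpace ℝ (Fin (d - 1))} (hr : 2 * r ≤ p.ρ)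
    (hv : ‖v‖ < r) : ContinuousOn (fun z => p.ψ (z + v)) (Metric.ball 0 r) :=
  p.contDiffOn_ψ.continuousOn.comp (by fun_prop) fun _ hz => p.add_mem_ball hr hv hz

theorem continuousOn_ball {r : ℝ} {v : EuclideanSpace ℝ (Fin (d - 1))} (hr : 2 * r ≤ p.ρ)
    (hv : ‖v‖ < r) : ContinuousOn p.ψ (Metric.ball 0 r) :=
  p.contDiffOn_ψ.continuousOn.mono
    (Metric.ball_subset_ball (by linarith [norm_nonneg v]))

/-- Translating a weighted vertical average of a smooth function changes it little in `L¹`, in terms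
of the weighted tangential derivative. -/
theorem lintegral_translate_average_le (hΓ : MeasurableSet Γ) {w q : ℝ → ℝ} (hw : Continuous w)
    (hwq : ∀ u ∈ Ioo (-1 : ℝ) 1, |w u| ≤ q u * √(c.wm u))
    {r : ℝ} {v : EuclideanSpace ℝ (Fin (d - 1))} (hr : 2 * r ≤ p.ρ) (hv : ‖v‖ < r)
    [IsFiniteMeasure (surfaceMeasure Γ)] {f : E d × ℝ → ℝ} {t : Ambient Γ} (ht : IsTriple c f t) :
    ∫⁻ z in Metric.ball 0 r, ‖(∫ u in Icc (-1 : ℝ) 1, w u * f (p.ψ (z + v), u))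
        - ∫ u in Icc (-1 : ℝ) 1, w u * f (p.ψ z, u)‖ₑ
      ≤ ‖v‖ₑ * p.K * ∫⁻ u, ∫⁻ s, ‖q u‖ₑ * ‖t.2.1 (s, u)‖ₑ ∂(surfaceMeasure Γ) ∂leb := by
  have hf := ht.contDiff
  have hint : ∀ s, Integrable (fun u => w u * f (s, u)) leb := fun s => by
    have h1 : Continuous fun u => w u * f (s, u) :=
      hw.mul (hf.continuous.comp (by fun_prop))
    exact h1.continuousOn.integrableOn_compact isCompact_Icc
  have hpt : ∀ z, ‖(∫ u in Icc (-1 : ℝ) 1, w u * f (p.ψ (z + v), u))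
        - ∫ u in Icc (-1 : ℝ) 1, w u * f (p.ψ z, u)‖ₑ
      ≤ ∫⁻ u, ‖w u‖ₑ * ‖f (p.ψ (z + v), u) - f (p.ψ z, u)‖ₑ ∂leb := by
    intro z
    rw [← integral_sub (hint _) (hint _)]
    refine (enorm_integral_le_lintegral_enorm _).trans (lintegral_mono fun u => ?_)
    rw [← mul_sub, enorm_mul]
  refine (lintegral_mono hpt).trans ?_
  have hmeas : AEMeasurable (Function.uncurry fun z u =>
      ‖w u‖ₑ * ‖f (p.ψ (z + v), u) - f (p.ψ z, u)‖ₑ)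
      ((volume.restrict (Metric.ball 0 r)).prod leb) := by
    rw [leb, Measure.prod_restrict]
    refine AEMeasurable.mul ?_ (AEMeasurable.enorm ?_)
    · exact (hw.measurable.comp measurable_snd).enorm.aemeasurable
    · refine ContinuousOn.aemeasurable ?_ (measurableSet_ball.prod measurableSet_Icc)
      have hfst : MapsTo Prod.fst (Metric.ball (0 : EuclideanSpace ℝ (Fin (d - 1))) r
          ×ˢ Icc (-1 : ℝ) 1) (Metric.ball 0 r) := fun _ h => h.1
      refine ContinuousOn.sub ?_ ?_
      · exact hf.continuous.comp_continuousOn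
          (((p.continuousOn_translate hr hv).comp continuousOn_fst hfst).prodMk continuousOn_snd)
      · exact hf.continuous.comp_continuousOn
          (((p.continuousOn_ball hr hv).comp continuousOn_fst hfst).prodMk continuousOn_snd)
  rw [lintegral_lintegral_swap hmeas,
    ← lintegral_const_mul' _ _ (ENNReal.mul_ne_top enorm_ne_top ENNReal.coe_ne_top)]
  refine lintegral_mono_ae ?_
  filter_upwards [ae_leb_mem_Ioo, ae_ae_of_ae_prod_swap ht.grad_eq] with u hu hgrad
  have hfu := differentiable_slice_left hf u
  have hcd : ContDiff ℝ 1 fun y => f (y, u) :=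
    (hf.comp (contDiff_id.prodMk contDiff_const)).of_le (by simp)
  rw [lintegral_const_mul' _ _ enorm_ne_top]
  calc ‖w u‖ₑ * ∫⁻ z in Metric.ball 0 r, ‖f (p.ψ (z + v), u) - f (p.ψ z, u)‖ₑ
      ≤ ‖w u‖ₑ * (‖v‖ₑ * ∫⁻ z in Metric.ball 0 (2 * r), ‖fderiv ℝ (fun z => f (p.ψ z, u)) z‖ₑ) := by
        gcongr
        exact lintegral_translate_sub_le (h := fun z => f (p.ψ z, u))
          (hcd.comp_contDiffOn (p.contDiffOn_ψ.mono (Metric.ball_subset_ball hr))) hv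
    _ ≤ ‖w u‖ₑ * (‖v‖ₑ * ∫⁻ z in Metric.ball 0 (2 * r), p.K * ‖tgrad Γ f (p.ψ z, u)‖ₑ) := by
        gcongr ‖w u‖ₑ * (‖v‖ₑ * ?_)
        refine setLIntegral_mono' measurableSet_ball fun z hz => ?_
        have h1 := p.norm_fderiv_comp_le hfu (Metric.ball_subset_ball hr hz)
        have h2 : ‖(p.K : ℝ) * ‖tgrad Γ f (p.ψ z, u)‖‖ₑ = p.K * ‖tgrad Γ f (p.ψ z, u)‖ₑ := by
          rw [enorm_mul, enorm_norm]
          simp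
        rw [← h2, enorm_le_iff_norm_le, Real.norm_of_nonneg (by positivity)]
        exact h1
    _ = ‖v‖ₑ * p.K * ∫⁻ z in Metric.ball 0 (2 * r), ‖w u‖ₑ * ‖tgrad Γ f (p.ψ z, u)‖ₑ := by
        rw [lintegral_const_mul' _ _ ENNReal.coe_ne_top, lintegral_const_mul' _ _ enorm_ne_top]
        ring
    _ ≤ ‖v‖ₑ * p.K * ∫⁻ z in Metric.ball 0 (2 * r), ‖q u‖ₑ * ‖t.2.1 (p.ψ z, u)‖ₑ := by
        gcongr ‖v‖ₑ * p.K * ?_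
        refine lintegral_mono_ae ?_
        filter_upwards [p.ae_comp hΓ hgrad hr] with z hz
        rw [hz, enorm_smul, ← mul_assoc]
        gcongr
        rw [← enorm_mul, enorm_le_iff_norm_le]
        refine (hwq u hu).trans ?_
        rw [norm_mul, Real.norm_of_nonneg (Real.sqrt_nonneg _)]
        gcongr
        exact Real.le_norm_self _
    _ ≤ _ := by
        gcongr ‖v‖ₑ * p.K * ?_
        refine p.lintegral_comp_le (g := fun s => ‖q u‖ₑ * ‖t.2.1 (s, u)‖ₑ) hΓ ?_ hr
        refine (Measurable.const_mul ?_ _).aemeasurable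
        exact ((Lp.stronglyMeasurable t.2.1).comp_measurable measurable_prodMk_right).enorm

/-- Translating the constraint of a smooth function in a local parametrisation changes it little in
`L¹`, in terms of the energy: it is close to a weighted vertical average, for which this holds. -/
theorem exists_lintegral_translate_le (hΓ : IsCompact Γ) (hc : c.Admissible i)
    (hi : i ≤ 1 ∨ c.NotFlat) {r : ℝ} {v : EuclideanSpace ℝ (Fin (d - 1))} (hr : 2 * r ≤ p.ρ)
    (hv : ‖v‖ < r) [IsFiniteMeasure (surfaceMeasure Γ)] :
    ∃ D : ENNReal, D ≠ ⊤ ∧ ∀ (f : E d × ℝ → ℝ) (t : Ambient Γ), IsTriple c f t →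
      ∫⁻ z in Metric.ball 0 r, ‖H1fn t.2.2 (p.ψ (z + v)) - H1fn t.2.2 (p.ψ z)‖ₑ
        ≤ D * (‖t.1‖ₑ + ‖t.2.1‖ₑ) := by
  obtain ⟨w, h, hw, hh, hm1, hp1, ⟨q, hq, hwq⟩, hC⟩ := hc.exists_weight hi
  obtain ⟨D₁, hD₁, hle₁⟩ := exists_lintegral_sub_average_le hΓ hc hw hh hm1 hp1 hC
  obtain ⟨D₂, hD₂, hle₂⟩ := exists_lintegral_weight_mul_le (Γ := Γ) hq
  have hvK : ‖v‖ₑ * p.K ≠ ⊤ := ENNReal.mul_ne_top enorm_ne_top ENNReal.coe_ne_top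
  refine ⟨2 * D₁ + ‖v‖ₑ * p.K * D₂, by finiteness, fun f t ht => ?_⟩
  set k := H1fn t.2.2 with hk
  set A : E d → ℝ := fun s => ∫ u in Icc (-1 : ℝ) 1, w u * f (s, u) with hA
  have hAm : Measurable A := by
    have h1 : Continuous fun x : E d × ℝ => w x.2 * f x :=
      (hw.comp continuous_snd).mul ht.contDiff.continuous
    exact (StronglyMeasurable.integral_prod_right' (ν := leb) h1.stronglyMeasurable).measurable
  have hkm : Measurable k := (Lp.stronglyMeasurable k).measurable
  have hg : Measurable fun s => ‖k s - A s‖ₑ := (hkm.sub hAm).enorm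
  have hψ0 := (p.continuousOn_ball hr hv).aemeasurable (μ := volume) measurableSet_ball
  have hψ1 := (p.continuousOn_translate hr hv).aemeasurable (μ := volume) measurableSet_ball
  have hg0 : AEMeasurable (fun z => ‖k (p.ψ z) - A (p.ψ z)‖ₑ)
      (volume.restrict (Metric.ball 0 r)) := hg.comp_aemeasurable hψ0
  have hg1 : AEMeasurable (fun z => ‖k (p.ψ (z + v)) - A (p.ψ (z + v))‖ₑ)
      (volume.restrict (Metric.ball 0 r)) := hg.comp_aemeasurable hψ1
  have hr0 : r ≤ p.ρ := by linarith [norm_nonneg v]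
  calc ∫⁻ z in Metric.ball 0 r, ‖k (p.ψ (z + v)) - k (p.ψ z)‖ₑ
      ≤ ∫⁻ z in Metric.ball 0 r, (‖k (p.ψ z) - A (p.ψ z)‖ₑ
          + (‖k (p.ψ (z + v)) - A (p.ψ (z + v))‖ₑ + ‖A (p.ψ (z + v)) - A (p.ψ z)‖ₑ)) := by
        refine lintegral_mono fun z => ?_
        have h1 : k (p.ψ (z + v)) - k (p.ψ z)
            = (k (p.ψ (z + v)) - A (p.ψ (z + v)) + (A (p.ψ (z + v)) - A (p.ψ z)))
              - (k (p.ψ z) - A (p.ψ z)) := by ring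
        rw [h1, add_comm ‖k (p.ψ z) - A (p.ψ z)‖ₑ]
        refine enorm_sub_le.trans ?_
        gcongr
        exact enorm_add_le _ _
    _ = (∫⁻ z in Metric.ball 0 r, ‖k (p.ψ z) - A (p.ψ z)‖ₑ)
          + ((∫⁻ z in Metric.ball 0 r, ‖k (p.ψ (z + v)) - A (p.ψ (z + v))‖ₑ)
          + ∫⁻ z in Metric.ball 0 r, ‖A (p.ψ (z + v)) - A (p.ψ z)‖ₑ) := by
        rw [lintegral_add_left' hg0, lintegral_add_left' hg1]
    _ ≤ D₁ * ‖t.1‖ₑ + (D₁ * ‖t.1‖ₑ + ‖v‖ₑ * p.K * (D₂ * ‖t.2.1‖ₑ)) := by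
        refine add_le_add ?_ (add_le_add ?_ ?_)
        · exact (p.lintegral_comp_le hΓ.measurableSet hg.aemeasurable hr0).trans (hle₁ f t ht)
        · exact (lintegral_translate_le (fun z => ‖k (p.ψ z) - A (p.ψ z)‖ₑ) hv).trans
            ((p.lintegral_comp_le hΓ.measurableSet hg.aemeasurable hr).trans (hle₁ f t ht))
        · refine (p.lintegral_translate_average_le hΓ.measurableSet hw hwq hr hv ht).trans ?_
          gcongr
          exact hle₂ _
    _ ≤ (2 * D₁ + ‖v‖ₑ * p.K * D₂) * ‖t.1‖ₑ + (2 * D₁ + ‖v‖ₑ * p.K * D₂) * ‖t.2.1‖ₑ := by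
        rw [← add_assoc, ← two_mul, ← mul_assoc, ← mul_assoc]
        gcongr
        · exact le_self_add
        · exact le_add_self
    _ = _ := by ring

/-- A function on `Γ` which is the constraint of an element of the energy space without energy is
locally invariant under translations of the parameter. -/
theorem lintegral_translate_eq_zero (hΓ : IsCompact Γ) (hc : c.Admissible i)
    (hi : i ≤ 1 ∨ c.NotFlat) {r : ℝ} {v : EuclideanSpace ℝ (Fin (d - 1))} (hr : 2 * r ≤ p.ρ)
    (hv : ‖v‖ < r) [IsFiniteMeasure (surfaceMeasure Γ)] {κ : H1 Γ}
    (hκ : ((0, 0, κ) : Ambient Γ) ∈ H Γ c) :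
    ∫⁻ z in Metric.ball 0 r, ‖H1fn κ (p.ψ (z + v)) - H1fn κ (p.ψ z)‖ₑ = 0 := by
  obtain ⟨D, hD, hle⟩ := p.exists_lintegral_translate_le hΓ hc hi hr hv
  obtain ⟨D₀, hD₀, hle₀⟩ := exists_lintegral_enorm_le (F := ℝ) (surfaceMeasure Γ)
  have hr0 : r ≤ p.ρ := by linarith [norm_nonneg v]
  set k := H1fn κ with hk
  let B : Ambient Γ → ENNReal := fun t =>
    2 * D₀ * ‖H1fnL Γ t.2.2 - k‖ₑ + D * (‖t.1‖ₑ + ‖t.2.1‖ₑ)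
  have hB : Continuous B := by
    refine Continuous.add ?_ ?_
    · exact (ENNReal.continuous_const_mul (by finiteness)).comp (by fun_prop)
    · exact (ENNReal.continuous_const_mul hD).comp (by fun_prop)
  have hkm : ∀ g : L2 Γ, Measurable g := fun g => (Lp.stronglyMeasurable g).measurable
  have hψ0 := (p.continuousOn_ball hr hv).aemeasurable (μ := volume) measurableSet_ball
  have hψ1 := (p.continuousOn_translate hr hv).aemeasurable (μ := volume) measurableSet_ball
  have hsub : closure {t : Ambient Γ | ∃ f, IsTriple c f t}
      ⊆ {t | ∫⁻ z in Metric.ball 0 r, ‖k (p.ψ (z + v)) - k (p.ψ z)‖ₑ ≤ B t} := by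
    refine closure_minimal ?_ (isClosed_le continuous_const hB)
    rintro t ⟨f, ht⟩
    set l := H1fn t.2.2 with hl
    have hg : Measurable fun s => ‖l s - k s‖ₑ := ((hkm l).sub (hkm k)).enorm
    have hg0 : AEMeasurable (fun z => ‖l (p.ψ z) - k (p.ψ z)‖ₑ)
        (volume.restrict (Metric.ball 0 r)) := hg.comp_aemeasurable hψ0
    have hg1 : AEMeasurable (fun z => ‖l (p.ψ (z + v)) - k (p.ψ (z + v))‖ₑ)
        (volume.restrict (Metric.ball 0 r)) := hg.comp_aemeasurable hψ1
    have hdiff : ∫⁻ s, ‖l s - k s‖ₑ ∂(surfaceMeasure Γ) ≤ D₀ * ‖l - k‖ₑ := by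
      refine le_trans (le_of_eq (lintegral_congr_ae ?_)) (hle₀ (l - k))
      filter_upwards [Lp.coeFn_sub l k] with s hs
      rw [hs, Pi.sub_apply]
    calc ∫⁻ z in Metric.ball 0 r, ‖k (p.ψ (z + v)) - k (p.ψ z)‖ₑ
        ≤ ∫⁻ z in Metric.ball 0 r, (‖l (p.ψ z) - k (p.ψ z)‖ₑ
          + (‖l (p.ψ (z + v)) - k (p.ψ (z + v))‖ₑ + ‖l (p.ψ (z + v)) - l (p.ψ z)‖ₑ)) := by
          refine lintegral_mono fun z => ?_
          have h1 : k (p.ψ (z + v)) - k (p.ψ z)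
              = (l (p.ψ z) - k (p.ψ z)) + ((l (p.ψ (z + v)) - l (p.ψ z))
                - (l (p.ψ (z + v)) - k (p.ψ (z + v)))) := by ring
          rw [h1, add_comm ‖l (p.ψ (z + v)) - k (p.ψ (z + v))‖ₑ]
          refine (enorm_add_le _ _).trans ?_
          gcongr
          exact enorm_sub_le
      _ = (∫⁻ z in Metric.ball 0 r, ‖l (p.ψ z) - k (p.ψ z)‖ₑ)
          + ((∫⁻ z in Metric.ball 0 r, ‖l (p.ψ (z + v)) - k (p.ψ (z + v))‖ₑ)
          + ∫⁻ z in Metric.ball 0 r, ‖l (p.ψ (z + v)) - l (p.ψ z)‖ₑ) := by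
          rw [lintegral_add_left' hg0, lintegral_add_left' hg1]
      _ ≤ D₀ * ‖l - k‖ₑ + (D₀ * ‖l - k‖ₑ + D * (‖t.1‖ₑ + ‖t.2.1‖ₑ)) := by
          refine add_le_add ?_ (add_le_add ?_ (hle f t ht))
          · exact (p.lintegral_comp_le hΓ.measurableSet hg.aemeasurable hr0).trans hdiff
          · exact (lintegral_translate_le (fun z => ‖l (p.ψ z) - k (p.ψ z)‖ₑ) hv).trans
              ((p.lintegral_comp_le hΓ.measurableSet hg.aemeasurable hr).trans hdiff)
      _ = B t := by
          change _ = 2 * D₀ * ‖l - k‖ₑ + _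
          ring
  have h0 : ∫⁻ z in Metric.ball 0 r, ‖k (p.ψ (z + v)) - k (p.ψ z)‖ₑ ≤ B (0, 0, κ) :=
    hsub (mem_closure_triples hΓ hc hκ)
  have hB0 : B (0, 0, κ) = 0 := by
    change 2 * D₀ * ‖H1fn κ - k‖ₑ + D * (‖(0 : Lp ℝ 2 (cylMeasure Γ))‖ₑ
      + ‖(0 : Lp (E d) 2 (cylMeasure Γ))‖ₑ) = 0
    rw [hk, sub_self, enorm_zero, enorm_zero, enorm_zero]
    simp
  exact le_antisymm (h0.trans_eq hB0) bot_le

/-- A measurable function invariant under small translations of the parameter is constant near the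
centre of the parametrisation. -/
theorem exists_nhds_const (hΓ : MeasurableSet Γ) {k : E d → ℝ} (hk : Measurable k)
    (h : ∀ v : EuclideanSpace ℝ (Fin (d - 1)), ‖v‖ < p.ρ / 2 →
      ∫⁻ z in Metric.ball 0 (p.ρ / 2), ‖k (p.ψ (z + v)) - k (p.ψ z)‖ₑ = 0) :
    ∃ W : Set (E d), IsOpen W ∧ x ∈ W ∧ ∃ r, surfaceMeasure Γ {s ∈ W | k s ≠ r} = 0 := by
  classical
  have hρ := p.ρ_pos
  -- a measurable extension of the parametrisation
  let Ψ : EuclideanSpace ℝ (Fin (d - 1)) → E d := (Metric.ball 0 p.ρ).piecewise p.ψ fun _ => x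
  have hΨ : Measurable Ψ := p.contDiffOn_ψ.continuousOn.measurable_piecewise
    continuousOn_const measurableSet_ball
  have hΨψ : ∀ z ∈ Metric.ball 0 p.ρ, Ψ z = p.ψ z := fun z hz => piecewise_eq_of_mem _ _ _ hz
  have hball : Metric.ball (0 : EuclideanSpace ℝ (Fin (d - 1))) (p.ρ / 2)
      ⊆ Metric.ball 0 p.ρ := Metric.ball_subset_ball (by linarith)
  obtain ⟨r, hr⟩ := ae_const_of_translate_eq (hk.comp hΨ) (half_pos hρ) fun v hv => by
    have hψ0 := (p.continuousOn_ball (by linarith) hv).aemeasurable (μ := volume) measurableSet_ball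
    have hψ1 := (p.continuousOn_translate (by linarith) hv).aemeasurable (μ := volume)
      measurableSet_ball
    have h1 := (lintegral_eq_zero_iff'
      ((hk.comp_aemeasurable hψ1).sub (hk.comp_aemeasurable hψ0)).enorm).1 (h v hv)
    filter_upwards [h1, ae_restrict_mem measurableSet_ball] with z hz hzb
    have h2 : k (p.ψ (z + v)) - k (p.ψ z) = 0 := enorm_eq_zero.1 hz
    rw [Function.comp_apply, Function.comp_apply, hΨψ _ (hball hzb),
      hΨψ _ (p.add_mem_ball (by linarith) hv hzb)]
    exact sub_eq_zero.1 h2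
  have hsub : Metric.ball (0 : EuclideanSpace ℝ (Fin (d - 1))) (p.ρ / 2 / 2)
      ⊆ Metric.ball 0 p.ρ := Metric.ball_subset_ball (by linarith)
  obtain ⟨W, hW, hxW, hWsub⟩ := p.nhds_subset (p.ρ / 2 / 2) (by linarith)
  refine ⟨W, hW, hxW, r, ?_⟩
  set N : Set (EuclideanSpace ℝ (Fin (d - 1))) :=
    {z | k (Ψ z) ≠ r} ∩ Metric.ball 0 (p.ρ / 2 / 2) with hN
  have hN0 : volume N = 0 := by
    rw [ae_iff, Measure.restrict_apply' measurableSet_ball] at hr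
    exact hr
  have h1 : surfaceMeasure Γ (p.ψ '' N) = 0 := by
    have h2 := p.surfaceMeasure_image_le (A := N) (inter_subset_right.trans hsub)
    rw [hN0, mul_zero] at h2
    exact le_antisymm h2 bot_le
  have h3 : ∀ᵐ s ∂(surfaceMeasure Γ), s ∈ Γ := ae_restrict_mem hΓ
  refine measure_mono_null (t := p.ψ '' N ∪ {s | s ∉ Γ}) ?_ (measure_union_null h1 h3)
  rintro s ⟨hsW, hs⟩
  by_cases hsΓ : s ∈ Γ
  · obtain ⟨z, hz, rfl⟩ := hWsub ⟨hsΓ, hsW⟩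
    refine Or.inl ⟨z, ⟨?_, hz⟩, rfl⟩
    change k (Ψ z) ≠ r
    rwa [hΨψ z (hsub hz)]
  · exact Or.inr hsΓ

end LocalParam

/-- Only constants are constraints of elements of the energy space without energy. -/
theorem ae_const_of_mem_H (hΓ : IsClosedHypersurface Γ) (hc : c.Admissible i)
    (hi : i ≤ 1 ∨ c.NotFlat) {κ : H1 Γ} (hκ : ((0, 0, κ) : Ambient Γ) ∈ H Γ c) :
    ∃ r : ℝ, ∀ᵐ s ∂(surfaceMeasure Γ), H1fn κ s = r := by
  have := hΓ.isFiniteMeasure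
  refine hΓ.ae_const_of_locally _ fun x hx => ?_
  obtain ⟨p⟩ := hΓ.nonempty_localParam hx
  exact p.exists_nhds_const hΓ.isCompact.measurableSet (Lp.stronglyMeasurable (H1fn κ)).measurable
    fun v hv => p.lintegral_translate_eq_zero hΓ.isCompact hc hi (by linarith) hv hκ

end Local

/-! ### Constants, positivity and the upper bound -/

section Form

variable {d : ℕ} {Γ : Set (E d)} {c : Coefficients} {i : ℕ} [IsFiniteMeasure (surfaceMeasure Γ)]

/-- The constant function `1` as an element of `H²(Γ)`, with gradient and Laplacian zero. -/
theorem exists_H2_one : ∃ e : H2 Γ, (∀ᵐ s ∂(surfaceMeasure Γ), H2fn e s = 1) ∧ H1grad e.1 = 0 := by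
  have h1 := (memLp_const (μ := surfaceMeasure Γ) (p := 2) (1 : ℝ)).coeFn_toLp
  have hgrad : (0 : L2vec Γ) =ᵐ[surfaceMeasure Γ] tangentialGradient Γ fun _ => 1 := by
    filter_upwards [Lp.coeFn_zero (E d) 2 (surfaceMeasure Γ)] with s hs
    rw [hs]
    simp [tangentialGradient, gradient]
  refine ⟨⟨⟨_, mem_H1_of_contDiff contDiff_const h1 hgrad⟩, 0, fun ψ => ?_⟩, h1, rfl⟩
  rw [inner_zero_left, neg_zero]
  exact inner_zero_left _

theorem form_eq_zero_of_grad (hc : c.Admissible i) {κ : H1 Γ} (hκ : H1grad κ = 0) (ψ : H1 Γ) :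
    form hc κ ψ = 0 := by
  have h : constLift hc κ = 0 := by
    have h1 : tensorL (μ := surfaceMeasure Γ) (F := E d) (sqrtWm hc) (H1grad κ) = 0 := by
      rw [hκ, map_zero]
    exact congrArg (WithLp.toLp 2) (Prod.ext rfl h1)
  rw [form_apply, h, map_zero, inner_zero_left, mul_zero]

theorem form_self (hc : c.Admissible i) (κ : H1 Γ) :
    form hc κ κ = σ / 4 * ‖proj Γ c (constLift hc κ)‖ ^ 2 := by
  rw [form_apply, inner_proj_self]

/-- If the form vanishes on `κ`, then the lift of `κ` is a limit of functions with constraint zero, so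
`κ` is the constraint of an element of the energy space without energy. -/
theorem mem_H_of_form_self_eq_zero (hc : c.Admissible i) {κ : H1 Γ} (h : form hc κ κ = 0) :
    ((0, 0, κ) : Ambient Γ) ∈ H Γ c := by
  have hσ := σ_pos
  rw [form_self] at h
  have h0 : proj Γ c (constLift hc κ) = 0 := by
    have h1 : ‖proj Γ c (constLift hc κ)‖ ^ 2 = 0 := by
      rcases mul_eq_zero.1 h with h2 | h2
      · linarith
      · exact h2
    exact norm_eq_zero.1 (pow_eq_zero_iff two_ne_zero |>.1 h1)
  have h1 := sub_proj_mem (c := c) (constLift hc κ)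
  rw [h0, sub_zero] at h1
  have h2 := (H Γ c).smul_mem (1 / 2 : ℝ)
    ((H Γ c).sub_mem (constLift_mem hc κ) (mem_kernelSpace.1 h1))
  have h3 : (1 / 2 : ℝ) • ((((constLift hc κ).fst, (constLift hc κ).snd, (2 : ℝ) • κ) : Ambient Γ)
      - (((constLift hc κ).fst, (constLift hc κ).snd, 0) : Ambient Γ)) = ((0, 0, κ) : Ambient Γ) := by
    refine Prod.ext ?_ (Prod.ext ?_ ?_)
    · change (1 / 2 : ℝ) • ((constLift hc κ).fst - (constLift hc κ).fst) = 0
      rw [sub_self, smul_zero]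
    · change (1 / 2 : ℝ) • ((constLift hc κ).snd - (constLift hc κ).snd) = 0
      rw [sub_self, smul_zero]
    · change (1 / 2 : ℝ) • ((2 : ℝ) • κ - 0) = κ
      rw [sub_zero, smul_smul]
      norm_num
  rwa [h3] at h2

theorem norm_sqrtWm_sq (hc : c.Admissible i) :
    ‖sqrtWm hc‖ ^ 2 = ∫ u in Icc (-1 : ℝ) 1, c.wm u := by
  rw [← real_inner_self_eq_norm_sq, L2.inner_def]
  refine integral_congr_ae ?_
  filter_upwards [coeFn_sqrtWm hc, ae_restrict_mem measurableSet_Icc] with u h1 h2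
  rw [h1, real_inner_self_eq_norm_sq, Real.norm_of_nonneg (Real.sqrt_nonneg _),
    Real.sq_sqrt (hc.wm_nonneg h2)]

/-- Half the constant lift of `κ` is a competitor with constraint `κ`, so the form is bounded by its
energy. -/
theorem form_self_le (hc : c.Admissible i) (κ : H1 Γ) :
    form hc κ κ ≤ σ / c.δ * ‖H1grad κ‖ ^ 2 := by
  have hσ := σ_pos
  have h1 : ‖constLift hc κ‖ ^ 2 = ‖H1grad κ‖ ^ 2 * ∫ u in Icc (-1 : ℝ) 1, c.wm u := by
    rw [← norm_sqrtWm_sq hc, ← mul_pow, ← norm_tensor, WithLp.prod_norm_sq_eq_of_L2]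
    change ‖(0 : Lp ℝ 2 (cylMeasure Γ))‖ ^ 2 + _ = _
    rw [norm_zero, zero_pow two_ne_zero, zero_add]
    rfl
  calc form hc κ κ = σ / 4 * ‖proj Γ c (constLift hc κ)‖ ^ 2 := form_self hc κ
    _ ≤ σ / 4 * ‖constLift hc κ‖ ^ 2 := by
        gcongr
        exact norm_proj_le _
    _ = σ / c.δ * ‖H1grad κ‖ ^ 2 := by
        rw [h1, Coefficients.δ, div_eq_mul_inv σ (4 * _), mul_inv, inv_inv]
        ring

end Form

end PropOp

end

theorem proposition5p1 {d : ℕ} (Γ : Set (E d)) (hΓ : IsClosedHypersurface Γ)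
    (c : Coefficients) (i : ℕ) (hc : c.Admissible i) :
    -- the solution operator defining `𝒢_Γ` is well defined
    (∀ κ : H1 Γ, ∃! p : H Γ c × (H1 Γ →L[ℝ] ℝ),
      IsSolution κ p.1 p.2) ∧
    -- on `H²(Γ)` the propagation operator takes values in `L²(Γ)`
    ∃ G : H2 Γ →ₗ[ℝ] L2 Γ,
      (∀ (κ : H2 Γ) (ψ : H1 Γ), propagation c κ.1 ψ = ⟪G κ, H1fn ψ⟫) ∧
      -- symmetry
      (∀ h κ : H2 Γ, ⟪G h, H2fn κ⟫ = ⟪H2fn h, G κ⟫) ∧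
      -- invariance
      (∃ e : H2 Γ, (∀ᵐ s ∂(surfaceMeasure Γ), H2fn e s = 1) ∧ G e = 0) ∧
      -- positivity
      (∀ κ : H2 Γ, 0 ≤ ⟪G κ, H2fn κ⟫) ∧
      -- equality for constants, and only for constants
      (∀ κ : H2 Γ, (∃ r : ℝ, ∀ᵐ s ∂(surfaceMeasure Γ), H2fn κ s = r) →
        ⟪G κ, H2fn κ⟫ = 0) ∧
      ((i ≤ 1 ∨ c.NotFlat) → ∀ κ : H2 Γ, ⟪G κ, H2fn κ⟫ = 0 →
        ∃ r : ℝ, ∀ᵐ s ∂(surfaceMeasure Γ), H2fn κ s = r) ∧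
      -- upper bound
      (∀ κ : H2 Γ,
        ⟪G κ, H2fn κ⟫ ≤ ⟪-(σ / c.δ) • laplacian κ, H2fn κ⟫) := by
  have := hΓ.isFiniteMeasure
  have hσ := σ_pos
  obtain ⟨G, hGmem, hG⟩ := exists_propagation_linearMap hΓ.isCompact hc
  have hGf : ∀ h κ : H2 Γ, ⟪G h, H2fn κ⟫ = form hc h.1 κ.1 := fun h κ => (hG h κ.1).symm
  obtain ⟨e, he1, he0⟩ := exists_H2_one (Γ := Γ)
  refine ⟨fun κ => ⟨(solve hc κ, form hc κ), isSolution_solve hc κ, fun p hp =>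
    Prod.ext (eq_of_isSolution hc hp (isSolution_solve hc κ)).1
      (eq_of_isSolution hc hp (isSolution_solve hc κ)).2⟩, G, fun κ ψ => ?_, fun h κ => ?_,
    ⟨e, he1, ?_⟩, fun κ => ?_, ?_, fun hi κ h0 => ?_, fun κ => ?_⟩
  · rw [propagation_eq_form hc, hG]
  · rw [hGf, real_inner_comm, hGf, form_symm]
  · refine eq_of_mem_closure_of_inner_eq (hGmem e) (Submodule.zero_mem _) ?_
    rintro _ ⟨ψ, rfl⟩
    rw [inner_zero_left]
    exact (hG e ψ).symm.trans (form_eq_zero_of_grad hc he0 ψ)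
  · rw [hGf, form_self]
    positivity
  · rintro κ ⟨r, hr⟩
    -- only the function `κ` is known to be constant, so its pairing is compared with that of `1`
    have hκ : H2fn κ = r • H2fn e := by
      apply Lp.ext
      filter_upwards [hr, he1, Lp.coeFn_smul r (H2fn e)] with s h1 h2 h3
      rw [h1, h3, Pi.smul_apply, h2, smul_eq_mul, mul_one]
    rw [hκ, real_inner_smul_right, hGf, form_symm, form_eq_zero_of_grad hc he0, mul_zero]
  · rw [hGf] at h0
    exact ae_const_of_mem_H hΓ hc hi (mem_H_of_form_self_eq_zero hc h0)
  · have h1 : ⟪H1grad κ.1, H1grad κ.1⟫ = -⟪laplacian κ, H2fn κ⟫ :=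
      Classical.choose_spec (show ∃ g : L2 Γ, IsLaplacian κ.1 g from κ.2) κ.1
    rw [hGf, neg_smul, inner_neg_left, real_inner_smul_left, ← mul_neg, ← h1,
      real_inner_self_eq_norm_sq]
    exact form_self_le hc κ.1
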